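/- **Setting.** Let $\{Y(\mathbf s):\mathbf s\in\mathbb R^2\}$ be a zero-mean, bounded, (strictly) stationary, measurable random field on a probability space $(\Omega,\mathcal F,P)$, with $\sigma(\mathbf s)=\operatorname{Cov}(Y(\mathbf s),Y(\mathbf 0))$. For $T\subset\mathbb R^2$ let $\mathcal F_Y(T)=\sigma\langle Y(\mathbf s):\mathbf s\in T\rangle$, and let $$\alpha_Y(u;v)=\sup\bigl\{|P(A\cap B)-P(A)P(B)|:\ A\in\mathcal F_Y(T_1),\ B\in\mathcal F_Y(T_2)\bigr\},$$ where the supremum also runs over all finite disjoint unions $T_1,T_2$ of half-open squares $\mathbf x+[0,c)^2$ $(c>0)$, each union of total area at most $v$, with $\|\mathbf x-\mathbf s\|_1\ge u$ for all $\mathbf x\in T_1,\ \mathbf s\in T_2$. Assume that for some constants $C_1,C_2,C_3\in(0,\infty)$ $$\alpha_Y(u;v)\le C_1e^{-C_2u}v^{C_3}\qquad\text{for all } u\ge1,\ v\ge1 .$$ For $a\in(4,\infty)$ let $f_a(x_1,x_2)=g_a(x_1)\,\mathbb 1_{(-1/2,1/2)}(x_2)$, where $g_a$ is the symmetric function with $g_a(x)=a/4$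 for $0\le x\le 1/a$, $g_a(x)=\frac{a}{4(a-3)}$ for $2/a\le x<1/2$, $g_a(x)=0$ for $x\ge1/2$, and $g_a$ linear on $[1/a,2/a]$ (continuously joining the two constants). Let $\mathbf X_1,\mathbf X_2,\dots$ be i.i.d. with density $f_a$, defined on the same probability space and independent of the field $Y$. (Measurability of the field and independence mean: for some $\sigma$-field $\mathcal G\subset\mathcal F$ independent of $(\mathbf X_i)_{i\ge1}$, the map $(\mathbf s,\omega)\mapsto Y(\mathbf s,\omega)$ is $\mathcal B(\mathbb R^2)\otimes\mathcal G$-measurable.) Let $\lambda_n>0$ satisfy $n=(\lambda_n^2)^2$ for $n\ge1$, let $\mathbf s_i=\lambda_n\mathbf X_i$ $(1\le i\le n)$ be the sampling sites in $R_n=(-\lambda_n/2,\lambda_n/2)^2$, let $T_n=n^{-1}\sum_{i=1}^nY(\mathbf s_i)$, and let $$\check\sigma_n^2=\lambda_n^2\operatorname{Var}(T_n\mid\mathbf X_1,\mathbf X_2,\dots),\qquad \sigma_\infty^2=\int_{\mathbb R^2}\sigma(\mathbf s)\,d\mathbf s\int_{\mathbb R^2} f_a^2(\mathbf s)\,d\mathbf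 s .$$ *Data-site-shifted block bootstrap (DSSBB).* Let $b_n>0$ satisfy $b_n^{-1}+b_n/\lambda_n\to0$, with $r_n=\lambda_n/b_n$ an even integer for every $n\ge1$. Let $\mathcal K_n=\{\mathbf k\in\mathbb Z^2:-r_n\le 2k_i<r_n,\ i=1,2\}$ and $\mathcal I_n=\{i\le n:\mathbf s_i+[0,b_n)^2\subset R_n\}$. Given the field and the design, draw for each $\mathbf k\in\mathcal K_n$ independently an index uniformly from $\mathcal I_n$, and let $T_n^{**}$ be the average, counted with multiplicity, of all observations $Y(\mathbf s_j)$ with $\mathbf s_j$ in the $|\mathcal K_n|$ drawn blocks $\mathbf s_i+[0,b_n)^2$. The DSSBB variance estimator is $\hat\sigma_n^2=\lambda_n^2\operatorname{Var}_*(T_n^{**})$, where $\operatorname{Var}_*$ is the variance under this drawing, conditional on the field and the design. (Where $\mathcal I_n=\emptyset$, put $\hat\sigma_n^2=0$.) **Proposition 1.** (i) For every $a\in(4,\infty)$ and every such field and design, $\sigma$ is integrable and $\check\sigma_n^2\to\sigma_\infty^2$ almost surely. (ii) There exist $a\in(4,\infty)$ and $\eta=\eta(a)\in(0,1)$ such that,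 for every such field with $\sigma(\mathbf 0)\ne0$ and $\sigma(\mathbf s)\ge0$ for all $\mathbf s\in\mathbb R^2$, with design density $f_a$ and any $\lambda_n,b_n$ as above, $$\limsup_{n\to\infty}P\bigl(\hat\sigma_n^2>\eta\,\sigma_\infty^2\bigr)<1 .$$ -/

import Mathlib

open MeasureTheory ProbabilityTheory Filter Topology

universe u

noncomputable section

namespace SpatialBootstrap

/-- The plane, with its Lebesgue measure `volume`. No norm of this type is used below. -/
abbrev Plane : Type := ℝ × ℝ

/-- The half-open square `x + [0, c)²`. -/
def square (x : Plane) (c : ℝ) : Set Plane :=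
  Set.Ico x.1 (x.1 + c) ×ˢ Set.Ico x.2 (x.2 + c)

/-- The sampling region `(-l/2, l/2)²`. -/
def region (l : ℝ) : Set Plane :=
  Set.Ioo (-l / 2) (l / 2) ×ˢ Set.Ioo (-l / 2) (l / 2)

/-! ### The random field -/

section Field

variable {Ω : Type u}

/-- Strict stationarity: the finite-dimensional distributions are invariant under translations. -/
def IsStationaryField [MeasurableSpace Ω] (P : Measure Ω) (Y : Plane → Ω → ℝ) : Prop :=
  ∀ (k : ℕ) (s : Fin k → Plane) (h : Plane),
    P.map (fun ω (i : Fin k) => Y (s i + h) ω) = P.map (fun ω (i : Fin k) => Y (s i) ω)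

/-- The σ-field generated by `Y s`, `s ∈ T`. -/
abbrev fieldSigma (Y : Plane → Ω → ℝ) (T : Set Plane) : MeasurableSpace Ω :=
  ⨆ s ∈ T, MeasurableSpace.comap (Y s) inferInstance

/-- Finite disjoint unions of squares (with positive side) of total area at most `b`. -/
def squareUnions (b : ℝ) : Set (Set Plane) :=
  {T | ∃ F : Finset (Plane × ℝ), (∀ q ∈ F, 0 < q.2) ∧
    (F : Set (Plane × ℝ)).PairwiseDisjoint (fun q => square q.1 q.2) ∧
    ∑ q ∈ F, q.2 ^ 2 ≤ b ∧ T = ⋃ q ∈ F, square q.1 q.2}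

/-- `sup |P(A ∩ B) - P(A) P(B)|` over `A` in the σ-field of `T₁` and `B` in that of `T₂`. -/
def alphaSets [MeasurableSpace Ω] (P : Measure Ω) (Y : Plane → Ω → ℝ) (T₁ T₂ : Set Plane) : ℝ :=
  sSup {r | ∃ A B : Set Ω, MeasurableSet[fieldSigma Y T₁] A ∧ MeasurableSet[fieldSigma Y T₂] B ∧
    r = |P.real (A ∩ B) - P.real A * P.real B|}

/-- The strong-mixing coefficient `α(a; b)`: the supremum of `alphaSets` over pairs of finite
disjoint unions of squares, each of area at most `b`, at `ℓ¹`-distance at least `a`. -/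
def alphaMixing [MeasurableSpace Ω] (P : Measure Ω) (Y : Plane → Ω → ℝ) (a b : ℝ) : ℝ :=
  sSup {r | ∃ T₁ ∈ squareUnions b, ∃ T₂ ∈ squareUnions b,
    (∀ x ∈ T₁, ∀ s ∈ T₂, a ≤ |x.1 - s.1| + |x.2 - s.2|) ∧ r = alphaSets P Y T₁ T₂}

/-- The autocovariance function `σ(s) = Cov(Y(s), Y(0))`. -/
def autocov [MeasurableSpace Ω] (P : Measure Ω) (Y : Plane → Ω → ℝ) (s : Plane) : ℝ :=
  cov[Y s, Y 0; P]

/-- A zero-mean bounded stationary random field with exponentially decaying strong mixing. -/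
structure IsMixingField [MeasurableSpace Ω] (P : Measure Ω) (Y : Plane → Ω → ℝ) : Prop where
  measurable : ∀ s, Measurable (Y s)
  bounded : ∃ M : ℝ, ∀ s, ∀ᵐ ω ∂P, |Y s ω| ≤ M
  zero_mean : ∀ s, ∫ ω, Y s ω ∂P = 0
  stationary : IsStationaryField P Y
  mixing : ∃ C₁ C₂ C₃ : ℝ, 0 < C₁ ∧ 0 < C₂ ∧ 0 < C₃ ∧
    ∀ a b : ℝ, 1 ≤ a → 1 ≤ b → alphaMixing P Y a b ≤ C₁ * Real.exp (-C₂ * a) * b ^ C₃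

end Field

/-! ### The stochastic design -/

/-- The symmetric density `g_a` on the line: `a/4` on `[0, 1/a]`, `a/(4(a-3))` on `[2/a, 1/2)`,
linear (and continuous) in between, `0` beyond `1/2`. -/
def lineDensity (a x : ℝ) : ℝ :=
  if |x| ≤ 1 / a then a / 4
  else if |x| ≤ 2 / a then a / 4 + (a * |x| - 1) * (a / (4 * (a - 3)) - a / 4)
  else if |x| < 1 / 2 then a / (4 * (a - 3))
  else 0

/-- The design density `f_a(x₁, x₂) = g_a(x₁) 1_{(-1/2, 1/2)}(x₂)`. -/
def designDensity (a : ℝ) (x : Plane) : ℝ :=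
  lineDensity a x.1 * Set.indicator (Set.Ioo (-1 / 2 : ℝ) (1 / 2)) 1 x.2

section Design

variable {Ω : Type u}

/-- The σ-field generated by the whole design sequence. -/
abbrev designSigma (X : ℕ → Ω → Plane) : MeasurableSpace Ω :=
  ⨆ i, MeasurableSpace.comap (X i) inferInstance

/-- The design variables are i.i.d. with density `f_a`. -/
structure IsDesign [MeasurableSpace Ω] (a : ℝ) (P : Measure Ω) (X : ℕ → Ω → Plane) : Prop where
  measurable : ∀ i, Measurable (X i)
  law : ∀ i, P.map (X i) = volume.withDensity (fun x => ENNReal.ofReal (designDensity a x))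
  indep : iIndepFun X P

/-- The field and the design are independent, and the field is a measurable random field:
for a σ-field `G` independent of the design, `(s, ω) ↦ Y s ω` is jointly measurable with respect
to the Borel sets of the plane and `G`. (Then every `Y s` is `G`-measurable. On a product space
`Ω₁ × Ω₂` with the field on `Ω₁` and the design on `Ω₂`, `G` is the σ-field of the first factor.
Independence of the finite-dimensional distributions of `Y` from the design would not determine
the law of the observations `Y (lam • X i)` at the random sites.) -/
def IsMeasurableIndep {mΩ : MeasurableSpace Ω} (P : Measure Ω) (Y : Plane → Ω → ℝ) (X : ℕ → Ω → Plane) : Prop :=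
  ∃ G : MeasurableSpace Ω, G ≤ mΩ ∧
    Measurable[(inferInstance : MeasurableSpace Plane).prod G] (Function.uncurry Y) ∧
    Indep G (designSigma X) P

/-- The sample mean `T_n` of the observations at the sites `l X_1, …, l X_n`. -/
def sampleMean (Y : Plane → Ω → ℝ) (X : ℕ → Ω → Plane) (n : ℕ) (l : ℝ) (ω : Ω) : ℝ :=
  (n : ℝ)⁻¹ * ∑ i : Fin n, Y (l • X i ω) ω

/-- The scaled conditional variance `l² Var(T_n | X)` of the sample mean given the design. -/
def scaledCondVar [MeasurableSpace Ω] (P : Measure Ω) (Y : Plane → Ω → ℝ) (X : ℕ → Ω → Plane) (n : ℕ) (l : ℝ)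
    (ω : Ω) : ℝ :=
  l ^ 2 * (Var[sampleMean Y X n l; P | designSigma X]) ω

/-- The limit `σ_∞² = ∫ σ(s) ds · ∫ f_a(s)² ds`. -/
def sigmaInftySq [MeasurableSpace Ω] (a : ℝ) (P : Measure Ω) (Y : Plane → Ω → ℝ) : ℝ :=
  (∫ s, autocov P Y s) * ∫ s, designDensity a s ^ 2

end Design

/-! ### The data-site-shifted block bootstrap, for given sites `s` and observations `y` -/

/-- Index set of the cells of the region, `{k ∈ ℤ² : -r ≤ 2 kᵢ < r}`, with `r` the ratio of the
side of the region to the side of a cell. -/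
def cells (r : ℝ) : Finset (ℤ × ℤ) :=
  Finset.Ico ⌈-r / 2⌉ ⌈r / 2⌉ ×ˢ Finset.Ico ⌈-r / 2⌉ ⌈r / 2⌉

/-- The blocks `s i + [0, b)²` that may be drawn: those contained in the region. -/
def admissible {n : ℕ} (l b : ℝ) (s : Fin n → Plane) : Set (Fin n) :=
  {i | square (s i) b ⊆ region l}

open Classical in
/-- The sites in the block that is attached to the `i`-th site. -/
def blockSites {n : ℕ} (b : ℝ) (s : Fin n → Plane) (i : Fin n) : Finset (Fin n) :=
  Finset.univ.filter fun j => s j ∈ square (s i) b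

/-- The average of all resampled observations when cell `k` receives the block `κ k`; observations
are counted with multiplicity. -/
def resampledMean {n : ℕ} (b : ℝ) (s : Fin n → Plane) (y : Fin n → ℝ) {K : Finset (ℤ × ℤ)}
    (κ : K → Fin n) : ℝ :=
  (∑ k, ∑ j ∈ blockSites b s (κ k), y j) / ∑ k, ((blockSites b s (κ k)).card : ℝ)

/-- The DSSBB estimator `l² Var_*(T_n**)`: the variance is taken under the resampling law, in which
the cells receive independent blocks, uniform on the admissible ones. -/
def dssbbVariance {n : ℕ} (l b : ℝ) (s : Fin n → Plane) (y : Fin n → ℝ) : ℝ :=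
  l ^ 2 * Var[fun κ : cells (l / b) → Fin n => resampledMean b s y κ;
    Measure.pi fun _ => uniformOn (admissible l b s)]

/-- The DSSBB estimator evaluated at the random sites and the observations there. -/
def dssbbEstimator {Ω : Type u} (Y : Plane → Ω → ℝ) (X : ℕ → Ω → Plane) (n : ℕ) (l b : ℝ)
    (ω : Ω) : ℝ :=
  dssbbVariance l b (fun i : Fin n => l • X i ω) (fun i : Fin n => Y (l • X i ω) ω)

/-- Scaling sequence: `λ_n > 0` and `n = (λ_n²)²`. -/
def IsScaling (lam : ℕ → ℝ) : Prop :=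
  ∀ n : ℕ, 1 ≤ n → 0 < lam n ∧ (n : ℝ) = (lam n ^ 2) ^ 2

/-- Block lengths: `b_n > 0`, `1/b_n + b_n/λ_n → 0`, and `λ_n/b_n` is an even integer. -/
structure IsBlockLength (lam b : ℕ → ℝ) : Prop where
  pos : ∀ n : ℕ, 1 ≤ n → 0 < b n
  tendsto : Tendsto (fun n => (b n)⁻¹ + b n / lam n) atTop (𝓝 0)
  even : ∀ n : ℕ, 1 ≤ n → ∃ m : ℕ, lam n / b n = 2 * m

theorem mem_cells (r : ℝ) (k : ℤ × ℤ) :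
    k ∈ cells r ↔ (-r ≤ 2 * k.1 ∧ 2 * k.1 < r) ∧ (-r ≤ 2 * k.2 ∧ 2 * k.2 < r) := by
  have h1 : ∀ j : ℤ, (-r / 2 ≤ j ↔ -r ≤ 2 * j) := fun j => by
    constructor <;> intro h <;> linarith
  have h2 : ∀ j : ℤ, ((j : ℝ) < r / 2 ↔ 2 * j < r) := fun j => by
    constructor <;> intro h <;> linarith
  simp only [cells, Finset.mem_product, Finset.mem_Ico, Int.ceil_le, Int.lt_ceil, h1, h2]

/-- For an even ratio, `cells` indexes exactly the lattice cells that meet the region. -/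
theorem mem_cells_iff (m : ℕ) (b : ℝ) (hb : 0 < b) (k : ℤ × ℤ) :
    k ∈ cells (2 * m) ↔ (region (2 * m * b) ∩ square (b * k.1, b * k.2) b).Nonempty := by
  have key : ∀ j : ℤ, ((-(2 * m : ℝ) ≤ 2 * j ∧ 2 * (j : ℝ) < 2 * m) ↔
      ∃ x : ℝ, (-(2 * m * b) / 2 < x ∧ x < 2 * m * b / 2) ∧ b * j ≤ x ∧ x < b * j + b) := by
    intro j
    constructor
    · rintro ⟨h1, h2⟩
      have h3 : (j : ℝ) + 1 ≤ m := by
        have : j < (m : ℤ) := by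
          have : (j : ℝ) < ((m : ℤ) : ℝ) := by push_cast; linarith
          exact_mod_cast this
        have : j + 1 ≤ (m : ℤ) := this
        exact_mod_cast this
      refine ⟨b * j + b / 2, ⟨?_, ?_⟩, ?_, ?_⟩ <;> nlinarith
    · rintro ⟨x, ⟨h1, h2⟩, h3, h4⟩
      constructor
      · have h5 : -(m : ℝ) < j + 1 := by
          by_contra hc
          push Not at hc
          nlinarith
        have : -(m : ℤ) < j + 1 := by exact_mod_cast h5
        have h6 : -(m : ℤ) ≤ j := by omega
        have : -(m : ℝ) ≤ j := by exact_mod_cast h6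
        linarith
      · by_contra hc
        push Not at hc
        nlinarith
  rw [mem_cells, key, key]
  constructor
  · rintro ⟨⟨x, hx, hx'⟩, ⟨y, hy, hy'⟩⟩
    exact ⟨(x, y), ⟨hx, hy⟩, ⟨hx', hy'⟩⟩
  · rintro ⟨⟨x, y⟩, ⟨hx, hy⟩, ⟨hx', hy'⟩⟩
    exact ⟨⟨x, hx, hx'⟩, ⟨y, hy, hy'⟩⟩

end SpatialBootstrap

end

/-!
Both parts rest on conditioning on the design. As the field is jointly measurable with respect to a
σ-field independent of the design, the conditional law of the observations given the design is the
law of the field at frozen sites (`condExp_observations`). In particular the conditional second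
moment of a sum of observations, with weights that depend on the design, is the corresponding double
sum of autocovariances (`condExp_sq_weighted_sum`).

**Part (i).** Hoeffding's covariance identity and strong mixing give exponential decay of `σ`, so
`σ` is bounded and integrable. The scaled conditional variance is
`λ² n⁻² ∑ᵢⱼ σ(λ(Xᵢ - Xⱼ))`, a U-statistic with the `n`-dependent kernel `λ² σ(λ(x - y))`, up to a
diagonal of order `λ²/n`. Its mean tends to `∫ σ ∫ f²` (`tendsto_integral_kernel`). In the Hoeffding
decomposition the linear part is an average of uniformly bounded i.i.d. variables, which Hoeffding's
exponential inequality controls, and the degenerate part has second moment of order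
`λ²/n² = n^(-3/2)`, which is summable; the Borel–Cantelli lemma yields almost sure convergence
(`ae_tendsto_pairSum`).

**Part (ii).** The blocks are attached to design points and are pooled with multiplicity, so dense
regions of the design enter twice. Heuristically, with block sums `Sᵢ` and block counts `Nᵢ` over
`K = (λ/b)²` draws, the bootstrap variance is about `λ² K⁻¹ E S² / (E N)²`. Near the central strip,
of width `2/a` and of mass about one half, `N` is of order `a λ² b²`, so `(E N)²` is of order
`a² λ⁴ b⁴`, while `E S²` is at most of order `a² λ⁴ b² · ∫ σ`. Hence the estimator stays bounded by
a constant times `∫ σ`, uniformly in `a`, whereas `σ_∞² ≥ (a/8) ∫ σ`. For large `a` the estimator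
is therefore below `σ_∞² / 2` with a probability that does not vanish.

To make this rigorous, the Efron–Stein inequality bounds the variance of the ratio
`∑ S / ∑ N` by moments of `S` and `N` and by negative moments of partial sums of `N`
(`variance_ratio_le`), which leads to a bound that is deterministic in the sites and the
observations (`dssbbVariance_le`). Its hypotheses are lower bounds for the block counts; they hold
with probability tending to one, by Chebyshev's inequality for the cells of a grid of half the block
size (`measure_not_isRegularAt_le`). The averages of `Sᵢ²` and `Nᵢ²` that remain are bounded in
mean by sorting triples of sites according to coincidences (`lintegral_pairs_inBlock_le`); for
`Sᵢ²` this is where `σ ≥ 0` enters, as it allows bounding the design density by `a/4`. Markov's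
inequality finishes the argument (`limsup_measure_dssbbEstimator_gt_lt_one`), given `∫ σ > 0`
(`integral_autocov_pos`): otherwise `σ` vanishes almost everywhere, the integrals of the field over
all sets are zero, and so is the field.
-/


noncomputable section

namespace SpatialBootstrap

/-! ### Covariance inequality under strong mixing -/

/-- **Covariance inequality under strong mixing.** By Hoeffding's identity the covariance is the
integral of `P(s < U, t < V) - P(s < U) P(t < V)` over `[-M, M]²`. -/
theorem abs_covariance_le_of_levelSets {Ω : Type*} [MeasurableSpace Ω] {P : Measure Ω}
    [IsProbabilityMeasure P] {U V : Ω → ℝ} (hU : Measurable U) (hV : Measurable V) {M α : ℝ}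
    (hUM : ∀ᵐ ω ∂P, |U ω| ≤ M) (hVM : ∀ᵐ ω ∂P, |V ω| ≤ M)
    (hα : ∀ s t : ℝ, |P.real ({ω | s < U ω} ∩ {ω | t < V ω}) -
      P.real {ω | s < U ω} * P.real {ω | t < V ω}| ≤ α) :
    |cov[U, V; P]| ≤ 4 * M ^ 2 * α := by
  have hM : 0 ≤ M := by
    obtain ⟨ω, hω⟩ := hUM.exists
    exact (abs_nonneg _).trans hω
  set ν : Measure ℝ := volume.restrict (Set.Ioc (-M) M) with hν
  have hνu : ν.real Set.univ = 2 * M := by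
    simp only [hν, Measure.real, Measure.restrict_apply_univ, Real.volume_Ioc]
    rw [ENNReal.toReal_ofReal (by linarith)]; ring
  let F : (Ω → ℝ) → ℝ → Ω → ℝ := fun W s ω => if s < W ω then 1 else 0
  have hFm : ∀ W : Ω → ℝ, Measurable W → Measurable (Function.uncurry (F W)) := fun W hW =>
    Measurable.ite (measurableSet_lt measurable_fst (hW.comp measurable_snd))
      measurable_const measurable_const
  have hF1 : ∀ W s ω, ‖F W s ω‖ ≤ 1 := fun W s ω => by
    simp only [F]; split_ifs <;> simp
  have hlayer : ∀ W : Ω → ℝ, ∀ ω, |W ω| ≤ M → ∫ s, F W s ω ∂ν = W ω + M := fun W ω h => by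
    rw [abs_le] at h
    have h1 : (fun s => F W s ω) = (Set.Iio (W ω)).indicator 1 := by
      ext s; simp [F, Set.indicator_apply]
    rw [h1, integral_indicator_one measurableSet_Iio, hν, measureReal_restrict_apply measurableSet_Iio]
    have h2 : Set.Iio (W ω) ∩ Set.Ioc (-M) M = Set.Ioo (-M) (W ω) := by
      ext s
      simp only [Set.mem_inter_iff, Set.mem_Iio, Set.mem_Ioc, Set.mem_Ioo]
      constructor
      · rintro ⟨a, b, c⟩
        exact ⟨b, a⟩
      · rintro ⟨a, b⟩
        exact ⟨b, a, by linarith⟩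
    rw [h2]
    simp only [Measure.real, Real.volume_Ioo]
    rw [ENNReal.toReal_ofReal (by linarith)]; ring
  have hPF : ∀ W : Ω → ℝ, Measurable W → ∀ s, ∫ ω, F W s ω ∂P = P.real {ω | s < W ω} := by
    intro W hW s
    have h1 : F W s = ({ω | s < W ω}).indicator 1 := by
      ext ω; simp [F, Set.indicator_apply]
    rw [h1, integral_indicator_one (measurableSet_lt measurable_const hW)]
  have hE1 : ∀ W : Ω → ℝ, Measurable W → (∀ᵐ ω ∂P, |W ω| ≤ M) →
      ∫ ω, (W ω + M) ∂P = ∫ s, P.real {ω | s < W ω} ∂ν := by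
    intro W hW hWM
    have h1 : ∫ ω, (W ω + M) ∂P = ∫ ω, ∫ s, F W s ω ∂ν ∂P :=
      integral_congr_ae (hWM.mono fun ω h => (hlayer W ω h).symm)
    rw [h1, ← integral_integral_swap]
    · exact integral_congr_ae (Eventually.of_forall fun s => hPF W hW s)
    · exact Integrable.of_bound (hFm W hW).aestronglyMeasurable 1
        (Eventually.of_forall fun z => hF1 W z.1 z.2)
  have hE2 : ∫ ω, (U ω + M) * (V ω + M) ∂P =
      ∫ z, P.real ({ω | z.1 < U ω} ∩ {ω | z.2 < V ω}) ∂(ν.prod ν) := by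
    have h1 : ∫ ω, (U ω + M) * (V ω + M) ∂P
        = ∫ ω, ∫ z, F U z.1 ω * F V z.2 ω ∂(ν.prod ν) ∂P := by
      refine integral_congr_ae ?_
      filter_upwards [hUM, hVM] with ω h1 h2
      rw [integral_prod_mul (fun s => F U s ω) (fun s => F V s ω), hlayer U ω h1, hlayer V ω h2]
    rw [h1, ← integral_integral_swap (f := fun (z : ℝ × ℝ) ω => F U z.1 ω * F V z.2 ω)]
    · refine integral_congr_ae (Eventually.of_forall fun z => ?_)
      have h2 : (fun ω => F U z.1 ω * F V z.2 ω) =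
          ({ω | z.1 < U ω} ∩ {ω | z.2 < V ω}).indicator 1 := by
        ext ω
        by_cases h3 : z.1 < U ω <;> by_cases h4 : z.2 < V ω <;>
          simp [F, h3, h4]
      simp only
      rw [h2, integral_indicator_one ((measurableSet_lt measurable_const hU).inter
        (measurableSet_lt measurable_const hV))]
    · refine Integrable.of_bound (C := 1) ?_ (Eventually.of_forall fun z => ?_)
      · refine Measurable.aestronglyMeasurable (Measurable.mul ?_ ?_)
        · exact (hFm U hU).comp ((measurable_fst.comp measurable_fst).prodMk measurable_snd)
        · exact (hFm V hV).comp ((measurable_snd.comp measurable_fst).prodMk measurable_snd)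
      · simp only [Function.uncurry, norm_mul]
        exact mul_le_one₀ (hF1 _ _ _) (norm_nonneg _) (hF1 _ _ _)
  have hUL : MemLp (fun ω => U ω + M) 2 P := MemLp.of_bound (hU.add_const M).aestronglyMeasurable
    (2 * M) (hUM.mono fun ω h => by rw [Real.norm_eq_abs]; rw [abs_le] at *; constructor <;> linarith)
  have hVL : MemLp (fun ω => V ω + M) 2 P := MemLp.of_bound (hV.add_const M).aestronglyMeasurable
    (2 * M) (hVM.mono fun ω h => by rw [Real.norm_eq_abs]; rw [abs_le] at *; constructor <;> linarith)
  have hUi : Integrable U P := Integrable.of_bound hU.aestronglyMeasurable M hUM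
  have hVi : Integrable V P := Integrable.of_bound hV.aestronglyMeasurable M hVM
  have hcov : cov[U, V; P] = ∫ z, (P.real ({ω | z.1 < U ω} ∩ {ω | z.2 < V ω}) -
      P.real {ω | z.1 < U ω} * P.real {ω | z.2 < V ω}) ∂(ν.prod ν) := by
    rw [← covariance_add_const_right hVi M, ← covariance_add_const_left hUi M,
      covariance_eq_sub hUL hVL]
    have hmeas : ∀ W : Ω → ℝ, Measurable W → Measurable fun s : ℝ => P.real {ω | s < W ω} := by
      intro W hW
      exact (measurable_measure_prodMk_left
        (measurableSet_lt measurable_fst (hW.comp measurable_snd) :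
          MeasurableSet {z : ℝ × Ω | z.1 < W z.2})).ennreal_toReal
    rw [integral_sub]
    · rw [integral_prod_mul (fun s => P.real {ω | s < U ω}) (fun s => P.real {ω | s < V ω}),
        ← hE1 U hU hUM, ← hE1 V hV hVM, ← hE2]
      rfl
    · refine Integrable.of_bound (C := 1) (Measurable.aestronglyMeasurable ?_)
        (Eventually.of_forall fun z => ?_)
      · exact (measurable_measure_prodMk_left
          ((measurableSet_lt (measurable_fst.comp measurable_fst) (hU.comp measurable_snd)).inter
          (measurableSet_lt (measurable_snd.comp measurable_fst) (hV.comp measurable_snd)) :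
          MeasurableSet ({z : (ℝ × ℝ) × Ω | z.1.1 < U z.2} ∩ {z | z.1.2 < V z.2}))).ennreal_toReal
      · rw [Real.norm_of_nonneg measureReal_nonneg]; exact measureReal_le_one
    · refine Integrable.of_bound (C := 1) (Measurable.aestronglyMeasurable ?_)
        (Eventually.of_forall fun z => ?_)
      · exact ((hmeas U hU).comp measurable_fst).mul ((hmeas V hV).comp measurable_snd)
      · rw [Real.norm_of_nonneg (mul_nonneg measureReal_nonneg measureReal_nonneg)]
        exact mul_le_one₀ measureReal_le_one measureReal_nonneg measureReal_le_one
  rw [hcov, ← Real.norm_eq_abs]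
  refine (norm_integral_le_of_norm_le_const (C := α) (Eventually.of_forall fun z => hα _ _)).trans
    (le_of_eq ?_)
  have : (ν.prod ν).real Set.univ = (2 * M) * (2 * M) := by
    rw [← Set.univ_prod_univ, measureReal_prod_prod, hνu]
  rw [this]; ring

/-! ### The autocovariance function and conditioning on the design -/

theorem autocov_eq_integral {Ω : Type u} [MeasurableSpace Ω] {P : Measure Ω} {Y : Plane → Ω → ℝ}
    (hY : IsMixingField P Y) (s : Plane) : autocov P Y s = ∫ ω, Y s ω * Y 0 ω ∂P := by
  simp [autocov, covariance, hY.zero_mean]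

/-- By stationarity the covariance of two observations depends on their difference only. -/
theorem integral_mul_eq_autocov {Ω : Type u} [MeasurableSpace Ω] {P : Measure Ω}
    {Y : Plane → Ω → ℝ} (hY : IsMixingField P Y) (s t : Plane) :
    ∫ ω, Y s ω * Y t ω ∂P = autocov P Y (s - t) := by
  rw [autocov_eq_integral hY]
  have h := hY.stationary 2 ![s - t, 0] t
  have hm : ∀ u : Fin 2 → Plane, Measurable fun ω (i : Fin 2) => Y (u i) ω := fun u =>
    measurable_pi_iff.2 fun i => hY.measurable _
  have hg : AEStronglyMeasurable (fun v : Fin 2 → ℝ => v 0 * v 1)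
      (P.map fun ω (i : Fin 2) => Y (![s - t, 0] i + t) ω) := by
    apply Measurable.aestronglyMeasurable; fun_prop
  have h1 := integral_map (hm fun i => ![s - t, 0] i + t).aemeasurable hg
  rw [h] at h1 hg
  rw [integral_map (hm ![s - t, 0]).aemeasurable hg] at h1
  simpa using h1.symm

theorem autocov_neg {Ω : Type u} [MeasurableSpace Ω] {P : Measure Ω} {Y : Plane → Ω → ℝ}
    (hY : IsMixingField P Y) (s : Plane) : autocov P Y (-s) = autocov P Y s := by
  rw [← zero_sub, ← integral_mul_eq_autocov hY, autocov_eq_integral hY]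
  simp_rw [mul_comm]

theorem abs_autocov_le_sq {Ω : Type u} [MeasurableSpace Ω] {P : Measure Ω} [IsProbabilityMeasure P]
    {Y : Plane → Ω → ℝ} (hY : IsMixingField P Y) {M : ℝ} (hM : ∀ s, ∀ᵐ ω ∂P, |Y s ω| ≤ M)
    (s : Plane) : |autocov P Y s| ≤ M ^ 2 := by
  rw [autocov_eq_integral hY, ← Real.norm_eq_abs]
  refine (norm_integral_le_of_norm_le_const (C := M ^ 2) ?_).trans (by simp)
  filter_upwards [hM s, hM 0] with ω h1 h2
  rw [norm_mul, sq]
  exact mul_le_mul h1 h2 (abs_nonneg _) ((abs_nonneg _).trans h1)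

theorem exists_abs_autocov_le {Ω : Type u} [MeasurableSpace Ω] {P : Measure Ω}
    [IsProbabilityMeasure P] {Y : Plane → Ω → ℝ} (hY : IsMixingField P Y) :
    ∃ C, 0 < C ∧ ∀ s, |autocov P Y s| ≤ C := by
  obtain ⟨M, hM⟩ := hY.bounded
  exact ⟨M ^ 2 + 1, by positivity, fun s => (abs_autocov_le_sq hY hM s).trans (by linarith)⟩

theorem abs_measureReal_inter_sub_le_one {Ω : Type*} [MeasurableSpace Ω] (P : Measure Ω)
    [IsProbabilityMeasure P] (A B : Set Ω) : |P.real (A ∩ B) - P.real A * P.real B| ≤ 1 := by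
  have h1 : P.real (A ∩ B) ≤ 1 := measureReal_le_one
  have h2 : 0 ≤ P.real (A ∩ B) := measureReal_nonneg
  have h3 : P.real A * P.real B ≤ 1 :=
    mul_le_one₀ measureReal_le_one measureReal_nonneg measureReal_le_one
  have h4 : 0 ≤ P.real A * P.real B := mul_nonneg measureReal_nonneg measureReal_nonneg
  rw [abs_le]; constructor <;> linarith

/-- The defining set of the mixing coefficient is bounded, so its supremum is no junk value. -/
theorem le_alphaMixing {Ω : Type u} [MeasurableSpace Ω] (P : Measure Ω)
    [IsProbabilityMeasure P] (Y : Plane → Ω → ℝ) {a b : ℝ} {T₁ T₂ : Set Plane}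
    (h₁ : T₁ ∈ squareUnions b) (h₂ : T₂ ∈ squareUnions b)
    (hd : ∀ x ∈ T₁, ∀ s ∈ T₂, a ≤ |x.1 - s.1| + |x.2 - s.2|) {A B : Set Ω}
    (hA : MeasurableSet[fieldSigma Y T₁] A) (hB : MeasurableSet[fieldSigma Y T₂] B) :
    |P.real (A ∩ B) - P.real A * P.real B| ≤ alphaMixing P Y a b := by
  refine le_trans (le_csSup ⟨1, ?_⟩ ⟨A, B, hA, hB, rfl⟩ : _ ≤ alphaSets P Y T₁ T₂)
    (le_csSup ⟨1, ?_⟩ ⟨T₁, h₁, T₂, h₂, hd, rfl⟩)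
  · rintro _ ⟨A, B, -, -, rfl⟩
    exact abs_measureReal_inter_sub_le_one P A B
  · rintro _ ⟨T₁, -, T₂, -, -, rfl⟩
    refine Real.sSup_le ?_ zero_le_one
    rintro _ ⟨A, B, -, -, rfl⟩
    exact abs_measureReal_inter_sub_le_one P A B

theorem square_one_mem_squareUnions (x : Plane) : square x 1 ∈ squareUnions 1 :=
  ⟨{(x, 1)}, by simp, by simp, by simp, by simp⟩

theorem measurable_fieldSigma {Ω : Type u} {Y : Plane → Ω → ℝ} {T : Set Plane} {s : Plane}
    (hs : s ∈ T) : Measurable[fieldSigma Y T] (Y s) := by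
  rw [measurable_iff_comap_le]
  exact le_iSup₂ (f := fun s (_ : s ∈ T) => MeasurableSpace.comap (Y s) inferInstance) s hs

/-- The autocovariance decays exponentially in the `ℓ¹`-norm of the lag. -/
theorem exists_abs_autocov_le_exp {Ω : Type u} [MeasurableSpace Ω] {P : Measure Ω}
    [IsProbabilityMeasure P] {Y : Plane → Ω → ℝ} (hY : IsMixingField P Y) :
    ∃ C c : ℝ, 0 < c ∧ ∀ s, |autocov P Y s| ≤ C * (Real.exp (-c * |s.1|) * Real.exp (-c * |s.2|)) := by
  obtain ⟨M, hM⟩ := hY.bounded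
  obtain ⟨C₁, c, C₃, hC₁, hc, -, hα⟩ := hY.mixing
  refine ⟨M ^ 2 * Real.exp (3 * c) + 4 * M ^ 2 * (C₁ * Real.exp (2 * c)), c, hc, fun s => ?_⟩
  rw [← Real.exp_add, add_mul]
  set d := |s.1| + |s.2| with hd
  have hE : -c * |s.1| + -c * |s.2| = -c * d := by rw [hd]; ring
  rw [hE]
  rcases lt_or_ge d 3 with h | h
  · have h1 : M ^ 2 * Real.exp (3 * c) * Real.exp (-c * d) ≥ M ^ 2 := by
      rw [mul_assoc, ← Real.exp_add]
      have : 1 ≤ Real.exp (3 * c + -c * d) := Real.one_le_exp (by nlinarith)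
      nlinarith [sq_nonneg M]
    have h2 : 0 ≤ 4 * M ^ 2 * (C₁ * Real.exp (2 * c)) * Real.exp (-c * d) := by positivity
    linarith [abs_autocov_le_sq hY hM s]
  · have h2 : |autocov P Y s| ≤ 4 * M ^ 2 * alphaMixing P Y (d - 2) 1 := by
      refine abs_covariance_le_of_levelSets (hY.measurable s) (hY.measurable 0) (hM s) (hM 0)
        fun p q => ?_
      -- unit squares at the two points keep a distance of at least `d - 2`
      refine le_alphaMixing P Y (square_one_mem_squareUnions s) (square_one_mem_squareUnions 0)
        ?_ ?_ ?_
      · rintro x ⟨⟨h1, h2⟩, h3, h4⟩ t ⟨⟨h5, h6⟩, h7, h8⟩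
        simp only [Prod.fst_zero, Prod.snd_zero, zero_add] at *
        have e1 : |s.1| ≤ |x.1 - t.1| + 1 := by
          cases abs_cases s.1 <;> cases abs_cases (x.1 - t.1) <;> linarith
        have e2 : |s.2| ≤ |x.2 - t.2| + 1 := by
          cases abs_cases s.2 <;> cases abs_cases (x.2 - t.2) <;> linarith
        linarith
      · exact measurable_fieldSigma (by simp [square]) measurableSet_Ioi
      · exact measurable_fieldSigma (by simp [square]) measurableSet_Ioi
    have h3 := hα (d - 2) 1 (by linarith) le_rfl
    rw [Real.one_rpow, mul_one] at h3
    have h4 : C₁ * Real.exp (-c * (d - 2)) = C₁ * Real.exp (2 * c) * Real.exp (-c * d) := by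
      rw [mul_assoc, ← Real.exp_add]; ring_nf
    have h5 : 0 ≤ M ^ 2 * Real.exp (3 * c) * Real.exp (-c * d) := by positivity
    have h6 : 4 * M ^ 2 * alphaMixing P Y (d - 2) 1
        ≤ 4 * M ^ 2 * (C₁ * Real.exp (2 * c)) * Real.exp (-c * d) := by
      rw [mul_assoc (4 * M ^ 2), ← h4]
      exact mul_le_mul_of_nonneg_left h3 (by positivity)
    linarith

theorem integrable_exp_neg_mul_abs {c : ℝ} (hc : 0 < c) :
    Integrable fun x : ℝ => Real.exp (-c * |x|) := by
  rw [← integrableOn_univ, ← Set.Iic_union_Ioi (a := (0 : ℝ))]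
  refine IntegrableOn.union ?_ ?_
  · refine (integrableOn_exp_mul_Iic hc 0).congr_fun (fun x hx => ?_) measurableSet_Iic
    simp only [abs_of_nonpos (Set.mem_Iic.1 hx)]; ring_nf
  · refine (integrableOn_exp_mul_Ioi (a := -c) (by linarith) 0).congr_fun (fun x hx => ?_)
      measurableSet_Ioi
    simp only [abs_of_pos (Set.mem_Ioi.1 hx)]

theorem measurable_autocov {Ω : Type u} [mΩ : MeasurableSpace Ω] {P : Measure Ω}
    [IsProbabilityMeasure P] {Y : Plane → Ω → ℝ} (hY : IsMixingField P Y)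
    (hm : Measurable (Function.uncurry Y)) : Measurable (autocov P Y) := by
  have h : autocov P Y = fun s => ∫ ω, Y s ω * Y 0 ω ∂P := funext (autocov_eq_integral hY)
  rw [h]
  have h2 : Measurable (Function.uncurry fun (s : Plane) ω => Y s ω * Y 0 ω) :=
    hm.mul ((hY.measurable 0).comp measurable_snd)
  exact h2.stronglyMeasurable.integral_prod_right.measurable

theorem integrable_autocov {Ω : Type u} [MeasurableSpace Ω] {P : Measure Ω}
    [IsProbabilityMeasure P] {Y : Plane → Ω → ℝ} (hY : IsMixingField P Y)
    (hm : Measurable (Function.uncurry Y)) : Integrable (autocov P Y) := by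
  obtain ⟨C, c, hc, h⟩ := exists_abs_autocov_le_exp hY
  have h1 : Integrable fun s : Plane => C * (Real.exp (-c * |s.1|) * Real.exp (-c * |s.2|)) :=
    ((integrable_exp_neg_mul_abs hc).mul_prod (integrable_exp_neg_mul_abs hc)).const_mul C
  exact h1.mono' (measurable_autocov hY hm).aestronglyMeasurable (Eventually.of_forall h)

/-- If `ξ` and `ζ` are independent, conditioning `F (ξ, ζ)` on `ζ` integrates out `ξ`. -/
theorem condExp_comp_of_indepFun {Ω A B : Type*} [mΩ : MeasurableSpace Ω] [MeasurableSpace A]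
    [MeasurableSpace B] {P : Measure Ω} [IsProbabilityMeasure P] {ξ : Ω → A} {ζ : Ω → B}
    (hξ : Measurable ξ) (hζ : Measurable ζ) (h : IndepFun ξ ζ P) {F : A → B → ℝ}
    (hF : Measurable (Function.uncurry F)) {C : ℝ} (hC : ∀ z, ∀ᵐ ω ∂P, |F (ξ ω) z| ≤ C) :
    Integrable (fun ω => F (ξ ω) (ζ ω)) P ∧
    P[fun ω => F (ξ ω) (ζ ω) | MeasurableSpace.comap ζ inferInstance] =ᵐ[P]
      fun ω => ∫ ω', F (ξ ω') (ζ ω) ∂P := by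
  have := Measure.isProbabilityMeasure_map (μ := P) hξ.aemeasurable
  have := Measure.isProbabilityMeasure_map (μ := P) hζ.aemeasurable
  have hlaw := (indepFun_iff_map_prod_eq_prod_map_map hζ.aemeasurable hξ.aemeasurable).1 h.symm
  have hFs : Measurable fun p : B × A => F p.2 p.1 := hF.comp measurable_swap
  have hint : Integrable (fun p : B × A => F p.2 p.1) ((P.map ζ).prod (P.map ξ)) := by
    refine Integrable.of_bound hFs.aestronglyMeasurable C ?_
    simp only [Real.norm_eq_abs]
    refine (Measure.ae_prod_iff_ae_ae (measurableSet_le hFs.abs measurable_const)).2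
      (Eventually.of_forall fun z => ?_)
    exact (ae_map_iff hξ.aemeasurable
      (measurableSet_le (hFs.comp measurable_prodMk_left).abs measurable_const)).2 (hC z)
  have hpair : Measurable fun ω => (ζ ω, ξ ω) := hζ.prodMk hξ
  have hF1 : Integrable (fun ω => F (ξ ω) (ζ ω)) P := by
    rw [← hlaw] at hint
    exact hint.comp_measurable hpair
  have hg : ∀ z, ∫ ω, F (ξ ω) z ∂P = ∫ a, F a z ∂(P.map ξ) := fun z =>
    (integral_map hξ.aemeasurable (hFs.comp measurable_prodMk_left).aestronglyMeasurable).symm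
  have hgm : Measurable fun z => ∫ a, F a z ∂(P.map ξ) :=
    hFs.stronglyMeasurable.integral_prod_right'.measurable
  have hgi : Integrable (fun z => ∫ a, F a z ∂(P.map ξ)) (P.map ζ) := hint.integral_prod_left
  refine ⟨hF1, (ae_eq_condExp_of_forall_setIntegral_eq hζ.comap_le hF1 ?_ ?_ ?_).symm⟩
  · intro s _ _
    simp_rw [hg]
    exact (hgi.comp_measurable hζ).integrableOn
  · rintro _ ⟨t, ht, rfl⟩ -
    simp_rw [hg]
    have e1 : ∫ ω in ζ ⁻¹' t, ∫ a, F a (ζ ω) ∂(P.map ξ) ∂P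
        = ∫ z in t, ∫ a, F a z ∂(P.map ξ) ∂(P.map ζ) :=
      (setIntegral_map ht hgm.aestronglyMeasurable hζ.aemeasurable).symm
    have e2 : ∫ ω in ζ ⁻¹' t, F (ξ ω) (ζ ω) ∂P
        = ∫ p in t ×ˢ Set.univ, F p.2 p.1 ∂((P.map ζ).prod (P.map ξ)) := by
      rw [← hlaw, setIntegral_map (ht.prod .univ) hFs.aestronglyMeasurable hpair.aemeasurable]
      congr 2
      ext ω; simp
    rw [e1, e2, setIntegral_prod _ hint.integrableOn]
    simp
  · simp_rw [hg]
    exact ((hgm.comp (comap_measurable ζ)).stronglyMeasurable).aestronglyMeasurable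

theorem designSigma_eq_comap {Ω : Type u} (X : ℕ → Ω → Plane) :
    designSigma X = MeasurableSpace.comap (fun ω i => X i ω) inferInstance := by
  simp only [designSigma, MeasurableSpace.pi, MeasurableSpace.comap_iSup, MeasurableSpace.comap_comp]
  rfl

/-- Given the design, a bounded functional of the field and the design has the mean it has with the
design frozen. -/
theorem condExp_field_of_isMeasurableIndep {Ω : Type u} {G : MeasurableSpace Ω} [mΩ : MeasurableSpace Ω] {P : Measure Ω}
    [IsProbabilityMeasure P] {X : ℕ → Ω → Plane} (hX : ∀ i, Measurable (X i))
    (hG : G ≤ mΩ) (hi : Indep G (designSigma X) P)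
    {F : Ω → (ℕ → Plane) → ℝ}
    (hF : Measurable[G.prod (inferInstance : MeasurableSpace (ℕ → Plane))] (Function.uncurry F))
    {C : ℝ} (hC : ∀ z, ∀ᵐ ω ∂P, |F ω z| ≤ C) :
    Integrable (fun ω => F ω fun i => X i ω) P ∧
    P[fun ω => F ω fun i => X i ω | designSigma X] =ᵐ[P] fun ω => ∫ ω', F ω' (fun i => X i ω) ∂P := by
  rw [designSigma_eq_comap] at hi ⊢
  refine @condExp_comp_of_indepFun Ω Ω (ℕ → Plane) mΩ G inferInstance P _ id _
    (measurable_id'' hG) (measurable_pi_iff.2 hX) ?_ F hF C hC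
  refine (@IndepFun_iff_Indep Ω Ω (ℕ → Plane) mΩ G inferInstance id _ P).2 ?_
  rw [MeasurableSpace.comap_id]
  exact hi

/-! ### Conditional moments of sums of observations given the design -/

theorem measurable_uncurry_of_isMeasurableIndep {Ω : Type u} [MeasurableSpace Ω] {P : Measure Ω}
    {Y : Plane → Ω → ℝ} {X : ℕ → Ω → Plane} (h : IsMeasurableIndep P Y X) :
    Measurable (Function.uncurry Y) := by
  obtain ⟨G, hG, hYG, -⟩ := h
  exact hYG.mono (sup_le_sup le_rfl (MeasurableSpace.comap_mono hG)) le_rfl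

theorem measurable_observations {A : Type u} [MeasurableSpace A] {Y : Plane → A → ℝ}
    (hY : Measurable (Function.uncurry Y)) {Φ : (ℕ → Plane) → (ℕ → ℝ) → ℝ}
    (hΦ : Measurable (Function.uncurry Φ)) (l : ℝ) :
    Measurable (Function.uncurry fun (ω : A) (x : ℕ → Plane) => Φ x fun j => Y (l • x j) ω) := by
  have h : Measurable fun p : A × (ℕ → Plane) => (p.2, fun j => Y (l • p.2 j) p.1) := by
    refine measurable_snd.prodMk (measurable_pi_lambda _ fun j => ?_)
    have h1 : Measurable fun p : A × (ℕ → Plane) => l • p.2 j :=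
      ((measurable_pi_apply j).comp measurable_snd).const_smul l
    exact hY.comp (h1.prodMk measurable_fst)
  exact hΦ.comp h

/-- Given the design, a bounded functional of the design and the observations has the mean it has
with the sites frozen. -/
theorem condExp_observations {Ω : Type u} [mΩ : MeasurableSpace Ω] {P : Measure Ω}
    [IsProbabilityMeasure P] {Y : Plane → Ω → ℝ} {X : ℕ → Ω → Plane} (hX : ∀ i, Measurable (X i))
    (hYX : IsMeasurableIndep P Y X) (l : ℝ) {Φ : (ℕ → Plane) → (ℕ → ℝ) → ℝ}
    (hΦ : Measurable (Function.uncurry Φ)) {C : ℝ}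
    (hC : ∀ x : ℕ → Plane, ∀ᵐ ω ∂P, |Φ x (fun j => Y (l • x j) ω)| ≤ C) :
    Integrable (fun ω => Φ (fun i => X i ω) (fun j => Y (l • X j ω) ω)) P ∧
    P[fun ω => Φ (fun i => X i ω) (fun j => Y (l • X j ω) ω) | designSigma X] =ᵐ[P]
      fun ω => ∫ ω', Φ (fun i => X i ω) (fun j => Y (l • X j ω) ω') ∂P := by
  obtain ⟨G, hG, hYG, hi⟩ := hYX
  refine condExp_field_of_isMeasurableIndep (mΩ := mΩ) hX hG hi
    (F := fun ω x => Φ x (fun j => Y (l • x j) ω)) ?_ hC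
  exact @measurable_observations Ω G Y hYG Φ hΦ l

theorem ae_abs_sum_le {Ω ι : Type*} [MeasurableSpace Ω] {P : Measure Ω} {s : Finset ι}
    {f : ι → Ω → ℝ} {M : ℝ} (h : ∀ i ∈ s, ∀ᵐ ω ∂P, |f i ω| ≤ M) :
    ∀ᵐ ω ∂P, |∑ i ∈ s, f i ω| ≤ s.card * M := by
  have h1 : ∀ᵐ ω ∂P, ∀ i ∈ s, |f i ω| ≤ M := (Finset.eventually_all s).2 h
  filter_upwards [h1] with ω hω
  refine (Finset.abs_sum_le_sum_abs _ _).trans ((Finset.sum_le_card_nsmul _ _ _ hω).trans ?_)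
  simp

/-- Conditional mean of a weighted sum of observations, with weights depending on the design. -/
theorem condExp_weighted_sum {Ω : Type u} [MeasurableSpace Ω] {P : Measure Ω}
    [IsProbabilityMeasure P] {Y : Plane → Ω → ℝ} {X : ℕ → Ω → Plane} (hY : IsMixingField P Y)
    (hX : ∀ i, Measurable (X i)) (hYX : IsMeasurableIndep P Y X) (l : ℝ) (s : Finset ℕ)
    {w : ℕ → (ℕ → Plane) → ℝ} (hw : ∀ j, Measurable (w j)) (hw1 : ∀ j x, |w j x| ≤ 1) :
    P[fun ω => ∑ j ∈ s, w j (fun i => X i ω) * Y (l • X j ω) ω | designSigma X] =ᵐ[P] 0 := by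
  obtain ⟨M, hM⟩ := hY.bounded
  have h := (condExp_observations (C := s.card * M) hX hYX l
    (Φ := fun x y => ∑ j ∈ s, w j x * y j) ?_ ?_).2
  · refine h.trans (Eventually.of_forall fun ω => ?_)
    simp only [Pi.zero_apply]
    rw [integral_finsetSum]
    · refine Finset.sum_eq_zero fun j _ => ?_
      rw [integral_const_mul, hY.zero_mean, mul_zero]
    · exact fun j _ => (Integrable.of_bound (hY.measurable _).aestronglyMeasurable M
        (hM _)).const_mul _
  · refine Finset.measurable_sum _ fun j _ => ?_
    exact ((hw j).comp measurable_fst).mul ((measurable_pi_apply j).comp measurable_snd)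
  · intro x
    refine ae_abs_sum_le fun j _ => ?_
    filter_upwards [hM (l • x j)] with ω hω
    rw [abs_mul]
    exact (mul_le_of_le_one_left (abs_nonneg _) (hw1 j x)).trans hω

/-- Conditional second moment of a weighted sum of observations given the design. -/
theorem condExp_sq_weighted_sum {Ω : Type u} [MeasurableSpace Ω] {P : Measure Ω}
    [IsProbabilityMeasure P] {Y : Plane → Ω → ℝ} {X : ℕ → Ω → Plane} (hY : IsMixingField P Y)
    (hX : ∀ i, Measurable (X i)) (hYX : IsMeasurableIndep P Y X) (l : ℝ) (s : Finset ℕ)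
    {w : ℕ → (ℕ → Plane) → ℝ} (hw : ∀ j, Measurable (w j)) (hw1 : ∀ j x, |w j x| ≤ 1) :
    Integrable (fun ω => (∑ j ∈ s, w j (fun i => X i ω) * Y (l • X j ω) ω) ^ 2) P ∧
    P[fun ω => (∑ j ∈ s, w j (fun i => X i ω) * Y (l • X j ω) ω) ^ 2 | designSigma X] =ᵐ[P]
      fun ω => ∑ j ∈ s, ∑ k ∈ s, w j (fun i => X i ω) * w k (fun i => X i ω) *
        autocov P Y (l • (X j ω - X k ω)) := by
  obtain ⟨M, hM⟩ := hY.bounded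
  have h := (condExp_observations (C := (s.card * M) ^ 2) hX hYX l
    (Φ := fun x y => (∑ j ∈ s, w j x * y j) ^ 2) ?_ ?_)
  · refine ⟨h.1, h.2.trans (Eventually.of_forall fun ω => ?_)⟩
    simp only [sq, Finset.sum_mul_sum]
    have hint : ∀ j k, Integrable (fun ω' => w j (fun i => X i ω) * Y (l • X j ω) ω' *
        (w k (fun i => X i ω) * Y (l • X k ω) ω')) P := by
      intro j k
      have h1 : Integrable (fun ω' => Y (l • X j ω) ω' * Y (l • X k ω) ω') P := by
        refine Integrable.of_bound ((hY.measurable _).mul (hY.measurable _)).aestronglyMeasurable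
          (M * M) ?_
        filter_upwards [hM (l • X j ω), hM (l • X k ω)] with ω' h1 h2
        rw [norm_mul]
        exact mul_le_mul h1 h2 (abs_nonneg _) ((abs_nonneg _).trans h1)
      refine (h1.const_mul (w j (fun i => X i ω) * w k (fun i => X i ω))).congr
        (Eventually.of_forall fun ω' => ?_)
      ring
    rw [integral_finsetSum _ fun j _ => integrable_finsetSum _ fun k _ => hint j k]
    refine Finset.sum_congr rfl fun j _ => ?_
    rw [integral_finsetSum _ fun k _ => hint j k]
    refine Finset.sum_congr rfl fun k _ => ?_
    rw [smul_sub, ← integral_mul_eq_autocov hY, ← integral_const_mul]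
    congr 1; ext ω'; ring
  · refine Measurable.pow_const (Finset.measurable_sum _ fun j _ => ?_) 2
    exact ((hw j).comp measurable_fst).mul ((measurable_pi_apply j).comp measurable_snd)
  · intro x
    have h1 : ∀ᵐ ω ∂P, |∑ j ∈ s, w j x * Y (l • x j) ω| ≤ s.card * M := by
      refine ae_abs_sum_le fun j _ => ?_
      filter_upwards [hM (l • x j)] with ω hω
      rw [abs_mul]
      exact (mul_le_of_le_one_left (abs_nonneg _) (hw1 j x)).trans hω
    filter_upwards [h1] with ω hω
    rw [abs_pow]
    exact pow_le_pow_left₀ (abs_nonneg _) hω 2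

theorem scaledCondVar_ae_eq {Ω : Type u} [MeasurableSpace Ω] {P : Measure Ω}
    [IsProbabilityMeasure P] {Y : Plane → Ω → ℝ} {X : ℕ → Ω → Plane} (hY : IsMixingField P Y)
    (hX : ∀ i, Measurable (X i)) (hYX : IsMeasurableIndep P Y X) (n : ℕ) (l : ℝ) :
    scaledCondVar P Y X n l =ᵐ[P] fun ω => l ^ 2 * ((n : ℝ)⁻¹ ^ 2 *
      ∑ i ∈ Finset.range n, ∑ j ∈ Finset.range n, autocov P Y (l • (X i ω - X j ω))) := by
  have hT : sampleMean Y X n l = fun ω => ∑ i ∈ Finset.range n, (n : ℝ)⁻¹ * Y (l • X i ω) ω := by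
    ext ω
    rw [sampleMean, Fin.sum_univ_eq_sum_range (fun i => Y (l • X i ω) ω), Finset.mul_sum]
  have hn1 : |((n : ℝ)⁻¹)| ≤ 1 := by
    rw [abs_of_nonneg (by positivity)]
    exact Nat.cast_inv_le_one n
  have h1 := condExp_weighted_sum hY hX hYX l (Finset.range n) (w := fun _ _ => (n : ℝ)⁻¹)
    (fun _ => measurable_const) (fun _ _ => hn1)
  have h2 := (condExp_sq_weighted_sum hY hX hYX l (Finset.range n) (w := fun _ _ => (n : ℝ)⁻¹)
    (fun _ => measurable_const) (fun _ _ => hn1)).2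
  have h3 : Var[sampleMean Y X n l; P | designSigma X] =ᵐ[P]
      P[fun ω => (∑ i ∈ Finset.range n, (n : ℝ)⁻¹ * Y (l • X i ω) ω) ^ 2 | designSigma X] := by
    refine condExp_congr_ae ?_
    rw [hT]
    filter_upwards [h1] with ω hω
    simp [hω]
  filter_upwards [h3, h2] with ω e3 e2
  rw [scaledCondVar, e3, e2]
  simp only [Finset.mul_sum]
  refine Finset.sum_congr rfl fun i _ => Finset.sum_congr rfl fun j _ => ?_
  ring

/-! ### The design density -/

/-- The profile of the design density inside the unit region, extended continuously to the line. -/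
def profile (a t : ℝ) : ℝ :=
  a / 4 - min 1 (max 0 (a * |t| - 1)) * (a / 4 - a / (4 * (a - 3)))

theorem continuous_profile (a : ℝ) : Continuous (profile a) := by
  unfold profile; fun_prop

theorem mem_region_one (x : Plane) : x ∈ region 1 ↔ |x.1| < 1 / 2 ∧ |x.2| < 1 / 2 := by
  simp only [region, Set.mem_prod, Set.mem_Ioo, abs_lt, neg_div]

theorem isOpen_region (l : ℝ) : IsOpen (region l) := isOpen_Ioo.prod isOpen_Ioo

theorem designDensity_eq_indicator {a : ℝ} (ha : 4 < a) :
    designDensity a = (region 1).indicator fun x => profile a x.1 := by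
  classical
  ext x
  have h0 : 0 < a := by linarith
  have h1 : 1 / a < 1 / 2 := one_div_lt_one_div_of_lt (by norm_num) (by linarith)
  have h2 : 2 / a < 1 / 2 := by rw [div_lt_div_iff₀ h0 (by norm_num)]; linarith
  have e2 : x.2 ∈ Set.Ioo (-1 / 2 : ℝ) (1 / 2) ↔ |x.2| < 1 / 2 := by
    simp only [Set.mem_Ioo, abs_lt, neg_div]
  rw [Set.indicator_apply, mem_region_one, designDensity, Set.indicator_apply]
  by_cases hx2 : |x.2| < 1 / 2
  · rw [if_pos (e2.2 hx2)]
    by_cases hx1 : |x.1| < 1 / 2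
    · rw [if_pos ⟨hx1, hx2⟩, Pi.one_apply, mul_one, lineDensity, profile]
      by_cases h3 : |x.1| ≤ 1 / a
      · have h5 : a * |x.1| ≤ 1 := by rw [le_div_iff₀ h0] at h3; linarith
        rw [if_pos h3, max_eq_left (by linarith), min_eq_right zero_le_one]; ring
      · rw [if_neg h3]
        have h5 : 1 < a * |x.1| := by rw [not_le, div_lt_iff₀ h0] at h3; linarith
        rw [max_eq_right (by linarith)]
        by_cases h4 : |x.1| ≤ 2 / a
        · have h6 : a * |x.1| ≤ 2 := by rw [le_div_iff₀ h0] at h4; linarith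
          rw [if_pos h4, min_eq_right (by linarith)]; ring
        · have h6 : 2 < a * |x.1| := by rw [not_le, div_lt_iff₀ h0] at h4; linarith
          rw [if_neg h4, if_pos hx1, min_eq_left (by linarith)]; ring
    · rw [if_neg (fun h => hx1 h.1), lineDensity]
      rw [if_neg (by linarith), if_neg (by linarith), if_neg hx1, zero_mul]
  · rw [if_neg (fun h => hx2 (e2.1 h)), if_neg (fun h => hx2 h.2), mul_zero]

theorem quarter_le_plateau {a : ℝ} (ha : 4 < a) : 1 / 4 ≤ a / (4 * (a - 3)) := by
  rw [div_le_div_iff₀ (by norm_num) (by linarith)]; linarith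

theorem plateau_le {a : ℝ} (ha : 4 < a) : a / (4 * (a - 3)) ≤ a / 4 := by
  gcongr
  linarith

theorem profile_le {a : ℝ} (ha : 4 < a) (t : ℝ) : profile a t ≤ a / 4 := by
  have h1 : 0 ≤ min 1 (max 0 (a * |t| - 1)) := le_min zero_le_one (le_max_left _ _)
  have h2 := plateau_le ha
  unfold profile; nlinarith

theorem quarter_le_profile {a : ℝ} (ha : 4 < a) (t : ℝ) : 1 / 4 ≤ profile a t := by
  have h1 : min 1 (max 0 (a * |t| - 1)) ≤ 1 := min_le_left _ _
  have h2 := plateau_le ha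
  have h3 := quarter_le_plateau ha
  unfold profile; nlinarith

theorem profile_eq_of_abs_le {a t : ℝ} (ha : 4 < a) (ht : |t| ≤ 1 / a) : profile a t = a / 4 := by
  have h5 : a * |t| ≤ 1 := by rw [le_div_iff₀ (by linarith)] at ht; linarith
  rw [profile, max_eq_left (by linarith), min_eq_right zero_le_one]; ring

theorem measurable_designDensity {a : ℝ} (ha : 4 < a) : Measurable (designDensity a) := by
  rw [designDensity_eq_indicator ha]
  exact ((continuous_profile a).measurable.comp measurable_fst).indicator
    (isOpen_region 1).measurableSet

theorem designDensity_nonneg {a : ℝ} (ha : 4 < a) (x : Plane) : 0 ≤ designDensity a x := by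
  rw [designDensity_eq_indicator ha]
  exact Set.indicator_nonneg (fun x _ => by linarith [quarter_le_profile ha x.1]) x

theorem designDensity_le {a : ℝ} (ha : 4 < a) (x : Plane) : designDensity a x ≤ a / 4 := by
  rw [designDensity_eq_indicator ha]
  exact Set.indicator_le' (fun x _ => profile_le ha x.1) (fun x _ => by positivity) x

theorem ae_continuousAt_designDensity {a : ℝ} (ha : 4 < a) :
    ∀ᵐ x : Plane, ContinuousAt (designDensity a) x := by
  have h : volume (frontier (region 1)) = 0 :=
    ((convex_Ioo _ _).prod (convex_Ioo _ _)).addHaar_frontier _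
  have h2 : ∀ᵐ x : Plane, x ∉ frontier (region 1) := measure_eq_zero_iff_ae_notMem.1 h
  filter_upwards [h2] with x hx
  rw [designDensity_eq_indicator ha]
  exact ContinuousOn.continuousAt_indicator
    ((continuous_profile a).comp continuous_fst).continuousOn hx

/-- The law of a design variable. -/
def designLaw (a : ℝ) : Measure Plane :=
  volume.withDensity fun x => ENNReal.ofReal (designDensity a x)

theorem designLaw_le {a : ℝ} (ha : 4 < a) : designLaw a ≤ ENNReal.ofReal (a / 4) • volume := by
  rw [← withDensity_const]
  exact withDensity_mono (Eventually.of_forall fun x => ENNReal.ofReal_le_ofReal (designDensity_le ha x))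

theorem isProbabilityMeasure_designLaw {Ω : Type u} [MeasurableSpace Ω] {a : ℝ} {P : Measure Ω}
    [IsProbabilityMeasure P] {X : ℕ → Ω → Plane} (hX : IsDesign a P X) :
    IsProbabilityMeasure (designLaw a) := by
  rw [designLaw, ← hX.law 0]
  exact Measure.isProbabilityMeasure_map (hX.measurable 0).aemeasurable

theorem integral_designLaw {a : ℝ} (ha : 4 < a) (g : Plane → ℝ) :
    ∫ x, g x ∂(designLaw a) = ∫ x, designDensity a x * g x := by
  rw [designLaw, integral_withDensity_eq_integral_toReal_smul
    (measurable_designDensity ha).ennreal_ofReal (Eventually.of_forall fun _ => ENNReal.ofReal_lt_top)]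
  simp_rw [ENNReal.toReal_ofReal (designDensity_nonneg ha _), smul_eq_mul]

theorem integrable_designDensity {a : ℝ} (ha : 4 < a) [IsProbabilityMeasure (designLaw a)] :
    Integrable (designDensity a) := by
  refine ⟨(measurable_designDensity ha).aestronglyMeasurable, ?_⟩
  rw [hasFiniteIntegral_iff_ofReal (Eventually.of_forall (designDensity_nonneg ha))]
  have h : designLaw a Set.univ < ⊤ := measure_lt_top _ _
  rwa [designLaw, withDensity_apply _ .univ, setLIntegral_univ] at h

/-- The mean over one site of a kernel at scale `l`, as an integral over lags. -/
theorem integral_kernel_designLaw {a : ℝ} (ha : 4 < a) {l : ℝ} (hl : 0 < l) (H : Plane → ℝ)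
    (x : Plane) :
    ∫ y, H (l • (x - y)) ∂(designLaw a) = (l ^ 2)⁻¹ * ∫ u, H u * designDensity a (x - l⁻¹ • u) := by
  rw [integral_designLaw ha]
  have h1 : ∫ y, designDensity a y * H (l • (x - y)) =
      ∫ v, H (l • v) * designDensity a (x - l⁻¹ • (l • v)) := by
    rw [← integral_sub_left_eq_self (fun v => H (l • v) * designDensity a (x - l⁻¹ • (l • v))) _ x]
    refine integral_congr_ae (Eventually.of_forall fun y => ?_)
    simp only
    rw [inv_smul_smul₀ hl.ne', sub_sub_cancel, mul_comm]
  rw [h1, Measure.integral_comp_smul volume (fun u => H u * designDensity a (x - l⁻¹ • u)) l]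
  simp [abs_of_pos hl]

theorem integrable_mul_designDensity {a : ℝ} (ha : 4 < a) {H : Plane → ℝ} (hH : Integrable H)
    {q : Plane → Plane} (hq : Measurable q) :
    Integrable fun u => H u * designDensity a (q u) :=
  hH.mul_bdd (c := a / 4) ((measurable_designDensity ha).comp hq).aestronglyMeasurable
    (Eventually.of_forall fun u => by
      rw [Real.norm_of_nonneg (designDensity_nonneg ha _)]; exact designDensity_le ha _)

theorem abs_integral_kernel_le {a : ℝ} (ha : 4 < a) {l : ℝ} (hl : 0 < l) {H : Plane → ℝ}
    (hH : Integrable H) (x : Plane) :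
    |∫ y, H (l • (x - y)) ∂(designLaw a)| ≤ (l ^ 2)⁻¹ * (a / 4 * ∫ u, |H u|) := by
  rw [integral_kernel_designLaw ha hl, abs_mul, abs_of_nonneg (by positivity : 0 ≤ (l ^ 2)⁻¹)]
  refine mul_le_mul_of_nonneg_left ?_ (by positivity)
  rw [← integral_const_mul]
  refine (abs_integral_le_integral_abs).trans (integral_mono_of_nonneg
    (Eventually.of_forall fun _ => abs_nonneg _) (hH.abs.const_mul _)
    (Eventually.of_forall fun u => ?_))
  simp only
  rw [abs_mul, abs_of_nonneg (designDensity_nonneg ha _), mul_comm]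
  exact mul_le_mul_of_nonneg_right (designDensity_le ha _) (abs_nonneg _)

/-- As the scale grows, the mean of the kernel over two sites becomes local: it picks up the
integral of the kernel and of the squared density. -/
theorem tendsto_integral_kernel {a : ℝ} (ha : 4 < a) [IsProbabilityMeasure (designLaw a)]
    {l : ℕ → ℝ} (hl : Tendsto l atTop atTop) {H : Plane → ℝ} (hH : Integrable H) :
    Tendsto (fun n => ∫ x, ∫ y, l n ^ 2 * H (l n • (x - y)) ∂(designLaw a) ∂(designLaw a)) atTop
      (𝓝 ((∫ u, H u) * ∫ x, designDensity a x ^ 2)) := by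
  have hinv : Tendsto (fun n => (l n)⁻¹) atTop (𝓝 0) := tendsto_inv_atTop_zero.comp hl
  have e1 : ∀ᶠ n in atTop, ∫ x, ∫ y, l n ^ 2 * H (l n • (x - y)) ∂(designLaw a) ∂(designLaw a) =
      ∫ x, designDensity a x * ∫ u, H u * designDensity a (x - (l n)⁻¹ • u) := by
    filter_upwards [hl.eventually_gt_atTop 0] with n hn
    rw [integral_designLaw ha]
    refine integral_congr_ae (Eventually.of_forall fun x => ?_)
    simp only
    rw [integral_const_mul, integral_kernel_designLaw ha hn, mul_inv_cancel_left₀ (by positivity)]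
  refine Tendsto.congr' (e1.mono fun n h => h.symm) ?_
  have e2 : (∫ u, H u) * ∫ x, designDensity a x ^ 2 =
      ∫ x, designDensity a x * ((∫ u, H u) * designDensity a x) := by
    rw [← integral_const_mul]
    refine integral_congr_ae (Eventually.of_forall fun x => ?_)
    simp only; ring
  rw [e2]
  have hin : ∀ x : Plane, ContinuousAt (designDensity a) x →
      Tendsto (fun n => ∫ u, H u * designDensity a (x - (l n)⁻¹ • u)) atTop
        (𝓝 ((∫ u, H u) * designDensity a x)) := by
    intro x hx
    rw [← integral_mul_const]
    refine tendsto_integral_of_dominated_convergence (fun u => |H u| * (a / 4))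
      (fun n => (integrable_mul_designDensity ha hH
        (by fun_prop : Measurable fun u : Plane => x - (l n)⁻¹ • u)).aestronglyMeasurable)
      (hH.abs.mul_const _)
      (fun n => Eventually.of_forall fun u => ?_) (Eventually.of_forall fun u => ?_)
    · rw [norm_mul, Real.norm_of_nonneg (designDensity_nonneg ha _), Real.norm_eq_abs]
      exact mul_le_mul_of_nonneg_left (designDensity_le ha _) (abs_nonneg _)
    · refine Tendsto.const_mul _ (hx.tendsto.comp ?_)
      have : Tendsto (fun n => x - (l n)⁻¹ • u) atTop (𝓝 (x - (0 : ℝ) • u)) :=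
        tendsto_const_nhds.sub (hinv.smul_const u)
      simpa using this
  refine tendsto_integral_of_dominated_convergence
    (fun x => designDensity a x * (a / 4 * ∫ u, |H u|)) (fun n => ?_)
    ((integrable_designDensity ha).mul_const _) (fun n => Eventually.of_forall fun x => ?_) ?_
  · have h1 : AEStronglyMeasurable (fun p : Plane × Plane => H p.2 * designDensity a (p.1 - (l n)⁻¹ • p.2))
        (volume.prod volume) :=
      hH.aestronglyMeasurable.comp_snd.mul ((measurable_designDensity ha).comp
        (by fun_prop : Measurable fun p : Plane × Plane => p.1 - (l n)⁻¹ • p.2)).aestronglyMeasurable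
    exact (measurable_designDensity ha).aestronglyMeasurable.mul h1.integral_prod_right'
  · rw [norm_mul, Real.norm_of_nonneg (designDensity_nonneg ha _)]
    refine mul_le_mul_of_nonneg_left ?_ (designDensity_nonneg ha _)
    rw [← integral_const_mul]
    refine (abs_integral_le_integral_abs).trans (integral_mono_of_nonneg
      (Eventually.of_forall fun _ => abs_nonneg _) (hH.abs.const_mul _)
      (Eventually.of_forall fun u => ?_))
    simp only
    rw [abs_mul, abs_of_nonneg (designDensity_nonneg ha _), mul_comm]
    exact mul_le_mul_of_nonneg_right (designDensity_le ha _) (abs_nonneg _)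
  · filter_upwards [ae_continuousAt_designDensity ha] with x hx
    exact (hin x hx).const_mul _

/-! ### Sums over pairs of independent sites -/

/-- Fubini for a bounded functional of two independent variables. -/
theorem integral_comp_of_indepFun {Ω A B : Type*} [MeasurableSpace Ω] [MeasurableSpace A]
    [MeasurableSpace B] {P : Measure Ω} [IsProbabilityMeasure P] {ξ : Ω → A} {ζ : Ω → B}
    (hξ : Measurable ξ) (hζ : Measurable ζ) (h : IndepFun ξ ζ P) {F : A → B → ℝ}
    (hF : Measurable (Function.uncurry F)) {C : ℝ} (hC : ∀ a z, |F a z| ≤ C) :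
    ∫ ω, F (ξ ω) (ζ ω) ∂P = ∫ ω, ∫ a, F a (ζ ω) ∂(P.map ξ) ∂P := by
  have h1 := condExp_comp_of_indepFun hξ hζ h hF
    (fun z => Eventually.of_forall fun ω => hC (ξ ω) z)
  rw [← integral_condExp hζ.comap_le, integral_congr_ae h1.2]
  refine integral_congr_ae (Eventually.of_forall fun ω => ?_)
  exact (integral_map hξ.aemeasurable
    (hF.comp measurable_prodMk_right).aestronglyMeasurable).symm

section UStatistic

variable {Ω E : Type*} [MeasurableSpace Ω] [MeasurableSpace E] {P : Measure Ω}
  [IsProbabilityMeasure P] {μ : Measure E} {X : ℕ → Ω → E}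

/-- Distinct pairs: the mean of a bounded functional of two sites is its double integral. -/
theorem integral_pair (hX : ∀ i, Measurable (X i)) (hμ : ∀ i, P.map (X i) = μ)
    (hind : iIndepFun X P) {F : E → E → ℝ} (hF : Measurable (Function.uncurry F)) {C : ℝ}
    (hC : ∀ x y, |F x y| ≤ C) {i j : ℕ} (hij : i ≠ j) :
    ∫ ω, F (X i ω) (X j ω) ∂P = ∫ y, ∫ x, F x y ∂μ ∂μ := by
  have : SFinite μ := by rw [← hμ 0]; infer_instance
  rw [integral_comp_of_indepFun (hX i) (hX j) (hind.indepFun hij) hF hC, hμ i, ← hμ j,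
    integral_map (hX j).aemeasurable, hμ j]
  rw [hμ j]
  exact (hF.comp measurable_swap).stronglyMeasurable.integral_prod_right'.aestronglyMeasurable

/-- A degenerate kernel at `(X k, X l)` is orthogonal to everything that does not involve `X k`. -/
theorem integral_degenerate_eq_zero (hX : ∀ i, Measurable (X i)) (hμ : ∀ i, P.map (X i) = μ)
    (hind : iIndepFun X P) {g : E → E → ℝ} (hg : Measurable (Function.uncurry g)) {C : ℝ}
    (hC : ∀ x y, |g x y| ≤ C) (hdeg : ∀ y, ∫ x, g x y ∂μ = 0) {i j k l : ℕ} (hkl : k ≠ l)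
    (hki : k ≠ i) (hkj : k ≠ j) :
    ∫ ω, g (X i ω) (X j ω) * g (X k ω) (X l ω) ∂P = 0 := by
  -- `X k` is independent of the other three sites, so it may be integrated out first
  have hdis : Disjoint ({k} : Finset ℕ) {i, j, l} := by simp [hkl, hki, hkj]
  have hI := hind.indepFun_finset {k} {i, j, l} hdis hX
  have hI2 : IndepFun (X k) (fun ω (t : ({i, j, l} : Finset ℕ)) => X t ω) P :=
    hI.comp (measurable_pi_apply (⟨k, by simp⟩ : ({k} : Finset ℕ))) measurable_id
  have hF : Measurable (Function.uncurry fun (x : E) (z : ({i, j, l} : Finset ℕ) → E) =>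
      g (z ⟨i, by simp⟩) (z ⟨j, by simp⟩) * g x (z ⟨l, by simp⟩)) := by
    have e : ∀ t : ({i, j, l} : Finset ℕ), Measurable
        fun p : E × (({i, j, l} : Finset ℕ) → E) => p.2 t := fun t =>
      (measurable_pi_apply t).comp measurable_snd
    exact (hg.comp ((e _).prodMk (e _))).mul (hg.comp (measurable_fst.prodMk (e _)))
  have h := integral_comp_of_indepFun (hX k)
    (measurable_pi_lambda _ fun t : ({i, j, l} : Finset ℕ) => hX t) hI2 hF (C := C * C) ?_
  · refine h.trans ?_
    simp_rw [integral_const_mul, hμ k, hdeg]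
    simp
  · intro a z
    rw [abs_mul]
    exact mul_le_mul (hC _ _) (hC _ _) (abs_nonneg _) ((abs_nonneg _).trans (hC a a))

/-- Second moment of a completely degenerate U-statistic: only coinciding pairs contribute. -/
theorem integral_sq_degenerate_le (hX : ∀ i, Measurable (X i)) (hμ : ∀ i, P.map (X i) = μ)
    (hind : iIndepFun X P) {g : E → E → ℝ} (hg : Measurable (Function.uncurry g)) {C : ℝ}
    (hC : ∀ x y, |g x y| ≤ C) (hdeg : ∀ y, ∫ x, g x y ∂μ = 0) (hsymm : ∀ x y, g x y = g y x)
    (n : ℕ) :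
    ∫ ω, (∑ p ∈ (Finset.range n).offDiag, g (X p.1 ω) (X p.2 ω)) ^ 2 ∂P ≤
      2 * n ^ 2 * ∫ y, ∫ x, g x y ^ 2 ∂μ ∂μ := by
  set V := ∫ y, ∫ x, g x y ^ 2 ∂μ ∂μ with hV
  have hV0 : 0 ≤ V := integral_nonneg fun y => integral_nonneg fun x => sq_nonneg _
  have hm : ∀ i j : ℕ, Measurable fun ω => g (X i ω) (X j ω) := fun i j =>
    hg.comp ((hX i).prodMk (hX j))
  have hint : ∀ p q : ℕ × ℕ, Integrable
      (fun ω => g (X p.1 ω) (X p.2 ω) * g (X q.1 ω) (X q.2 ω)) P := fun p q => by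
    refine Integrable.of_bound ((hm _ _).mul (hm _ _)).aestronglyMeasurable (C * C)
      (Eventually.of_forall fun ω => ?_)
    rw [norm_mul]
    exact mul_le_mul (hC _ _) (hC _ _) (abs_nonneg _) ((abs_nonneg _).trans (hC (X 0 ω) (X 0 ω)))
  simp only [sq, Finset.sum_mul_sum]
  rw [integral_finsetSum _ fun p _ => integrable_finsetSum _ fun q _ => hint p q]
  have hbd : ∀ p ∈ (Finset.range n).offDiag,
      ∫ ω, ∑ q ∈ (Finset.range n).offDiag, g (X p.1 ω) (X p.2 ω) * g (X q.1 ω) (X q.2 ω) ∂P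
        ≤ 2 * V := by
    intro p hp
    have hp' : p.1 ≠ p.2 := (Finset.mem_offDiag.1 hp).2.2
    rw [integral_finsetSum _ fun q _ => hint p q]
    have hdiag : ∫ ω, g (X p.1 ω) (X p.2 ω) * g (X p.1 ω) (X p.2 ω) ∂P = V := by
      rw [hV, ← integral_pair hX hμ hind (F := fun x y => g x y ^ 2) (hg.pow_const 2) (C := C ^ 2)
        (fun x y => by rw [abs_pow]; exact pow_le_pow_left₀ (abs_nonneg _) (hC x y) 2) hp']
      simp only [sq]
    have hterm : ∀ q ∈ (Finset.range n).offDiag,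
        ∫ ω, g (X p.1 ω) (X p.2 ω) * g (X q.1 ω) (X q.2 ω) ∂P ≤
          (if q = p then V else 0) + (if q = p.swap then V else 0) := by
      intro q hq
      have hq' : q.1 ≠ q.2 := (Finset.mem_offDiag.1 hq).2.2
      by_cases h1 : q.1 = p.1 ∨ q.1 = p.2
      · by_cases h2 : q.2 = p.1 ∨ q.2 = p.2
        · have h3 : q = p ∨ q = p.swap := by
            rcases h1 with h1 | h1 <;> rcases h2 with h2 | h2
            · exact absurd (h1.trans h2.symm) hq'
            · exact Or.inl (Prod.ext h1 h2)
            · exact Or.inr (Prod.ext h1 h2)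
            · exact absurd (h1.trans h2.symm) hq'
          rcases h3 with h3 | h3
          · rw [h3, if_pos rfl, hdiag]
            split_ifs <;> linarith
          · rw [if_pos h3]
            have : ∫ ω, g (X p.1 ω) (X p.2 ω) * g (X q.1 ω) (X q.2 ω) ∂P = V := by
              rw [h3, ← hdiag]
              simp only [Prod.fst_swap, Prod.snd_swap]
              refine integral_congr_ae (Eventually.of_forall fun ω => ?_)
              simp only
              rw [hsymm (X p.2 ω)]
            rw [this]
            split_ifs <;> linarith
        · push Not at h2
          have : ∫ ω, g (X p.1 ω) (X p.2 ω) * g (X q.1 ω) (X q.2 ω) ∂P = 0 := by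
            simp_rw [hsymm (X q.1 _)]
            exact integral_degenerate_eq_zero hX hμ hind hg hC hdeg hq'.symm h2.1 h2.2
          rw [this]
          split_ifs <;> linarith
      · push Not at h1
        rw [integral_degenerate_eq_zero hX hμ hind hg hC hdeg hq' h1.1 h1.2]
        split_ifs <;> linarith
    refine (Finset.sum_le_sum hterm).trans ?_
    rw [Finset.sum_add_distrib, Finset.sum_ite_eq', Finset.sum_ite_eq']
    split_ifs <;> linarith
  refine (Finset.sum_le_card_nsmul _ _ _ hbd).trans ?_
  rw [nsmul_eq_mul]
  have hcard : (((Finset.range n).offDiag).card : ℝ) ≤ n ^ 2 := by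
    have : ((Finset.range n).offDiag).card ≤ n * n := by
      rw [Finset.offDiag_card, Finset.card_range]; exact Nat.sub_le _ _
    rw [sq]; exact_mod_cast this
  nlinarith

/-- Hoeffding's inequality for both tails of a sum of bounded i.i.d. variables. -/
theorem measureReal_abs_sum_ge_le (hX : ∀ i, Measurable (X i)) (hμ : ∀ i, P.map (X i) = μ)
    (hind : iIndepFun X P) {f : E → ℝ} (hf : Measurable f) {B : ℝ} (hB : 0 ≤ B)
    (hfB : ∀ x, |f x| ≤ B) (n : ℕ) {ε : ℝ} (hε : 0 ≤ ε) :
    P.real {ω | ε ≤ |∑ i ∈ Finset.range n, (f (X i ω) - ∫ x, f x ∂μ)|} ≤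
      2 * Real.exp (-ε ^ 2 / (2 * n * B ^ 2)) := by
  -- the lower tail is the upper tail of `-f`
  have key : ∀ f : E → ℝ, Measurable f → (∀ x, |f x| ≤ B) →
      P.real {ω | ε ≤ ∑ i ∈ Finset.range n, (f (X i ω) - ∫ x, f x ∂μ)} ≤
        Real.exp (-ε ^ 2 / (2 * n * B ^ 2)) := by
    intro f hf hfB
    have hI : iIndepFun (fun i ω => f (X i ω) - ∫ x, f x ∂μ) P :=
      hind.comp (fun _ x => f x - ∫ x, f x ∂μ) fun _ => hf.sub_const _
    have hmean : ∀ i, ∫ ω, f (X i ω) ∂P = ∫ x, f x ∂μ := fun i => by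
      rw [← hμ i, integral_map (hX i).aemeasurable hf.aestronglyMeasurable]
    have hs : ∀ i < n, HasSubgaussianMGF (fun ω => f (X i ω) - ∫ x, f x ∂μ)
        ((‖B - -B‖₊ / 2) ^ 2) P := fun i _ => by
      rw [← hmean i]
      exact hasSubgaussianMGF_of_mem_Icc (X := fun ω => f (X i ω)) (hf.comp (hX i)).aemeasurable
        (Eventually.of_forall fun ω => abs_le.1 (hfB _))
    have h := HasSubgaussianMGF.measure_sum_range_ge_le_of_iIndepFun hI hs hε
    have e : (((‖B - -B‖₊ / 2) ^ 2 : NNReal) : ℝ) = B ^ 2 := by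
      push_cast
      rw [Real.norm_of_nonneg (by linarith)]
      ring
    rwa [e] at h
  have h2 := key (fun x => -f x) hf.neg (fun x => by rw [abs_neg]; exact hfB x)
  have hsub : {ω | ε ≤ |∑ i ∈ Finset.range n, (f (X i ω) - ∫ x, f x ∂μ)|} ⊆
      {ω | ε ≤ ∑ i ∈ Finset.range n, (f (X i ω) - ∫ x, f x ∂μ)} ∪
      {ω | ε ≤ ∑ i ∈ Finset.range n, (-f (X i ω) - ∫ x, -f x ∂μ)} := by
    intro ω hω
    have hω' : ε ≤ |∑ i ∈ Finset.range n, (f (X i ω) - ∫ x, f x ∂μ)| := hω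
    rcases le_abs.1 hω' with h | h
    · exact Or.inl h
    · refine Or.inr (h.trans_eq ?_)
      rw [integral_neg, ← Finset.sum_neg_distrib]
      exact Finset.sum_congr rfl fun i _ => by ring
  calc _ ≤ _ := measureReal_mono hsub
    _ ≤ _ := measureReal_union_le _ _
    _ ≤ _ := by linarith [key f hf hfB]

end UStatistic

/-- Summable second moments force almost sure convergence to zero. -/
theorem ae_tendsto_zero_of_summable_sq {Ω : Type*} [MeasurableSpace Ω] {P : Measure Ω}
    {Z : ℕ → Ω → ℝ} (hm : ∀ n, Measurable (Z n)) (hi : ∀ n, Integrable (fun ω => Z n ω ^ 2) P)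
    {c : ℕ → ℝ} (hc : Summable c) (hZ : ∀ n, ∫ ω, Z n ω ^ 2 ∂P ≤ c n) :
    ∀ᵐ ω ∂P, Tendsto (fun n => Z n ω) atTop (𝓝 0) := by
  have h1 : ∫⁻ ω, ∑' n, ENNReal.ofReal (Z n ω ^ 2) ∂P ≠ ⊤ := by
    rw [lintegral_tsum fun n => ((hm n).pow_const 2).ennreal_ofReal.aemeasurable]
    have h2 : ∀ n, ∫⁻ ω, ENNReal.ofReal (Z n ω ^ 2) ∂P ≤ ENNReal.ofReal (c n) := fun n => by
      rw [← ofReal_integral_eq_lintegral_ofReal (hi n) (Eventually.of_forall fun ω => sq_nonneg _)]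
      exact ENNReal.ofReal_le_ofReal (hZ n)
    refine ne_top_of_le_ne_top ?_ (ENNReal.tsum_le_tsum h2)
    exact hc.tsum_ofReal_ne_top
  have h3 := ae_lt_top (Measurable.tsum fun n => ((hm n).pow_const 2).ennreal_ofReal) h1
  filter_upwards [h3] with ω hω
  have h4 := ENNReal.tendsto_atTop_zero_of_tsum_ne_top hω.ne
  have h5 := (ENNReal.tendsto_toReal ENNReal.zero_ne_top).comp h4
  have h6 : Tendsto (fun n => Z n ω ^ 2) atTop (𝓝 0) := by
    refine h5.congr fun n => ?_
    simp [ENNReal.toReal_ofReal (sq_nonneg (Z n ω))]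
  have h7 := h6.sqrt
  simp only [Real.sqrt_zero, Real.sqrt_sq_eq_abs] at h7
  exact (tendsto_zero_iff_abs_tendsto_zero _).2 h7

/-! ### The conditional variance of the sample mean -/

section Hoeffding

variable {Ω E : Type*} [MeasurableSpace Ω] [MeasurableSpace E] {P : Measure Ω}
  [IsProbabilityMeasure P] {μ : Measure E} [IsProbabilityMeasure μ] {X : ℕ → Ω → E}

/-- **Hoeffding decomposition.** Once the mean and the linear projection are removed, the sum of a
symmetric kernel over distinct pairs is completely degenerate, so its second moment is of the order
of the number of pairs. -/
theorem integral_sq_uStatistic_remainder_le (hX : ∀ i, Measurable (X i))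
    (hμ : ∀ i, P.map (X i) = μ) (hind : iIndepFun X P) {h : E → E → ℝ}
    (hh : Measurable (Function.uncurry h)) {B : ℝ} (hB : ∀ x y, |h x y| ≤ B)
    (hsymm : ∀ x y, h x y = h y x) (n : ℕ) :
    Integrable (fun ω => (∑ p ∈ (Finset.range n).offDiag, (h (X p.1 ω) (X p.2 ω) -
      ∫ y, h (X p.1 ω) y ∂μ - ∫ y, h (X p.2 ω) y ∂μ + ∫ x, ∫ y, h x y ∂μ ∂μ)) ^ 2) P ∧
    ∫ ω, (∑ p ∈ (Finset.range n).offDiag, (h (X p.1 ω) (X p.2 ω) -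
      ∫ y, h (X p.1 ω) y ∂μ - ∫ y, h (X p.2 ω) y ∂μ + ∫ x, ∫ y, h x y ∂μ ∂μ)) ^ 2 ∂P ≤
      2 * n ^ 2 * ∫ x, ∫ y, h x y ^ 2 ∂μ ∂μ := by
  set h1 : E → ℝ := fun x => ∫ y, h x y ∂μ with hh1
  set θ : ℝ := ∫ x, h1 x ∂μ with hθ
  have hh1m : Measurable h1 := hh.stronglyMeasurable.integral_prod_right.measurable
  have hconst : ∀ c : ℝ, ∀ f : E → ℝ, (∀ x, |f x| ≤ c) → |∫ x, f x ∂μ| ≤ c := fun c f hf => by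
    have := norm_integral_le_of_norm_le_const (μ := μ) (f := f) (C := c) (Eventually.of_forall hf)
    simpa using this
  have hh1B : ∀ x, |h1 x| ≤ B := fun x => hconst B _ (hB x)
  have hθB : |θ| ≤ B := hconst B _ hh1B
  let g : E → E → ℝ := fun x y => h x y - h1 x - h1 y + θ
  have hgm : Measurable (Function.uncurry g) :=
    ((hh.sub (hh1m.comp measurable_fst)).sub (hh1m.comp measurable_snd)).add_const θ
  have hgB : ∀ x y, |g x y| ≤ 4 * B := fun x y => by
    have a1 := abs_le.1 (hB x y)
    have a2 := abs_le.1 (hh1B x)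
    have a3 := abs_le.1 (hh1B y)
    have a4 := abs_le.1 hθB
    rw [abs_le]; simp only [g]; constructor <;> linarith [a1.1, a1.2, a2.1, a2.2, a3.1, a3.2, a4.1, a4.2]
  have hhL : ∀ x, Measurable fun y => h x y := fun x => hh.comp measurable_prodMk_left
  have hhR : ∀ y, Measurable fun x => h x y := fun y => hh.comp measurable_prodMk_right
  have hi1 : ∀ y, Integrable (fun x => h x y) μ := fun y =>
    Integrable.of_bound (hhR y).aestronglyMeasurable B (Eventually.of_forall fun x => hB x y)
  have hi2 : Integrable h1 μ :=
    Integrable.of_bound hh1m.aestronglyMeasurable B (Eventually.of_forall hh1B)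
  have hsw : ∀ y, ∫ x, h x y ∂μ = h1 y := fun y => by simp_rw [hsymm _ y]; rfl
  have hu : ∀ y, ∫ x, (h x y - h1 x) ∂μ = h1 y - θ := fun y => by
    rw [integral_sub (hi1 y) hi2, hsw]
  have hdeg : ∀ y, ∫ x, g x y ∂μ = 0 := fun y => by
    have e : ∀ x, g x y = (h x y - h1 x) - (h1 y - θ) := fun x => by simp only [g]; ring
    simp_rw [e]
    have hux : Integrable (fun x => h x y - h1 x) μ := (hi1 y).sub hi2
    rw [integral_sub hux (integrable_const _), hu]; simp
  have hgs : ∀ x y, g x y = g y x := fun x y => by simp only [g]; rw [hsymm x y]; ring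
  have hmain := integral_sq_degenerate_le hX hμ hind hgm hgB hdeg hgs n
  constructor
  · have hm : Measurable fun ω => ∑ p ∈ (Finset.range n).offDiag, g (X p.1 ω) (X p.2 ω) :=
      Finset.measurable_sum _ fun p _ => hgm.comp ((hX p.1).prodMk (hX p.2))
    have hb := ae_abs_sum_le (P := P) (s := (Finset.range n).offDiag)
      (f := fun p ω => g (X p.1 ω) (X p.2 ω)) (M := 4 * B)
      fun p _ => Eventually.of_forall fun ω => hgB _ _
    refine Integrable.of_bound (hm.pow_const 2).aestronglyMeasurable
      ((((Finset.range n).offDiag).card * (4 * B)) ^ 2) (hb.mono fun ω hω => ?_)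
    rw [norm_pow]
    exact pow_le_pow_left₀ (norm_nonneg _) hω 2
  · refine hmain.trans ?_
    refine mul_le_mul_of_nonneg_left ?_ (by positivity)
    -- centering in one variable at a time only decreases the second moment
    have huB : ∀ x y, |h x y - h1 x| ≤ 2 * B := fun x y => by
      have a1 := abs_le.1 (hB x y)
      have a2 := abs_le.1 (hh1B x)
      rw [abs_le]; constructor <;> linarith [a1.1, a1.2, a2.1, a2.2]
    have hum : Measurable (Function.uncurry fun x y => h x y - h1 x) :=
      hh.sub (hh1m.comp measurable_fst)
    have hu2i : Integrable (Function.uncurry fun x y => (h x y - h1 x) ^ 2) (μ.prod μ) := by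
      refine Integrable.of_bound (hum.pow_const 2).aestronglyMeasurable ((2 * B) ^ 2)
        (Eventually.of_forall fun p => ?_)
      simp only [Function.uncurry]
      rw [norm_pow]
      exact pow_le_pow_left₀ (norm_nonneg _) (huB _ _) 2
    have hh2i : Integrable (Function.uncurry fun x y => h x y ^ 2) (μ.prod μ) := by
      refine Integrable.of_bound (hh.pow_const 2).aestronglyMeasurable (B ^ 2)
        (Eventually.of_forall fun p => ?_)
      simp only [Function.uncurry]
      rw [norm_pow]
      exact pow_le_pow_left₀ (norm_nonneg _) (hB _ _) 2
    have hg2i : Integrable (Function.uncurry fun x y => g x y ^ 2) (μ.prod μ) := by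
      refine Integrable.of_bound (hgm.pow_const 2).aestronglyMeasurable ((4 * B) ^ 2)
        (Eventually.of_forall fun p => ?_)
      simp only [Function.uncurry]
      rw [norm_pow]
      exact pow_le_pow_left₀ (norm_nonneg _) (hgB _ _) 2
    calc ∫ y, ∫ x, g x y ^ 2 ∂μ ∂μ
        ≤ ∫ y, ∫ x, (h x y - h1 x) ^ 2 ∂μ ∂μ := by
          refine integral_mono hg2i.integral_prod_right hu2i.integral_prod_right fun y => ?_
          have hmy : Measurable fun x => h x y - h1 x := (hhR y).sub hh1m
          have hv := variance_le_expectation_sq (μ := μ) hmy.aestronglyMeasurable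
          rw [variance_eq_integral hmy.aemeasurable, hu] at hv
          refine le_trans (le_of_eq ?_) hv
          refine integral_congr_ae (Eventually.of_forall fun x => ?_)
          simp only [g]; ring
      _ = ∫ x, ∫ y, (h x y - h1 x) ^ 2 ∂μ ∂μ := (integral_integral_swap hu2i).symm
      _ ≤ ∫ x, ∫ y, h x y ^ 2 ∂μ ∂μ := by
          refine integral_mono hu2i.integral_prod_left hh2i.integral_prod_left fun x => ?_
          have hv := variance_le_expectation_sq (μ := μ) (hhL x).aestronglyMeasurable
          rwa [variance_eq_integral (hhL x).aemeasurable] at hv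

end Hoeffding

theorem tendsto_scaling {lam : ℕ → ℝ} (h : IsScaling lam) : Tendsto lam atTop atTop := by
  have h1 : Tendsto (fun n => (lam n ^ 2) ^ 2) atTop atTop :=
    tendsto_natCast_atTop_atTop.congr' ((eventually_ge_atTop 1).mono fun n hn => (h n hn).2)
  refine tendsto_atTop.2 fun b => ?_
  filter_upwards [h1.eventually_ge_atTop ((max b 0 ^ 2) ^ 2), eventually_ge_atTop 1] with n hn hn1
  have h2 := (h n hn1).1
  rw [← pow_mul, ← pow_mul] at hn
  exact (le_max_left b 0).trans ((pow_le_pow_iff_left₀ (le_max_right b 0) h2.le (by norm_num)).1 hn)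

theorem scaling_sq {lam : ℕ → ℝ} (h : IsScaling lam) {n : ℕ} (hn : 1 ≤ n) :
    lam n ^ 2 = Real.sqrt n := by
  rw [(h n hn).2, Real.sqrt_sq (by positivity)]

/-- Strong law for the pair sums at a growing scale. The diagonal is of order `λ² / n`, and the sum
over distinct pairs is treated by the Hoeffding decomposition. -/
theorem ae_tendsto_pairSum {Ω : Type u} [MeasurableSpace Ω] {P : Measure Ω}
    [IsProbabilityMeasure P] {a : ℝ} (ha : 4 < a) {X : ℕ → Ω → Plane} (hX : IsDesign a P X)
    {lam : ℕ → ℝ} (hlam : IsScaling lam) {H : Plane → ℝ} (hHm : Measurable H) (hHi : Integrable H)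
    {C : ℝ} (hC : ∀ s, |H s| ≤ C) (hsymm : ∀ s, H (-s) = H s) :
    ∀ᵐ ω ∂P, Tendsto (fun n : ℕ => lam n ^ 2 * ((n : ℝ)⁻¹ ^ 2 *
      ∑ i ∈ Finset.range n, ∑ j ∈ Finset.range n, H (lam n • (X i ω - X j ω)))) atTop
      (𝓝 ((∫ s, H s) * ∫ x, designDensity a x ^ 2)) := by
  have := isProbabilityMeasure_designLaw hX
  set μ := designLaw a with hμdef
  have hμ : ∀ i, P.map (X i) = μ := hX.law
  have hC0 : 0 ≤ C := (abs_nonneg _).trans (hC 0)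
  set I := ∫ s, |H s| with hI
  have hI0 : 0 ≤ I := integral_nonneg fun _ => abs_nonneg _
  let h : ℕ → Plane → Plane → ℝ := fun n x y => lam n ^ 2 * H (lam n • (x - y))
  have hhm : ∀ n, Measurable (Function.uncurry (h n)) := fun n => by
    have : Measurable fun p : Plane × Plane => lam n • (p.1 - p.2) := by fun_prop
    exact (hHm.comp this).const_mul _
  have hhB : ∀ n x y, |h n x y| ≤ lam n ^ 2 * C := fun n x y => by
    simp only [h]
    rw [abs_mul, abs_of_nonneg (sq_nonneg _)]
    exact mul_le_mul_of_nonneg_left (hC _) (sq_nonneg _)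
  have hhs : ∀ n x y, h n x y = h n y x := fun n x y => by
    simp only [h]
    rw [← neg_sub, smul_neg, hsymm]
  set h1 : ℕ → Plane → ℝ := fun n x => ∫ y, h n x y ∂μ with hh1
  set θ : ℕ → ℝ := fun n => ∫ x, h1 n x ∂μ with hθ
  have hθlim : Tendsto θ atTop (𝓝 ((∫ s, H s) * ∫ x, designDensity a x ^ 2)) :=
    tendsto_integral_kernel ha (tendsto_scaling hlam) hHi
  have hh1m : ∀ n, Measurable (h1 n) := fun n =>
    (hhm n).stronglyMeasurable.integral_prod_right.measurable
  have hh1B : ∀ n, 1 ≤ n → ∀ x, |h1 n x| ≤ a / 4 * I := fun n hn x => by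
    have hl := (hlam n hn).1
    simp only [hh1, h]
    rw [integral_const_mul, abs_mul, abs_of_nonneg (sq_nonneg _)]
    have := mul_le_mul_of_nonneg_left (abs_integral_kernel_le ha hl hHi x) (sq_nonneg (lam n))
    rwa [mul_inv_cancel_left₀ (by positivity)] at this
  -- the degenerate part: second moments of order `λ² / n² = n ^ (-3 / 2)`
  let D : ℕ → Ω → ℝ := fun n ω => (n : ℝ)⁻¹ ^ 2 * ∑ p ∈ (Finset.range n).offDiag,
    (h n (X p.1 ω) (X p.2 ω) - h1 n (X p.1 ω) - h1 n (X p.2 ω) + θ n)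
  have hrem := fun n => integral_sq_uStatistic_remainder_le hX.measurable hμ hX.indep (hhm n)
    (hhB n) (hhs n) n
  have hD : ∀ᵐ ω ∂P, Tendsto (fun n => D n ω) atTop (𝓝 0) := by
    refine ae_tendsto_zero_of_summable_sq (c := fun n : ℕ =>
      2 * (C * (a / 4 * I)) * (1 / (n : ℝ) ^ (3 / 2 : ℝ))) (fun n => ?_) (fun n => ?_) ?_ (fun n => ?_)
    · refine Measurable.const_mul (Finset.measurable_sum _ fun p _ => ?_) _
      exact ((((hhm n).comp ((hX.measurable p.1).prodMk (hX.measurable p.2))).sub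
        ((hh1m n).comp (hX.measurable p.1))).sub ((hh1m n).comp (hX.measurable p.2))).add_const _
    · simp only [D, mul_pow]
      exact (hrem n).1.const_mul _
    · exact (Real.summable_one_div_nat_rpow.2 (by norm_num)).mul_left _
    · rcases Nat.eq_zero_or_pos n with rfl | hn
      · simp [D]
      have hl := (hlam n hn).1
      have hn0 : (0 : ℝ) < n := by exact_mod_cast hn
      have hsq : ∫ x, ∫ y, h n x y ^ 2 ∂μ ∂μ ≤ lam n ^ 2 * (C * (a / 4 * I)) := by
        have hin : ∀ x, ∫ y, h n x y ^ 2 ∂μ ≤ lam n ^ 2 * (C * (a / 4 * I)) := by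
          intro x
          have hH2 : Integrable fun s => H s ^ 2 := by
            refine (hHi.abs.const_mul C).mono' (hHm.pow_const 2).aestronglyMeasurable
              (Eventually.of_forall fun s => ?_)
            rw [norm_pow, sq, Real.norm_eq_abs]
            exact mul_le_mul_of_nonneg_right (hC s) (abs_nonneg _)
          have e1 := le_of_abs_le (abs_integral_kernel_le ha hl hH2 x)
          have e2 : ∫ s, |H s ^ 2| ≤ C * I := by
            rw [hI, ← integral_const_mul]
            refine integral_mono hH2.abs (hHi.abs.const_mul C) fun s => ?_
            simp only
            rw [abs_pow, sq]
            exact mul_le_mul_of_nonneg_right (hC s) (abs_nonneg _)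
          have e3 : ∫ y, h n x y ^ 2 ∂μ = (lam n ^ 2) ^ 2 * ∫ y, H (lam n • (x - y)) ^ 2 ∂μ := by
            rw [← integral_const_mul]
            refine integral_congr_ae (Eventually.of_forall fun y => ?_)
            simp only [h]; ring
          rw [e3]
          calc (lam n ^ 2) ^ 2 * ∫ y, H (lam n • (x - y)) ^ 2 ∂μ
              ≤ (lam n ^ 2) ^ 2 * ((lam n ^ 2)⁻¹ * (a / 4 * (C * I))) := by
                refine mul_le_mul_of_nonneg_left (e1.trans ?_) (by positivity)
                gcongr
            _ = lam n ^ 2 * (C * (a / 4 * I)) := by field_simp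
        have hle : ∀ x, ‖∫ y, h n x y ^ 2 ∂μ‖ ≤ lam n ^ 2 * (C * (a / 4 * I)) := fun x => by
          rw [Real.norm_of_nonneg (integral_nonneg fun _ => sq_nonneg _)]; exact hin x
        refine (le_abs_self _).trans ?_
        simpa using norm_integral_le_of_norm_le_const (μ := μ) (Eventually.of_forall hle)
      have e4 : ∫ ω, D n ω ^ 2 ∂P ≤ (n : ℝ)⁻¹ ^ 4 * (2 * n ^ 2 * (lam n ^ 2 * (C * (a / 4 * I)))) := by
        simp only [D, mul_pow]
        rw [integral_const_mul, ← pow_mul]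
        refine mul_le_mul_of_nonneg_left ((hrem n).2.trans ?_) (by positivity)
        exact mul_le_mul_of_nonneg_left hsq (by positivity)
      refine e4.trans (le_of_eq ?_)
      have e5 : (n : ℝ) ^ (3 / 2 : ℝ) = n * lam n ^ 2 := by
        rw [scaling_sq hlam hn, Real.sqrt_eq_rpow, ← Real.rpow_one_add' hn0.le (by norm_num)]
        norm_num
      have e6 : (n : ℝ) = (lam n ^ 2) ^ 2 := (hlam n hn).2
      rw [e5, e6]
      field_simp
  -- the linear part: its summands are bounded uniformly in `n`, with exponential tails
  have hL : ∀ᵐ ω ∂P, Tendsto (fun n : ℕ => (n : ℝ)⁻¹ * ∑ i ∈ Finset.range n,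
      (h1 n (X i ω) - θ n)) atTop (𝓝 0) := by
    set B := a / 4 * I + 1 with hB
    have hB0 : 0 < B := by positivity
    have hk : ∀ k : ℕ, ∀ᵐ ω ∂P, ∀ᶠ n : ℕ in atTop,
        |(n : ℝ)⁻¹ * ∑ i ∈ Finset.range n, (h1 n (X i ω) - θ n)| < 1 / ((k : ℝ) + 1) := by
      intro k
      set ε : ℝ := 1 / ((k : ℝ) + 1) with hε
      have hε0 : 0 < ε := by positivity
      let S : ℕ → Set Ω := fun n => if 1 ≤ n then
        {ω | n * ε ≤ |∑ i ∈ Finset.range n, (h1 n (X i ω) - θ n)|} else ∅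
      have hS : ∀ n, P (S n) ≤ ENNReal.ofReal (2 * Real.exp (-(ε ^ 2 / (2 * B ^ 2))) ^ n) := by
        intro n
        by_cases hn : 1 ≤ n
        · have hn0 : (0 : ℝ) < n := by exact_mod_cast hn
          have := measureReal_abs_sum_ge_le hX.measurable hμ hX.indep (hh1m n) hB0.le
            (fun x => (hh1B n hn x).trans (by linarith)) n (ε := n * ε) (by positivity)
          simp only [S, if_pos hn]
          rw [← ENNReal.ofReal_toReal (measure_ne_top P _)]
          refine ENNReal.ofReal_le_ofReal (this.trans (le_of_eq ?_))
          rw [← Real.exp_nat_mul]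
          congr 2
          field_simp
        · simp [S, hn]
      have hsum : ∑' n, P (S n) ≠ ⊤ := by
        refine ne_top_of_le_ne_top ?_ (ENNReal.tsum_le_tsum hS)
        refine Summable.tsum_ofReal_ne_top (Summable.mul_left 2
          (summable_geometric_of_lt_one (Real.exp_nonneg _) ?_))
        rw [Real.exp_lt_one_iff]
        have : 0 < ε ^ 2 / (2 * B ^ 2) := by positivity
        linarith
      filter_upwards [ae_eventually_notMem hsum] with ω hω
      filter_upwards [hω, eventually_ge_atTop 1] with n hn hn1
      simp only [S, if_pos hn1, Set.mem_ofPred_eq, not_le] at hn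
      have hn0 : (0 : ℝ) < n := by exact_mod_cast hn1
      rw [abs_mul, abs_of_nonneg (by positivity : 0 ≤ (n : ℝ)⁻¹), inv_mul_lt_iff₀ hn0]
      exact hn
    filter_upwards [ae_all_iff.2 hk] with ω hω
    rw [Metric.tendsto_atTop']
    intro ε hε
    obtain ⟨k, hk⟩ := exists_nat_one_div_lt hε
    obtain ⟨N, hN⟩ := eventually_atTop.1 (hω k)
    refine ⟨N, fun n hn => ?_⟩
    rw [Real.dist_eq, sub_zero]
    exact (hN n hn.le).trans hk
  filter_upwards [hD, hL] with ω h2 h3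
  have hinv : Tendsto (fun n : ℕ => ((n : ℝ))⁻¹) atTop (𝓝 0) := tendsto_inv_atTop_nhds_zero_nat
  have hdiag : Tendsto (fun n : ℕ => lam n ^ 2 * (n : ℝ)⁻¹ * H 0) atTop (𝓝 0) := by
    have h4 : Tendsto (fun n => (lam n ^ 2)⁻¹ * H 0) atTop (𝓝 (0 * H 0)) :=
      (tendsto_inv_atTop_zero.comp ((tendsto_pow_atTop (by norm_num : (2 : ℕ) ≠ 0)).comp
        (tendsto_scaling hlam))).mul_const _
    rw [zero_mul] at h4
    refine h4.congr' ?_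
    filter_upwards [eventually_ge_atTop 1] with n hn
    have hl := (hlam n hn).1
    rw [(hlam n hn).2]
    field_simp
  have hfin : Tendsto (fun n : ℕ => lam n ^ 2 * (n : ℝ)⁻¹ * H 0 + (D n ω +
      2 * (1 - (n : ℝ)⁻¹) * ((n : ℝ)⁻¹ * ∑ i ∈ Finset.range n, (h1 n (X i ω) - θ n)) +
      (1 - (n : ℝ)⁻¹) * θ n)) atTop (𝓝 (0 + (0 + 2 * (1 - 0) * 0 + (1 - 0) *
        ((∫ s, H s) * ∫ x, designDensity a x ^ 2)))) := by
    have h5 : Tendsto (fun n : ℕ => 1 - (n : ℝ)⁻¹) atTop (𝓝 (1 - 0)) := tendsto_const_nhds.sub hinv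
    exact hdiag.add ((h2.add ((h5.const_mul 2).mul h3)).add (h5.mul hθlim))
  have hz : (0 + (0 + 2 * (1 - 0) * 0 + (1 - 0) * ((∫ s, H s) * ∫ x, designDensity a x ^ 2)))
      = (∫ s, H s) * ∫ x, designDensity a x ^ 2 := by ring
  rw [hz] at hfin
  refine hfin.congr' ?_
  filter_upwards [eventually_ge_atTop 1] with n hn
  have hn0 : (0 : ℝ) < n := by exact_mod_cast hn
  have hsplit : ∀ F : ℕ → ℕ → ℝ, ∑ i ∈ Finset.range n, ∑ j ∈ Finset.range n, F i j =
      ∑ i ∈ Finset.range n, F i i + ∑ p ∈ (Finset.range n).offDiag, F p.1 p.2 := by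
    intro F
    rw [← Finset.sum_product', ← Finset.diag_union_offDiag,
      Finset.sum_union (Finset.disjoint_diag_offDiag _), Finset.sum_diag]
  have hoff : ∀ f : ℕ → ℝ, ∑ p ∈ (Finset.range n).offDiag, f p.1 =
      (n - 1) * ∑ i ∈ Finset.range n, f i := by
    intro f
    have := hsplit fun i _ => f i
    simp only [Finset.sum_const, Finset.card_range, nsmul_eq_mul, ← Finset.mul_sum] at this
    linarith
  have hoff2 : ∀ f : ℕ → ℝ, ∑ p ∈ (Finset.range n).offDiag, f p.2 =
      (n - 1) * ∑ i ∈ Finset.range n, f i := by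
    intro f
    have := hsplit fun _ j => f j
    simp only [Finset.sum_const, Finset.card_range, nsmul_eq_mul] at this
    linarith
  have hDn : D n ω = (n : ℝ)⁻¹ ^ 2 * (∑ p ∈ (Finset.range n).offDiag, h n (X p.1 ω) (X p.2 ω)
      - (n - 1) * ∑ i ∈ Finset.range n, h1 n (X i ω) - (n - 1) * ∑ i ∈ Finset.range n, h1 n (X i ω)
      + (n - 1) * (n * θ n)) := by
    simp only [D]
    rw [Finset.sum_add_distrib, Finset.sum_sub_distrib, Finset.sum_sub_distrib,
      hoff fun i => h1 n (X i ω), hoff2 fun i => h1 n (X i ω), hoff fun _ => θ n]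
    simp
  have hcalc : lam n ^ 2 * ((n : ℝ)⁻¹ ^ 2 * ∑ i ∈ Finset.range n, ∑ j ∈ Finset.range n,
      H (lam n • (X i ω - X j ω))) = (n : ℝ)⁻¹ ^ 2 * (n * (lam n ^ 2 * H 0) +
      ∑ p ∈ (Finset.range n).offDiag, h n (X p.1 ω) (X p.2 ω)) := by
    rw [mul_left_comm, hsplit fun i j => H (lam n • (X i ω - X j ω)), mul_add, Finset.mul_sum,
      Finset.mul_sum]
    simp [h]
  rw [hcalc, hDn, Finset.sum_sub_distrib]
  simp only [Finset.sum_const, Finset.card_range, nsmul_eq_mul]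
  field_simp
  ring

/-- Almost sure convergence of the scaled conditional variance of the sample mean. -/
theorem ae_tendsto_scaledCondVar {Ω : Type u} [MeasurableSpace Ω] {P : Measure Ω}
    [IsProbabilityMeasure P] {a : ℝ} (ha : 4 < a) {Y : Plane → Ω → ℝ} {X : ℕ → Ω → Plane}
    {lam : ℕ → ℝ} (hY : IsMixingField P Y) (hX : IsDesign a P X) (hYX : IsMeasurableIndep P Y X)
    (hlam : IsScaling lam) :
    ∀ᵐ ω ∂P, Tendsto (fun n : ℕ => scaledCondVar P Y X n (lam n) ω) atTop
      (𝓝 (sigmaInftySq a P Y)) := by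
  have hm := measurable_uncurry_of_isMeasurableIndep hYX
  obtain ⟨C, -, hC⟩ := exists_abs_autocov_le hY
  filter_upwards [ae_all_iff.2 fun n => scaledCondVar_ae_eq hY hX.measurable hYX n (lam n),
    ae_tendsto_pairSum ha hX hlam (measurable_autocov hY hm) (integrable_autocov hY hm) hC
      (autocov_neg hY)] with ω h1 h2
  exact h2.congr fun n => (h1 n).symm

/-! ### Positivity of the integrated autocovariance -/

/-- On a finite product measure space, an integrable function whose integral over every measurable
rectangle vanishes is zero almost everywhere. -/
theorem ae_eq_zero_of_setIntegral_prod_eq_zero {α β : Type*} [MeasurableSpace α]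
    [MeasurableSpace β] {μ : Measure α} {ν : Measure β} [IsFiniteMeasure μ] [IsFiniteMeasure ν]
    {f : α × β → ℝ} (hf : Integrable f (μ.prod ν))
    (h : ∀ s t, MeasurableSet s → MeasurableSet t → ∫ z in s ×ˢ t, f z ∂(μ.prod ν) = 0) :
    f =ᵐ[μ.prod ν] 0 := by
  set π := μ.prod ν with hπ
  have hfin : ∀ E : Set (α × β), ∫⁻ z in E, ENNReal.ofReal (f z) ∂π ≠ ⊤ := fun E =>
    (hf.integrableOn (s := E)).lintegral_lt_top.ne
  have hfin' : ∀ E : Set (α × β), ∫⁻ z in E, ENNReal.ofReal (-f z) ∂π ≠ ⊤ := fun E =>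
    (hf.neg.integrableOn (s := E)).lintegral_lt_top.ne
  have hiff : ∀ E : Set (α × β), ∫ z in E, f z ∂π = 0 ↔
      ∫⁻ z in E, ENNReal.ofReal (f z) ∂π = ∫⁻ z in E, ENNReal.ofReal (-f z) ∂π := fun E => by
    rw [integral_eq_lintegral_pos_part_sub_lintegral_neg_part hf.integrableOn, sub_eq_zero,
      ENNReal.toReal_eq_toReal_iff' (hfin E) (hfin' E)]
  have : IsFiniteMeasure (π.withDensity fun z => ENNReal.ofReal (f z)) :=
    isFiniteMeasure_withDensity_ofReal hf.2
  have heq : π.withDensity (fun z => ENNReal.ofReal (f z)) =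
      π.withDensity fun z => ENNReal.ofReal (-f z) := by
    refine Measure.ext_prod fun {s t} hs ht => ?_
    rw [withDensity_apply _ (hs.prod ht), withDensity_apply _ (hs.prod ht)]
    exact (hiff _).1 (h s t hs ht)
  refine hf.ae_eq_zero_of_forall_setIntegral_eq_zero fun E hE _ => (hiff E).2 ?_
  rw [← withDensity_apply _ hE, ← withDensity_apply _ hE, heq]

/-- A measurable stationary field with non-negative covariances cannot be uncorrelated at almost
every lag: its integrals over all sets would vanish, hence so would the field itself. -/
theorem integral_autocov_pos {Ω : Type u} [MeasurableSpace Ω] {P : Measure Ω}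
    [IsProbabilityMeasure P] {Y : Plane → Ω → ℝ} (hY : IsMixingField P Y)
    (hm : Measurable (Function.uncurry Y)) (h0 : autocov P Y 0 ≠ 0)
    (hnn : ∀ s, 0 ≤ autocov P Y s) : 0 < ∫ s, autocov P Y s := by
  refine lt_of_le_of_ne (integral_nonneg hnn) fun hzero => h0 ?_
  have hae : autocov P Y =ᵐ[volume] 0 :=
    (integral_eq_zero_iff_of_nonneg hnn (integrable_autocov hY hm)).1 hzero.symm
  obtain ⟨M, hM⟩ := hY.bounded
  set ν : Measure Plane := volume.restrict (Set.Ioc 0 1 ×ˢ Set.Ioc 0 1) with hν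
  have hν1 : ν Set.univ = 1 := by
    rw [hν, Measure.restrict_apply_univ, Measure.volume_eq_prod, Measure.prod_prod]; simp
  have : IsFiniteMeasure ν := ⟨by rw [hν1]; exact ENNReal.one_lt_top⟩
  have hbd : ∀ ρ : Measure Plane, [IsFiniteMeasure ρ] →
      ∀ᵐ z ∂(ρ.prod P), ‖Function.uncurry Y z‖ ≤ M := fun ρ _ =>
    (Measure.ae_prod_iff_ae_ae (measurableSet_le hm.norm measurable_const)).2
      (Eventually.of_forall hM)
  have hint : Integrable (Function.uncurry Y) (ν.prod P) :=
    Integrable.of_bound hm.aestronglyMeasurable M (hbd ν)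
  have hYY : Measurable fun q : (Plane × Plane) × Ω => Y q.1.1 q.2 * Y q.1.2 q.2 :=
    (hm.comp ((measurable_fst.comp measurable_fst).prodMk measurable_snd)).mul
      (hm.comp ((measurable_snd.comp measurable_fst).prodMk measurable_snd))
  -- the second moment of the integral over `s` is a double integral of the autocovariance
  have hZ : ∀ s : Set Plane, MeasurableSet s → ∀ᵐ ω ∂P, ∫ u in s, Y u ω ∂ν = 0 := by
    intro s hs
    have hYYi : Integrable (Function.uncurry fun (p : Plane × Plane) ω => Y p.1 ω * Y p.2 ω)
        (((ν.restrict s).prod (ν.restrict s)).prod P) := by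
      refine Integrable.of_bound hYY.aestronglyMeasurable (M * M) ?_
      refine (Measure.ae_prod_iff_ae_ae (measurableSet_le hYY.norm measurable_const)).2
        (Eventually.of_forall fun p => ?_)
      filter_upwards [hM p.1, hM p.2] with ω h1 h2
      rw [norm_mul]
      exact mul_le_mul h1 h2 (abs_nonneg _) ((abs_nonneg _).trans h1)
    have hsq : ∀ ω, (∫ u in s, Y u ω ∂ν) ^ 2 =
        ∫ p, Y p.1 ω * Y p.2 ω ∂((ν.restrict s).prod (ν.restrict s)) := fun ω => by
      rw [integral_prod_mul (fun u => Y u ω) (fun u => Y u ω), sq]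
    have hE : ∫ ω, (∫ u in s, Y u ω ∂ν) ^ 2 ∂P = 0 := by
      simp_rw [hsq]
      rw [← integral_integral_swap hYYi]
      simp_rw [integral_mul_eq_autocov hY]
      have hz : ∀ᵐ p ∂((ν.restrict s).prod (ν.restrict s)), autocov P Y (p.1 - p.2) = 0 := by
        have hms : MeasurableSet {p : Plane × Plane | autocov P Y (p.1 - p.2) = 0} :=
          ((measurable_autocov hY hm).comp (measurable_fst.sub measurable_snd))
            (measurableSet_singleton 0)
        refine (Measure.ae_prod_iff_ae_ae hms).2 (Eventually.of_forall fun u => ?_)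
        refine ae_mono (Measure.restrict_le_self.trans Measure.restrict_le_self) ?_
        exact (Measure.measurePreserving_sub_left volume u).quasiMeasurePreserving.ae hae
      rw [integral_congr_ae hz]
      simp
    have hi2 : Integrable (fun ω => (∫ u in s, Y u ω ∂ν) ^ 2) P := by
      simp_rw [hsq]
      exact hYYi.integral_prod_right
    have := (integral_eq_zero_iff_of_nonneg (fun ω => sq_nonneg _) hi2).1 hE
    filter_upwards [this] with ω hω
    exact pow_eq_zero_iff (two_ne_zero) |>.1 hω
  have hH : Function.uncurry Y =ᵐ[ν.prod P] 0 := by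
    refine ae_eq_zero_of_setIntegral_prod_eq_zero hint fun s t hs ht => ?_
    rw [← Measure.prod_restrict, integral_prod_symm]
    · have h1 : ∀ᵐ ω ∂(P.restrict t), ∫ u in s, Function.uncurry Y (u, ω) ∂ν = 0 :=
        ae_restrict_of_ae (hZ s hs)
      rw [integral_congr_ae h1]
      simp
    · rw [Measure.prod_restrict]; exact hint.integrableOn
  -- the field vanishes almost everywhere, but its second moment is the variance `σ(0)`
  have hfinal : ∫ z, Function.uncurry Y z ^ 2 ∂(ν.prod P) = autocov P Y 0 := by
    rw [integral_prod]
    · have h1 : ∀ u, ∫ ω, Function.uncurry Y (u, ω) ^ 2 ∂P = autocov P Y 0 := fun u => by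
        rw [← sub_self u, ← integral_mul_eq_autocov hY]
        simp only [Function.uncurry, sq]
      simp_rw [h1]
      simp [Measure.real, hν1]
    · refine Integrable.of_bound (hm.pow_const 2).aestronglyMeasurable (M ^ 2) ?_
      filter_upwards [hbd ν] with z hz
      rw [norm_pow]
      exact pow_le_pow_left₀ (norm_nonneg _) hz 2
  rw [← hfinal, integral_congr_ae (g := fun _ => (0 : ℝ))]
  · simp
  · filter_upwards [hH] with z hz
    simp [hz]

/-! ### The Efron–Stein inequality on a finite product space -/

section Bootstrap

variable {A : Type*} [Finite A] [MeasurableSpace A] [MeasurableSingletonClass A]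

/-- One step of the tensorization of the variance: the second coordinate is averaged out, and the
first one is compared with a function that does not see it. -/
theorem variance_prod_le {B : Type*} [Finite B] [MeasurableSpace B] [MeasurableSingletonClass B]
    (μ : Measure A) (ν : Measure B) [IsProbabilityMeasure μ] [IsProbabilityMeasure ν]
    (F : A × B → ℝ) (G : B → ℝ) :
    Var[F; μ.prod ν] ≤ ∫ x, Var[fun y => F (x, y); ν] ∂μ +
      ∫ p, (F p - G p.2) ^ 2 ∂(μ.prod ν) := by
  set m : A → ℝ := fun x => ∫ y, F (x, y) ∂ν with hm
  have h1 : Var[F; μ.prod ν] = ∫ x, ∫ y, F (x, y) ^ 2 ∂ν ∂μ - (∫ x, m x ∂μ) ^ 2 := by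
    rw [variance_eq_sub (MemLp.of_discrete), integral_prod _ Integrable.of_finite,
      integral_prod _ Integrable.of_finite]
    rfl
  have h2 : ∀ x, Var[fun y => F (x, y); ν] = ∫ y, F (x, y) ^ 2 ∂ν - m x ^ 2 := fun x => by
    rw [variance_eq_sub (MemLp.of_discrete)]; rfl
  have h3 : Var[m; μ] = ∫ x, m x ^ 2 ∂μ - (∫ x, m x ∂μ) ^ 2 := by
    rw [variance_eq_sub (MemLp.of_discrete)]; rfl
  have h4 : Var[F; μ.prod ν] = ∫ x, Var[fun y => F (x, y); ν] ∂μ + Var[m; μ] := by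
    simp_rw [h1, h2, h3]
    rw [integral_sub Integrable.of_finite Integrable.of_finite]
    ring
  rw [h4]
  gcongr
  set c := ∫ y, G y ∂ν with hc
  have h5 : Var[m; μ] ≤ ∫ x, (m x - c) ^ 2 ∂μ := by
    rw [← variance_sub_const (X := m) (by fun_prop) c]
    exact variance_le_expectation_sq (by fun_prop)
  refine h5.trans ?_
  rw [integral_prod _ Integrable.of_finite]
  refine integral_mono Integrable.of_finite Integrable.of_finite fun x => ?_
  have h6 : m x - c = ∫ y, (F (x, y) - G y) ∂ν := by
    rw [integral_sub Integrable.of_finite Integrable.of_finite]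
  have h7 := variance_nonneg (fun y => F (x, y) - G y) ν
  rw [variance_eq_sub MemLp.of_discrete] at h7
  simp only [h6]
  simp only [Pi.pow_apply] at h7
  linarith

/-- The Efron–Stein inequality for sequences, by induction on their length. -/
theorem efronStein_fin (μ : Measure A) [IsProbabilityMeasure μ] (n : ℕ) :
    ∀ (f : (Fin n → A) → ℝ) (g : Fin n → (Fin n → A) → ℝ),
      (∀ k, DependsOn (g k) {k}ᶜ) →
      Var[f; Measure.pi fun _ : Fin n => μ] ≤
        ∑ k, ∫ κ, (f κ - g k κ) ^ 2 ∂(Measure.pi fun _ : Fin n => μ) := by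
  induction n with
  | zero =>
    intro f g _
    have : f = fun _ => f default := funext fun κ => by rw [Subsingleton.elim κ default]
    rw [this]
    rw [variance_eq_integral (by fun_prop)]
    simp
  | succ n ih =>
    intro f g hg
    have hmp := (measurePreserving_piFinSuccAbove (fun _ : Fin (n + 1) => μ) 0).symm
    have hcons : ∀ p : A × (Fin n → A), (MeasurableEquiv.piFinSuccAbove (fun _ => A) 0).symm p =
        Fin.cons p.1 p.2 := fun p => by
      simp [MeasurableEquiv.piFinSuccAbove]
      rfl
    have htr : ∀ F : (Fin (n + 1) → A) → ℝ, ∫ κ, F κ ∂(Measure.pi fun _ : Fin (n + 1) => μ) =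
        ∫ p, F (Fin.cons p.1 p.2) ∂(μ.prod (Measure.pi fun _ : Fin n => μ)) := fun F => by
      rw [← hmp.integral_comp' F]
      simp_rw [hcons]
    have hvar : Var[f; Measure.pi fun _ : Fin (n + 1) => μ] =
        Var[fun p : A × (Fin n → A) => f (Fin.cons p.1 p.2);
          μ.prod (Measure.pi fun _ : Fin n => μ)] := by
      rw [← hmp.variance_fun_comp (f := f) (by fun_prop)]
      simp_rw [hcons]
    obtain ⟨x0⟩ : Nonempty A := μ.nonempty_of_neZero
    rw [hvar, Fin.sum_univ_succ]
    refine (variance_prod_le μ _ _ (fun y => g 0 (Fin.cons x0 y))).trans ?_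
    rw [add_comm]
    refine add_le_add (le_of_eq ?_) ?_
    · rw [htr]
      refine integral_congr_ae (Eventually.of_forall fun p => ?_)
      have : g 0 (Fin.cons x0 p.2) = g 0 (Fin.cons p.1 p.2) := by
        refine hg 0 fun i hi => ?_
        obtain ⟨j, rfl⟩ := Fin.exists_succ_eq.2 hi
        simp
      simp only [this]
    · have h1 : ∀ x, Var[fun y => f (Fin.cons x y); Measure.pi fun _ : Fin n => μ] ≤
          ∑ k : Fin n, ∫ y, (f (Fin.cons x y) - g k.succ (Fin.cons x y)) ^ 2
            ∂(Measure.pi fun _ : Fin n => μ) := fun x => by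
        refine ih _ (fun k y => g k.succ (Fin.cons x y)) fun k y z hyz => hg k.succ fun i hi => ?_
        refine Fin.cases ?_ (fun j hj => ?_) i hi
        · simp
        · simp only [Fin.cons_succ]
          exact hyz j (fun h => hj (by simp only [Set.mem_singleton_iff] at h ⊢; rw [h]))
      refine (integral_mono Integrable.of_finite Integrable.of_finite h1).trans (le_of_eq ?_)
      rw [integral_finsetSum _ fun _ _ => Integrable.of_finite]
      refine Finset.sum_congr rfl fun k _ => ?_
      rw [htr, integral_prod _ Integrable.of_finite]

/-- **Efron–Stein inequality** on a finite product space, with arbitrary surrogates `g k` that do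
not depend on the `k`-th coordinate. -/
theorem efronStein {ι : Type*} [Fintype ι] (μ : Measure A) [IsProbabilityMeasure μ]
    (f : (ι → A) → ℝ) (g : ι → (ι → A) → ℝ) (hg : ∀ k, DependsOn (g k) {k}ᶜ) :
    Var[f; Measure.pi fun _ : ι => μ] ≤
      ∑ k, ∫ κ, (f κ - g k κ) ^ 2 ∂(Measure.pi fun _ : ι => μ) := by
  classical
  let e := Fintype.equivFin ι
  have hmp := measurePreserving_piCongrLeft (fun _ : ι => μ) e.symm
  have he : ∀ z : Fin (Fintype.card ι) → A,
      MeasurableEquiv.piCongrLeft (fun _ : ι => A) e.symm z = fun i => z (e i) := fun z => by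
    ext i
    obtain ⟨j, rfl⟩ := e.symm.surjective i
    rw [MeasurableEquiv.coe_piCongrLeft, Equiv.piCongrLeft_apply_apply]; simp
  rw [← hmp.variance_fun_comp (f := f) (by fun_prop)]
  simp_rw [← hmp.integral_comp', he]
  refine (efronStein_fin μ _ (fun z => f fun i => z (e i))
    (fun k z => g (e.symm k) fun i => z (e i)) fun k y z hyz => hg _ fun i hi => ?_).trans
    (le_of_eq ?_)
  · refine hyz (e i) fun h => hi ?_
    simp only [Set.mem_singleton_iff] at h ⊢
    rw [← h]; simp
  · rw [← e.sum_comp]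
    simp

theorem integral_coord {ι : Type*} [Fintype ι] (μ : Measure A) [IsProbabilityMeasure μ]
    (k : ι) (u : A → ℝ) : ∫ κ, u (κ k) ∂(Measure.pi fun _ : ι => μ) = ∫ x, u x ∂μ := by
  have hmp := measurePreserving_eval (fun _ : ι => μ) k
  have h := integral_map (μ := Measure.pi fun _ : ι => μ) hmp.measurable.aemeasurable
    (Measurable.of_discrete (f := u)).aestronglyMeasurable
  rw [hmp.map_eq] at h
  exact h.symm

/-- Under a product measure a coordinate is independent of a function of the others. -/
theorem integral_coord_mul {ι : Type*} [Fintype ι] (μ : Measure A) [IsProbabilityMeasure μ]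
    (k : ι) (u : A → ℝ) {φ : (ι → A) → ℝ} (hφ : DependsOn φ {k}ᶜ) :
    ∫ κ, u (κ k) * φ κ ∂(Measure.pi fun _ : ι => μ) =
      (∫ x, u x ∂μ) * ∫ κ, φ κ ∂(Measure.pi fun _ : ι => μ) := by
  classical
  obtain ⟨x0⟩ : Nonempty A := μ.nonempty_of_neZero
  have hI : iIndepFun (fun (i : ι) (κ : ι → A) => κ i) (Measure.pi fun _ : ι => μ) :=
    iIndepFun_pi (μ := fun _ : ι => μ) (X := fun _ => id) fun _ => aemeasurable_id
  have hI2 := hI.indepFun_finset {k} {k}ᶜ disjoint_compl_right fun i => measurable_pi_apply i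
  let φ' : (({k}ᶜ : Finset ι) → A) → ℝ := fun z =>
    φ fun i => if h : i ∈ ({k}ᶜ : Finset ι) then z ⟨i, h⟩ else x0
  have hφ' : ∀ κ, φ κ = φ' fun i => κ i := fun κ => hφ fun i hi => by
    have : i ∈ ({k}ᶜ : Finset ι) := by simpa using hi
    simp [this]
  have hI3 := hI2.comp (φ := fun z : ({k} : Finset ι) → A => u (z ⟨k, by simp⟩)) (ψ := φ')
    (by fun_prop) (by fun_prop)
  have h := hI3.integral_fun_mul_eq_mul_integral (Measurable.of_discrete.aestronglyMeasurable)
    (Measurable.of_discrete.aestronglyMeasurable)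
  simp only [Function.comp_def] at h
  simp_rw [← hφ'] at h
  rw [h]
  congr 1
  exact integral_coord μ k u

end Bootstrap

/-! ### Variance of a ratio of sums -/

section Ratio

variable {A : Type*} [Finite A] [MeasurableSpace A] [MeasurableSingletonClass A] {ι : Type*}
  [Fintype ι]

/-- Negative moments of a sum of i.i.d. weights that are at least `v₀`, and at least `v₁` with
probability at least `1/4`: up to an event of probability `O(1 / #R)` the sum is of order
`#R * v₁`. -/
theorem integral_inv_pow_sum_le (μ : Measure A) [IsProbabilityMeasure μ] {N : A → ℝ} {v₀ v₁ : ℝ}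
    (hv₀ : 0 < v₀) (hv₁ : 0 < v₁) (hN : ∀ x, v₀ ≤ N x) {G : Set A} (hG : ∀ x ∈ G, v₁ ≤ N x)
    (hμG : 1 / 4 ≤ μ.real G) {R : Finset ι} (hR : R.Nonempty) (p : ℕ) :
    ∫ κ, ((∑ j ∈ R, N (κ j)) ^ p)⁻¹ ∂(Measure.pi fun _ : ι => μ) ≤
      ((R.card / 8 * v₁) ^ p)⁻¹ + ((R.card * v₀) ^ p)⁻¹ * (64 / R.card) := by
  classical
  set π := Measure.pi fun _ : ι => μ with hπ
  have hc : (0 : ℝ) < R.card := by exact_mod_cast hR.card_pos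
  set q := μ.real G with hq
  let Z : A → ℝ := G.indicator 1
  have hZm : ∫ x, Z x ∂μ = q := integral_indicator_one (Set.toFinite G).measurableSet
  let W : (ι → A) → ℝ := fun κ => ∑ j ∈ R, Z (κ j)
  have hWeq : W = ∑ i, fun κ : ι → A => (fun x => if i ∈ R then Z x else 0) (κ i) := by
    ext κ
    simp [W]
  have hWvar : Var[W; π] ≤ R.card := by
    rw [hWeq, hπ, variance_sum_pi (μ := fun _ : ι => μ)
      (X := fun i x => if i ∈ R then Z x else 0) fun _ => MemLp.of_discrete]
    have hle : ∀ i ∈ Finset.univ, Var[fun x => if i ∈ R then Z x else 0; μ] ≤ if i ∈ R then 1 else 0 := by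
      intro i _
      by_cases hi : i ∈ R
      · simp only [hi, if_true]
        refine (variance_le_expectation_sq (by fun_prop)).trans ?_
        have : ∀ x, (Z ^ 2) x ≤ 1 := fun x => by
          simp only [Z, Pi.pow_apply, Set.indicator_apply]
          split_ifs <;> simp
        refine (integral_mono Integrable.of_finite (integrable_const 1) this).trans ?_
        simp
      · simp only [hi, if_false]
        rw [variance_eq_integral (by fun_prop)]
        simp
    refine (Finset.sum_le_sum hle).trans ?_
    simp
  have hWmean : ∫ κ, W κ ∂π = R.card * q := by
    simp only [W]
    rw [integral_finsetSum _ fun _ _ => Integrable.of_finite]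
    have : ∀ j ∈ R, ∫ κ, Z (κ j) ∂π = q := fun j _ => by rw [hπ, integral_coord μ j Z, hZm]
    rw [Finset.sum_congr rfl this]; simp
  set Bad : Set (ι → A) := {κ | (R.card : ℝ) / 8 ≤ |W κ - ∫ κ, W κ ∂π|} with hBad
  have hBadP : π.real Bad ≤ 64 / R.card := by
    have h := meas_ge_le_variance_div_sq (μ := π) (X := W) MemLp.of_discrete
      (c := R.card / 8) (by positivity)
    rw [Measure.real]
    refine (ENNReal.toReal_mono ENNReal.ofReal_ne_top h).trans ?_
    rw [ENNReal.toReal_ofReal (div_nonneg (variance_nonneg _ _) (by positivity)),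
      div_le_div_iff₀ (by positivity) hc]
    nlinarith
  have hpt : ∀ κ, ((∑ j ∈ R, N (κ j)) ^ p)⁻¹ ≤
      ((R.card / 8 * v₁) ^ p)⁻¹ + ((R.card * v₀) ^ p)⁻¹ * Bad.indicator 1 κ := by
    intro κ
    have hlow : R.card * v₀ ≤ ∑ j ∈ R, N (κ j) := by
      rw [← nsmul_eq_mul]
      exact Finset.card_nsmul_le_sum _ _ _ fun j _ => hN _
    by_cases hκ : κ ∈ Bad
    · rw [Set.indicator_of_mem hκ, Pi.one_apply, mul_one]
      have h1 : ((∑ j ∈ R, N (κ j)) ^ p)⁻¹ ≤ ((R.card * v₀) ^ p)⁻¹ :=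
        inv_anti₀ (by positivity) (pow_le_pow_left₀ (by positivity) hlow p)
      have h2 : 0 ≤ ((R.card / 8 * v₁) ^ p)⁻¹ := by positivity
      linarith
    · rw [Set.indicator_of_notMem hκ, mul_zero, add_zero]
      have hκ' : |W κ - R.card * q| < R.card / 8 := by
        rw [← hWmean]; exact not_le.1 hκ
      have h1 : (R.card : ℝ) / 8 ≤ W κ := by
        have := (abs_lt.1 hκ').1
        nlinarith
      have h2 : W κ * v₁ ≤ ∑ j ∈ R, N (κ j) := by
        simp only [W]
        rw [Finset.sum_mul]
        refine Finset.sum_le_sum fun j _ => ?_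
        by_cases hj : κ j ∈ G
        · simp only [Z, Set.indicator_of_mem hj, Pi.one_apply, one_mul]; exact hG _ hj
        · simp only [Z, Set.indicator_of_notMem hj, zero_mul]; exact hv₀.le.trans (hN _)
      refine inv_anti₀ (by positivity) (pow_le_pow_left₀ (by positivity) (le_trans ?_ h2) p)
      exact mul_le_mul_of_nonneg_right h1 hv₁.le
  refine (integral_mono Integrable.of_finite Integrable.of_finite hpt).trans ?_
  rw [integral_add Integrable.of_finite Integrable.of_finite, integral_const_mul,
    integral_indicator_one (Set.toFinite _).measurableSet]
  simp only [integral_const, probReal_univ, one_smul]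
  gcongr

/-- Variance of a ratio of sums of i.i.d. pairs `(S, N)` over `K` draws. Deleting one draw gives the
surrogates in the Efron–Stein inequality, and the numerators are decoupled from the remaining
denominators. -/
theorem variance_ratio_le (μ : Measure A) [IsProbabilityMeasure μ] (S : A → ℝ) {N : A → ℝ}
    {v₀ v₁ : ℝ} (hv₀ : 0 < v₀) (hv₁ : 0 < v₁) (hN : ∀ x, v₀ ≤ N x) {G : Set A}
    (hG : ∀ x ∈ G, v₁ ≤ N x) (hμG : 1 / 4 ≤ μ.real G) {K : ℕ} (hK : Fintype.card ι = K)
    (hK4 : 4 ≤ K) :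
    Var[fun κ : ι → A => (∑ k, S (κ k)) / ∑ k, N (κ k); Measure.pi fun _ : ι => μ] ≤
      2 * K * (∫ x, S x ^ 2 ∂μ) * (((K / 16 * v₁) ^ 2)⁻¹ + ((K / 2 * v₀) ^ 2)⁻¹ * (128 / K)) +
      2 * K ^ 3 * (∫ x, N x ^ 2 ∂μ) * (∫ x, S x ^ 2 ∂μ) *
        (((K / 16 * v₁) ^ 4)⁻¹ + ((K / 2 * v₀) ^ 4)⁻¹ * (128 / K)) := by
  classical
  set π := Measure.pi fun _ : ι => μ with hπ
  have hNpos : ∀ x, 0 < N x := fun x => hv₀.trans_le (hN x)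
  have hK0 : (0 : ℝ) < K := by exact_mod_cast (by omega : 0 < K)
  have hK4' : (4 : ℝ) ≤ K := by exact_mod_cast hK4
  set s2 := ∫ x, S x ^ 2 ∂μ with hs2
  set n2 := ∫ x, N x ^ 2 ∂μ with hn2
  have hs20 : 0 ≤ s2 := integral_nonneg fun _ => sq_nonneg _
  have hn20 : 0 ≤ n2 := integral_nonneg fun _ => sq_nonneg _
  -- negative moments, for index sets that miss at most two draws
  have hneg : ∀ R : Finset ι, K - 2 ≤ R.card → ∀ p : ℕ,
      ∫ κ, ((∑ j ∈ R, N (κ j)) ^ p)⁻¹ ∂π ≤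
        ((K / 16 * v₁) ^ p)⁻¹ + ((K / 2 * v₀) ^ p)⁻¹ * (128 / K) := by
    intro R hR p
    have hRK : (K : ℝ) / 2 ≤ R.card := by
      have : ((K - 2 : ℕ) : ℝ) ≤ R.card := by exact_mod_cast hR
      rw [Nat.cast_sub (by omega)] at this
      push_cast at this
      linarith
    have hRne : R.Nonempty := Finset.card_pos.1 (by omega)
    refine (integral_inv_pow_sum_le μ hv₀ hv₁ hN hG hμG hRne p).trans ?_
    have e1 : (128 : ℝ) / K = 64 / (K / 2) := by field_simp; norm_num
    have e2 : (K : ℝ) / 16 = K / 2 / 8 := by ring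
    rw [e1, e2]
    gcongr
  let U : ι → (ι → A) → ℝ := fun k κ => ∑ j ∈ Finset.univ.erase k, S (κ j)
  let D : ι → (ι → A) → ℝ := fun k κ => ∑ j ∈ Finset.univ.erase k, N (κ j)
  have hdep : ∀ (F : A → ℝ) (R : Finset ι) (k : ι), k ∉ R →
      ∀ y z : ι → A, (∀ i ∈ ({k}ᶜ : Set ι), y i = z i) → ∑ j ∈ R, F (y j) = ∑ j ∈ R, F (z j) :=
    fun F R k hk y z hyz =>
    Finset.sum_congr rfl fun j hj => by
      rw [hyz j (fun h => hk (by rw [Set.mem_singleton_iff] at h; rwa [h] at hj))]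
  have hES := efronStein μ (fun κ : ι → A => (∑ k, S (κ k)) / ∑ k, N (κ k))
    (fun k κ => U k κ / D k κ) fun k y z hyz => by
      simp only [U, D]
      rw [hdep S _ k (Finset.notMem_erase k _) y z hyz, hdep N _ k (Finset.notMem_erase k _) y z hyz]
  refine hES.trans ?_
  have hcard1 : ∀ k : ι, (Finset.univ.erase k : Finset ι).card = K - 1 := fun k => by
    rw [Finset.card_erase_of_mem (Finset.mem_univ k), Finset.card_univ, hK]
  have hcard2 : ∀ k l : ι, l ≠ k → ((Finset.univ.erase k).erase l : Finset ι).card = K - 2 :=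
    fun k l hlk => by
      rw [Finset.card_erase_of_mem (Finset.mem_erase.2 ⟨hlk, Finset.mem_univ l⟩), hcard1]; omega
  -- `(S + U) / (N + D) - U / D = (S - N * (U / D)) / (N + D)`, and Cauchy–Schwarz for `U ^ 2`;
  -- in the term with `S (κ l)`, that draw is also removed from the denominator
  have hpt : ∀ k (κ : ι → A), ((∑ k, S (κ k)) / ∑ k, N (κ k) - U k κ / D k κ) ^ 2 ≤
      2 * (S (κ k) ^ 2 * ((D k κ) ^ 2)⁻¹) + 2 * K * ∑ l ∈ Finset.univ.erase k,
        N (κ k) ^ 2 * (S (κ l) ^ 2 *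
          ((∑ j ∈ (Finset.univ.erase k).erase l, N (κ j)) ^ 4)⁻¹) := by
    intro k κ
    have hD : 0 < D k κ := Finset.sum_pos (fun j _ => hNpos _)
      (Finset.card_pos.1 (by rw [hcard1]; omega))
    have eS : ∑ k, S (κ k) = S (κ k) + U k κ := (Finset.add_sum_erase _ _ (Finset.mem_univ k)).symm
    have eN : ∑ k, N (κ k) = N (κ k) + D k κ := (Finset.add_sum_erase _ _ (Finset.mem_univ k)).symm
    have hnk := hNpos (κ k)
    have e1 : (∑ k, S (κ k)) / ∑ k, N (κ k) - U k κ / D k κ =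
        (S (κ k) - N (κ k) * (U k κ / D k κ)) / (N (κ k) + D k κ) := by
      rw [eS, eN]; field_simp; ring
    have e2 : ((∑ k, S (κ k)) / ∑ k, N (κ k) - U k κ / D k κ) ^ 2 ≤
        (2 * S (κ k) ^ 2 + 2 * (N (κ k) * (U k κ / D k κ)) ^ 2) * ((D k κ) ^ 2)⁻¹ := by
      rw [e1, div_pow, div_eq_mul_inv]
      refine mul_le_mul ?_ ?_ (by positivity) (by positivity)
      · nlinarith [sq_nonneg (S (κ k) + N (κ k) * (U k κ / D k κ))]
      · exact inv_anti₀ (by positivity) (pow_le_pow_left₀ hD.le (by linarith) 2)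
    have e3 : (U k κ) ^ 2 ≤ K * ∑ l ∈ Finset.univ.erase k, S (κ l) ^ 2 := by
      refine sq_sum_le_card_mul_sum_sq.trans ?_
      refine mul_le_mul_of_nonneg_right ?_ (Finset.sum_nonneg fun _ _ => sq_nonneg _)
      rw [hcard1]; exact_mod_cast Nat.sub_le _ _
    have e4 : ∀ l ∈ Finset.univ.erase k, S (κ l) ^ 2 * ((D k κ) ^ 4)⁻¹ ≤
        S (κ l) ^ 2 * ((∑ j ∈ (Finset.univ.erase k).erase l, N (κ j)) ^ 4)⁻¹ := by
      intro l hl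
      have hl' := (Finset.mem_erase.1 hl).1
      refine mul_le_mul_of_nonneg_left ?_ (sq_nonneg _)
      have hpos : 0 < ∑ j ∈ (Finset.univ.erase k).erase l, N (κ j) :=
        Finset.sum_pos (fun j _ => hNpos _) (Finset.card_pos.1 (by rw [hcard2 k l hl']; omega))
      refine inv_anti₀ (by positivity) (pow_le_pow_left₀ hpos.le ?_ 4)
      exact Finset.sum_le_sum_of_subset_of_nonneg (Finset.erase_subset _ _)
        fun j _ _ => (hNpos _).le
    have e5 : (U k κ) ^ 2 * ((D k κ) ^ 4)⁻¹ ≤ K * ∑ l ∈ Finset.univ.erase k,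
        S (κ l) ^ 2 * ((∑ j ∈ (Finset.univ.erase k).erase l, N (κ j)) ^ 4)⁻¹ := by
      refine (mul_le_mul_of_nonneg_right e3 (by positivity)).trans ?_
      rw [mul_assoc, Finset.sum_mul]
      exact mul_le_mul_of_nonneg_left (Finset.sum_le_sum e4) hK0.le
    have e6 := mul_le_mul_of_nonneg_left e5 (by positivity : 0 ≤ 2 * N (κ k) ^ 2)
    refine e2.trans ?_
    rw [← Finset.mul_sum]
    have e7 : (2 * S (κ k) ^ 2 + 2 * (N (κ k) * (U k κ / D k κ)) ^ 2) * ((D k κ) ^ 2)⁻¹ =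
        2 * (S (κ k) ^ 2 * ((D k κ) ^ 2)⁻¹) + 2 * N (κ k) ^ 2 * ((U k κ) ^ 2 * ((D k κ) ^ 4)⁻¹) := by
      field_simp
    rw [e7]
    linarith
  have hk : ∀ k ∈ Finset.univ, ∫ κ, ((∑ k, S (κ k)) / ∑ k, N (κ k) - U k κ / D k κ) ^ 2 ∂π ≤
      2 * (s2 * (((K / 16 * v₁) ^ 2)⁻¹ + ((K / 2 * v₀) ^ 2)⁻¹ * (128 / K))) +
      2 * K * (K * (n2 * (s2 * (((K / 16 * v₁) ^ 4)⁻¹ + ((K / 2 * v₀) ^ 4)⁻¹ * (128 / K))))) := by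
    intro k _
    refine (integral_mono Integrable.of_finite Integrable.of_finite (hpt k)).trans ?_
    rw [integral_add Integrable.of_finite Integrable.of_finite, integral_const_mul,
      integral_const_mul, integral_finsetSum _ fun _ _ => Integrable.of_finite]
    have h1 : ∫ κ, S (κ k) ^ 2 * ((D k κ) ^ 2)⁻¹ ∂π = s2 * ∫ κ, ((D k κ) ^ 2)⁻¹ ∂π :=
      integral_coord_mul μ k (fun x => S x ^ 2) fun y z hyz => by
        simp only [D]
        rw [hdep N _ k (Finset.notMem_erase k _) y z hyz]
    have h2 : ∀ l ∈ Finset.univ.erase k, ∫ κ, N (κ k) ^ 2 * (S (κ l) ^ 2 *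
          ((∑ j ∈ (Finset.univ.erase k).erase l, N (κ j)) ^ 4)⁻¹) ∂π ≤
        n2 * (s2 * (((K / 16 * v₁) ^ 4)⁻¹ + ((K / 2 * v₀) ^ 4)⁻¹ * (128 / K))) := by
      intro l hl
      have hl' := (Finset.mem_erase.1 hl).1
      have h3 := integral_coord_mul (ι := ι) μ k (fun x => N x ^ 2)
        (φ := fun κ => S (κ l) ^ 2 * ((∑ j ∈ (Finset.univ.erase k).erase l, N (κ j)) ^ 4)⁻¹)
        fun y z hyz => by
          simp only
          rw [hdep N _ k (fun h => Finset.notMem_erase k _ (Finset.mem_of_mem_erase h)) y z hyz,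
            hyz l (by simpa using hl')]
      have h4 := integral_coord_mul (ι := ι) μ l (fun x => S x ^ 2)
        (φ := fun κ => ((∑ j ∈ (Finset.univ.erase k).erase l, N (κ j)) ^ 4)⁻¹)
        fun y z hyz => by
          simp only
          rw [hdep N _ l (Finset.notMem_erase l _) y z hyz]
      rw [h3, h4]
      gcongr
      exact hneg _ (hcard2 k l hl').ge 4
    have h3 : ∫ κ, ((D k κ) ^ 2)⁻¹ ∂π ≤ ((K / 16 * v₁) ^ 2)⁻¹ + ((K / 2 * v₀) ^ 2)⁻¹ * (128 / K) :=
      hneg _ (by rw [hcard1]; omega) 2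
    rw [h1]
    refine add_le_add ?_ ?_
    · gcongr
    · refine mul_le_mul_of_nonneg_left ?_ (by positivity)
      refine (Finset.sum_le_card_nsmul _ _ _ h2).trans ?_
      rw [hcard1, nsmul_eq_mul]
      refine mul_le_mul_of_nonneg_right ?_ (by positivity)
      exact_mod_cast Nat.sub_le _ _
  refine (Finset.sum_le_card_nsmul _ _ _ hk).trans (le_of_eq ?_)
  rw [Finset.card_univ, hK, nsmul_eq_mul]
  ring

end Ratio

/-! ### The bootstrap variance for given sites and observations -/

theorem card_cells (m : ℕ) : (cells (2 * m)).card = (2 * m) ^ 2 := by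
  have h1 : (-(2 * (m : ℝ)) / 2) = ((-m : ℤ) : ℝ) := by push_cast; ring
  have h2 : (2 * (m : ℝ) / 2) = ((m : ℤ) : ℝ) := by push_cast; ring
  rw [cells, h1, h2, Int.ceil_intCast, Int.ceil_intCast, Finset.card_product, Int.card_Ico]
  have : ((m : ℤ) - -(m : ℤ)).toNat = 2 * m := by omega
  rw [this]; ring

theorem toReal_count_fin {n : ℕ} (I : Set (Fin n)) : (Measure.count I).toReal = I.ncard := by
  rw [Measure.count_apply (Set.toFinite I).measurableSet,
    ← Set.Finite.cast_ncard_eq (Set.toFinite I), ENat.toENNReal_coe, ENNReal.toReal_natCast]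

/-- Integrals under the uniform law on a large subset are controlled by full averages. -/
theorem integral_uniformOn_le {n : ℕ} {I : Set (Fin n)} (hn : 0 < n)
    (hI : (n : ℝ) / 4 ≤ I.ncard) {F : Fin n → ℝ} (hF : ∀ i, 0 ≤ F i) :
    ∫ i, F i ∂(uniformOn I) ≤ 4 / n * ∑ i, F i := by
  have hn0 : (0 : ℝ) < n := by exact_mod_cast hn
  have hI0 : (0 : ℝ) < I.ncard := lt_of_lt_of_le (by positivity) hI
  have hs : 0 ≤ ∑ i, F i := Finset.sum_nonneg fun i _ => hF i
  rw [uniformOn, ProbabilityTheory.cond, integral_smul_measure, smul_eq_mul, ENNReal.toReal_inv]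
  have h2 : ∫ i in I, F i ∂Measure.count ≤ ∑ i, F i := by
    refine (setIntegral_le_integral Integrable.of_finite (Eventually.of_forall hF)).trans ?_
    rw [integral_count]
  rw [toReal_count_fin]
  calc ((I.ncard : ℝ))⁻¹ * ∫ i in I, F i ∂Measure.count ≤ ((n : ℝ) / 4)⁻¹ * ∑ i, F i := by
        refine mul_le_mul (inv_anti₀ (by positivity) hI) h2 (integral_nonneg hF) (by positivity)
    _ = 4 / n * ∑ i, F i := by rw [inv_div]

theorem ratio_bound_mono {s s' t t' k A B : ℝ} (hs : 0 ≤ s) (hss : s ≤ s') (ht : 0 ≤ t)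
    (htt : t ≤ t') (hk : 0 ≤ k) (hA : 0 ≤ A) (hB : 0 ≤ B) :
    2 * k * s * A + 2 * k ^ 3 * t * s * B ≤ 2 * k * s' * A + 2 * k ^ 3 * t' * s' * B := by
  have := ht.trans htt
  gcongr

/-- Deterministic bound for the bootstrap variance: all admissible blocks hold at least `v₀` sites,
and a quarter of all sites start blocks with at least `v₁` sites. -/
theorem dssbbVariance_le {n : ℕ} (hn : 0 < n) {l b : ℝ} {m : ℕ} (hm : 1 ≤ m) (hlb : l / b = 2 * m)
    (s : Fin n → Plane) (y : Fin n → ℝ) {v₀ v₁ : ℝ} (hv₀ : 0 < v₀) (hv₁ : 0 < v₁)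
    (hN : ∀ i ∈ admissible l b s, v₀ ≤ ((blockSites b s i).card : ℝ)) {G : Set (Fin n)}
    (hGI : G ⊆ admissible l b s) (hG : ∀ i ∈ G, v₁ ≤ ((blockSites b s i).card : ℝ))
    (hGn : (n : ℝ) / 4 ≤ G.ncard) {K : ℕ} (hK : K = (2 * m) ^ 2) :
    dssbbVariance l b s y ≤ l ^ 2 *
      (2 * K * (4 / n * ∑ i, (∑ j ∈ blockSites b s i, y j) ^ 2) *
        (((K / 16 * v₁) ^ 2)⁻¹ + ((K / 2 * v₀) ^ 2)⁻¹ * (128 / K)) +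
      2 * K ^ 3 * (4 / n * ∑ i, (max ((blockSites b s i).card : ℝ) v₀) ^ 2) *
        (4 / n * ∑ i, (∑ j ∈ blockSites b s i, y j) ^ 2) *
        (((K / 16 * v₁) ^ 4)⁻¹ + ((K / 2 * v₀) ^ 4)⁻¹ * (128 / K))) := by
  set I := admissible l b s with hI
  have hn0 : (0 : ℝ) < n := by exact_mod_cast hn
  have hIfin : I.Finite := Set.toFinite I
  have hIn : (n : ℝ) / 4 ≤ I.ncard :=
    hGn.trans (by exact_mod_cast Set.ncard_le_ncard hGI hIfin)
  have hIpos : 0 < I.ncard := by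
    have : (0 : ℝ) < I.ncard := lt_of_lt_of_le (by positivity) hIn
    exact_mod_cast this
  have hIne : I.Nonempty := (Set.ncard_pos hIfin).1 hIpos
  have hprob : IsProbabilityMeasure (uniformOn I) := isProbabilityMeasure_uniformOn hIfin hIne
  have hK4 : 4 ≤ K := by
    rw [hK]
    calc 4 = 2 ^ 2 := by norm_num
      _ ≤ (2 * m) ^ 2 := Nat.pow_le_pow_left (by omega) 2
  have hcard : Fintype.card (cells (l / b)) = K := by
    rw [Fintype.card_coe, hlb, card_cells, hK]
  have hGq : 1 / 4 ≤ (uniformOn I).real G := by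
    have h1 : (uniformOn I).real G = G.ncard / I.ncard := by
      rw [Measure.real, uniformOn, cond_apply hIfin.measurableSet,
        Set.inter_eq_self_of_subset_right hGI, ENNReal.toReal_mul, ENNReal.toReal_inv,
        toReal_count_fin, toReal_count_fin, div_eq_inv_mul]
    have h2 : (I.ncard : ℝ) ≤ n := by
      have := Set.ncard_le_ncard (Set.subset_univ I) (Set.toFinite _)
      rw [Set.ncard_univ, Nat.card_eq_fintype_card, Fintype.card_fin] at this
      exact_mod_cast this
    rw [h1, le_div_iff₀ (by exact_mod_cast hIpos)]
    linarith
  -- the weights only matter on admissible blocks, so they may be raised to `v₀` elsewhere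
  have hae : (fun κ : cells (l / b) → Fin n => resampledMean b s y κ) =ᵐ[
      Measure.pi fun _ => uniformOn I]
      fun κ => (∑ k, ∑ j ∈ blockSites b s (κ k), y j) /
        ∑ k, max ((blockSites b s (κ k)).card : ℝ) v₀ := by
    have h1 : ∀ᵐ κ ∂(Measure.pi fun _ : cells (l / b) => uniformOn I), ∀ k, κ k ∈ I := by
      refine ae_all_iff.2 fun k => ?_
      refine (measurePreserving_eval (fun _ : cells (l / b) => uniformOn I) k).quasiMeasurePreserving.ae ?_
      exact ae_cond_mem hIfin.measurableSet
    filter_upwards [h1] with κ hκ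
    rw [resampledMean]
    congr 1
    exact Finset.sum_congr rfl fun k _ => (max_eq_left (hN _ (hκ k))).symm
  rw [dssbbVariance, ← hI, variance_congr hae]
  refine mul_le_mul_of_nonneg_left ?_ (sq_nonneg l)
  refine (variance_ratio_le (uniformOn I) (fun i => ∑ j ∈ blockSites b s i, y j)
    (N := fun i => max ((blockSites b s i).card : ℝ) v₀) hv₀ hv₁ (fun i => le_max_right _ _)
    (G := G) (fun i hi => (hG i hi).trans (le_max_left _ _)) hGq hcard hK4).trans ?_
  have hS2 := integral_uniformOn_le hn hIn
    (F := fun i => (∑ j ∈ blockSites b s i, y j) ^ 2) fun i => sq_nonneg _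
  have hN2 := integral_uniformOn_le hn hIn
    (F := fun i => max ((blockSites b s i).card : ℝ) v₀ ^ 2) fun i => sq_nonneg _
  have hS0 : 0 ≤ ∫ i, (∑ j ∈ blockSites b s i, y j) ^ 2 ∂(uniformOn I) :=
    integral_nonneg fun i => sq_nonneg _
  have hN0 : 0 ≤ ∫ i, max ((blockSites b s i).card : ℝ) v₀ ^ 2 ∂(uniformOn I) :=
    integral_nonneg fun i => sq_nonneg _
  exact ratio_bound_mono hS0 hS2 hN0 hN2 (Nat.cast_nonneg K) (by positivity) (by positivity)

/-! ### Counts of design points -/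

theorem measurableSet_square (x : Plane) (c : ℝ) : MeasurableSet (square x c) :=
  measurableSet_Ico.prod measurableSet_Ico

theorem volume_real_square (x : Plane) {c : ℝ} (hc : 0 ≤ c) : volume.real (square x c) = c ^ 2 := by
  rw [Measure.real, square, Measure.volume_eq_prod, Measure.prod_prod, Real.volume_Ico,
    Real.volume_Ico, add_sub_cancel_left, add_sub_cancel_left, ENNReal.toReal_mul,
    ENNReal.toReal_ofReal hc, sq]

theorem mul_volume_le_designLaw {a : ℝ} [IsProbabilityMeasure (designLaw a)]
    {Q : Set Plane} (hQ : MeasurableSet Q) {c : ℝ} (hc : 0 ≤ c)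
    (hle : ∀ x ∈ Q, c ≤ designDensity a x) : c * volume.real Q ≤ (designLaw a).real Q := by
  have h1 : ENNReal.ofReal c * volume Q ≤ designLaw a Q := by
    rw [designLaw, withDensity_apply _ hQ, ← setLIntegral_const]
    exact setLIntegral_mono' hQ fun x hx => ENNReal.ofReal_le_ofReal (hle x hx)
  have h2 := ENNReal.toReal_mono (measure_ne_top _ _) h1
  rwa [ENNReal.toReal_mul, ENNReal.toReal_ofReal hc] at h2

theorem quarter_le_designDensity {a : ℝ} (ha : 4 < a) {x : Plane} (hx : x ∈ region 1) :
    1 / 4 ≤ designDensity a x := by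
  rw [designDensity_eq_indicator ha, Set.indicator_of_mem hx]
  exact quarter_le_profile ha _

theorem designDensity_eq_of_strip {a : ℝ} (ha : 4 < a) {x : Plane} (hx : x ∈ region 1)
    (hs : |x.1| ≤ 1 / a) : designDensity a x = a / 4 := by
  rw [designDensity_eq_indicator ha, Set.indicator_of_mem hx]
  exact profile_eq_of_abs_le ha hs

/-- Number of the first `n` design points in `Q`, as a real number. -/
def countIn {Ω : Type u} (X : ℕ → Ω → Plane) (n : ℕ) (Q : Set Plane) (ω : Ω) : ℝ :=
  ∑ j ∈ Finset.range n, Q.indicator 1 (X j ω)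

theorem countIn_mono {Ω : Type u} (X : ℕ → Ω → Plane) (n : ℕ) {Q R : Set Plane} (h : Q ⊆ R)
    (ω : Ω) : countIn X n Q ω ≤ countIn X n R ω :=
  Finset.sum_le_sum fun _ _ => Set.indicator_le_indicator_of_subset h (fun _ => zero_le_one) _

/-- Chebyshev's inequality for the lower tail of a binomial count. -/
theorem measure_countIn_lt_le {Ω : Type u} [MeasurableSpace Ω] {P : Measure Ω}
    [IsProbabilityMeasure P] {a : ℝ} {X : ℕ → Ω → Plane} (hX : IsDesign a P X) {n : ℕ}
    (hn : 1 ≤ n) {Q : Set Plane} (hQ : MeasurableSet Q) {p : ℝ} (hp : 0 < p)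
    (hpQ : p ≤ (designLaw a).real Q) :
    P {ω | countIn X n Q ω < 3 / 4 * (n * p)} ≤ ENNReal.ofReal (16 / (n * p)) := by
  set q := (designLaw a).real Q with hq
  have hn0 : (0 : ℝ) < n := by exact_mod_cast hn
  have hq0 : 0 < q := hp.trans_le hpQ
  let Z : ℕ → Ω → ℝ := fun j ω => Q.indicator 1 (X j ω)
  have hIm : Measurable (Q.indicator (1 : Plane → ℝ)) := measurable_one.indicator hQ
  have hZm : ∀ j, Measurable (Z j) := fun j => hIm.comp (hX.measurable j)
  have hZL : ∀ j, MemLp (Z j) 2 P := fun j => MemLp.of_bound (hZm j).aestronglyMeasurable 1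
    (Eventually.of_forall fun ω => by
      by_cases h : X j ω ∈ Q <;> simp [Z, h])
  have hZmean : ∀ j, ∫ ω, Z j ω ∂P = q := fun j => by
    have h := integral_map (μ := P) (hX.measurable j).aemeasurable
      (hIm.aestronglyMeasurable (μ := P.map (X j)))
    rw [← h, hX.law j, integral_indicator_one hQ, hq]; rfl
  have hmean : ∫ ω, countIn X n Q ω ∂P = n * q := by
    simp only [countIn]
    rw [integral_finsetSum _ fun j _ => (hZL j).integrable (by norm_num)]
    rw [Finset.sum_congr rfl fun j _ => hZmean j]; simp
  have hvar : Var[countIn X n Q; P] ≤ n * q := by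
    have e : countIn X n Q = ∑ j ∈ Finset.range n, Z j := by
      ext ω; simp [countIn, Z]
    rw [e, IndepFun.variance_sum (fun j _ => hZL j) fun i _ j _ hij =>
      (hX.indep.indepFun hij).comp hIm hIm]
    have : ∀ j ∈ Finset.range n, Var[Z j; P] ≤ q := fun j _ => by
      refine (variance_le_expectation_sq (hZm j).aestronglyMeasurable).trans (le_of_eq ?_)
      rw [← hZmean j]
      refine integral_congr_ae (Eventually.of_forall fun ω => ?_)
      by_cases h : X j ω ∈ Q <;> simp [Z, h]
    refine (Finset.sum_le_card_nsmul _ _ _ this).trans ?_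
    simp
  have hL : MemLp (countIn X n Q) 2 P := by
    have e : countIn X n Q = fun ω => ∑ j ∈ Finset.range n, Z j ω := by
      ext ω; simp [countIn, Z]
    rw [e]
    exact memLp_finsetSum _ fun j _ => hZL j
  have hch := meas_ge_le_variance_div_sq hL (c := n * q / 4) (by positivity)
  have hsub : {ω | countIn X n Q ω < 3 / 4 * (n * p)} ⊆
      {ω | n * q / 4 ≤ |countIn X n Q ω - ∫ ω, countIn X n Q ω ∂P|} := by
    intro ω hω
    have h1 : countIn X n Q ω < 3 / 4 * (n * p) := hω
    have h2 : (n : ℝ) * p ≤ n * q := mul_le_mul_of_nonneg_left hpQ hn0.le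
    change n * q / 4 ≤ |countIn X n Q ω - ∫ ω, countIn X n Q ω ∂P|
    refine le_trans ?_ (neg_le_abs _)
    rw [hmean]
    linarith
  refine (measure_mono hsub).trans (hch.trans (ENNReal.ofReal_le_ofReal ?_))
  rw [div_le_div_iff₀ (by positivity) (by positivity)]
  have h2 : (n : ℝ) * p ≤ n * q := mul_le_mul_of_nonneg_left hpQ hn0.le
  have h3 : 0 < (n : ℝ) * p := by positivity
  nlinarith

/-! ### The sampling blocks in the unscaled design -/

theorem smul_mem_square_iff {l b : ℝ} (hl : 0 < l) (x z : Plane) :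
    l • z ∈ square (l • x) b ↔ z ∈ square x (b / l) := by
  have key : ∀ u v : ℝ, (l * u ≤ l * v ∧ l * v < l * u + b) ↔ (u ≤ v ∧ v < u + b / l) := by
    intro u v
    rw [mul_le_mul_iff_right₀ hl]
    refine and_congr_right fun _ => ?_
    rw [← mul_lt_mul_iff_right₀ hl (b := v), mul_add, mul_div_cancel₀ _ hl.ne']
  simp only [square, Set.mem_prod, Set.mem_Ico, Prod.smul_fst, Prod.smul_snd, smul_eq_mul, key]

theorem smul_mem_region_iff {l : ℝ} (hl : 0 < l) (z : Plane) :
    l • z ∈ region l ↔ z ∈ region 1 := by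
  have key : ∀ v : ℝ, (-l / 2 < l * v ∧ l * v < l / 2) ↔ (-1 / 2 < v ∧ v < 1 / 2) := by
    intro v
    constructor
    · rintro ⟨h1, h2⟩
      constructor <;> nlinarith
    · rintro ⟨h1, h2⟩
      constructor <;> nlinarith
  simp only [region, Set.mem_prod, Set.mem_Ioo, Prod.smul_fst, Prod.smul_snd, smul_eq_mul, key]

theorem mem_admissible_iff {l b : ℝ} (hl : 0 < l) {n : ℕ} (x : Fin n → Plane) (i : Fin n) :
    i ∈ admissible l b (fun i => l • x i) ↔ square (x i) (b / l) ⊆ region 1 := by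
  constructor
  · intro h z hz
    exact (smul_mem_region_iff hl z).1 (h ((smul_mem_square_iff hl _ _).2 hz))
  · intro h z hz
    have e : z = l • (l⁻¹ • z) := (smul_inv_smul₀ hl.ne' z).symm
    rw [e] at hz ⊢
    exact (smul_mem_region_iff hl _).2 (h ((smul_mem_square_iff hl _ _).1 hz))

theorem sum_blockSites {Ω : Type u} (X : ℕ → Ω → Plane) {l b : ℝ} (hl : 0 < l) {n : ℕ} (ω : Ω)
    (i : Fin n) (F : ℕ → ℝ) :
    ∑ j ∈ blockSites b (fun i : Fin n => l • X i ω) i, F j =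
      ∑ j ∈ Finset.range n, (square (X i ω) (b / l)).indicator 1 (X j ω) * F j := by
  classical
  rw [blockSites, Finset.sum_filter, ← Fin.sum_univ_eq_sum_range
    fun j => (square (X i ω) (b / l)).indicator 1 (X j ω) * F j]
  refine Finset.sum_congr rfl fun j _ => ?_
  simp only [smul_mem_square_iff hl]
  by_cases h : X j ω ∈ square (X i ω) (b / l) <;> simp [h]

theorem card_blockSites {Ω : Type u} (X : ℕ → Ω → Plane) {l b : ℝ} (hl : 0 < l) {n : ℕ} (ω : Ω)
    (i : Fin n) :
    ((blockSites b (fun i : Fin n => l • X i ω) i).card : ℝ) =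
      countIn X n (square (X i ω) (b / l)) ω := by
  have h := sum_blockSites X (b := b) hl ω i fun _ => 1
  simpa [countIn] using h

theorem bounds_of_square_subset_region {x : Plane} {e : ℝ} (he : 0 < e)
    (h : square x e ⊆ region 1) :
    (-1 / 2 < x.1 ∧ x.1 + e ≤ 1 / 2) ∧ (-1 / 2 < x.2 ∧ x.2 + e ≤ 1 / 2) := by
  have hx : x ∈ square x e := ⟨⟨le_rfl, by linarith⟩, ⟨le_rfl, by linarith⟩⟩
  obtain ⟨⟨h1, -⟩, ⟨h2, -⟩⟩ := h hx
  refine ⟨⟨h1, ?_⟩, ⟨h2, ?_⟩⟩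
  · by_contra hc
    push Not at hc
    have hz : (max x.1 (1 / 2), x.2) ∈ square x e :=
      ⟨⟨le_max_left _ _, max_lt (by linarith) hc⟩, ⟨le_rfl, by linarith⟩⟩
    have := (h hz).1.2
    exact absurd (le_max_right x.1 (1 / 2 : ℝ)) (not_le.2 this)
  · by_contra hc
    push Not at hc
    have hz : (x.1, max x.2 (1 / 2)) ∈ square x e :=
      ⟨⟨le_rfl, by linarith⟩, ⟨le_max_left _ _, max_lt (by linarith) hc⟩⟩
    have := (h hz).2.2
    exact absurd (le_max_right x.2 (1 / 2 : ℝ)) (not_le.2 this)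

theorem square_subset_region {x : Plane} {e : ℝ} (h1 : -1 / 2 < x.1) (h2 : x.1 + e ≤ 1 / 2)
    (h3 : -1 / 2 < x.2) (h4 : x.2 + e ≤ 1 / 2) : square x e ⊆ region 1 := by
  rintro z ⟨⟨a1, a2⟩, ⟨a3, a4⟩⟩
  exact ⟨⟨by linarith, by linarith⟩, ⟨by linarith, by linarith⟩⟩

/-- The cell with index `j` of a grid of side `e / 2`, half the side of a block. -/
def gridCell (e : ℝ) (j : ℤ × ℤ) : Set Plane := square (e / 2 * j.1, e / 2 * j.2) (e / 2)

theorem exists_grid_index {m : ℕ} {e x : ℝ} (he : 0 < e) (hme : e * (2 * m) = 1)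
    (h1 : -1 / 2 < x) (h2 : x + e ≤ 1 / 2) :
    ∃ j ∈ Finset.Ioo (-(2 * m) : ℤ) (2 * m), x ≤ e / 2 * j ∧ e / 2 * j + e / 2 ≤ x + e := by
  set j := ⌈2 * x / e⌉ with hj
  have h3 : 2 * x / e ≤ j := Int.le_ceil _
  have h4 : (j : ℝ) < 2 * x / e + 1 := Int.ceil_lt_add_one _
  have h5 : x ≤ e / 2 * j := by
    rw [div_le_iff₀ he] at h3; linarith
  have h6 : e / 2 * j + e / 2 ≤ x + e := by
    have : (j : ℝ) * e < 2 * x + e := by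
      have := mul_lt_mul_of_pos_right h4 he
      rwa [add_mul, div_mul_cancel₀ _ he.ne', one_mul] at this
    linarith
  refine ⟨j, Finset.mem_Ioo.2 ⟨?_, ?_⟩, h5, h6⟩
  · have : (-(2 * m) : ℝ) < j := by
      by_contra hc
      push Not at hc
      nlinarith
    exact_mod_cast this
  · have : (j : ℝ) < 2 * m := by
      by_contra hc
      push Not at hc
      nlinarith
    exact_mod_cast this

/-- Every block inside the unit region contains a grid cell. -/
theorem exists_gridCell_subset {m : ℕ} {e : ℝ} {x : Plane} (he : 0 < e) (hme : e * (2 * m) = 1)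
    (h : square x e ⊆ region 1) :
    ∃ j ∈ Finset.Ioo (-(2 * m) : ℤ) (2 * m) ×ˢ Finset.Ioo (-(2 * m) : ℤ) (2 * m),
      gridCell e j ⊆ square x e := by
  obtain ⟨⟨h1, h2⟩, ⟨h3, h4⟩⟩ := bounds_of_square_subset_region he h
  obtain ⟨j1, hj1, a1, a2⟩ := exists_grid_index he hme h1 h2
  obtain ⟨j2, hj2, a3, a4⟩ := exists_grid_index he hme h3 h4
  refine ⟨(j1, j2), Finset.mem_product.2 ⟨hj1, hj2⟩, ?_⟩
  rintro z ⟨⟨b1, b2⟩, ⟨b3, b4⟩⟩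
  exact ⟨⟨by linarith, by linarith⟩, ⟨by linarith, by linarith⟩⟩

/-! ### Regularity of the design -/

/-- The lower left corners of blocks of side `e` that lie in the central strip of the unit region,
where the design density is maximal. -/
def stripCorners (a e : ℝ) : Set Plane :=
  Set.Icc (-(1 / a)) (1 / a - e) ×ˢ Set.Ioc (-1 / 2) (1 / 2 - e)

theorem measurableSet_stripCorners (a e : ℝ) : MeasurableSet (stripCorners a e) :=
  measurableSet_Icc.prod measurableSet_Ioc

theorem third_le_designLaw_stripCorners {a e : ℝ} (ha : 4 < a) [IsProbabilityMeasure (designLaw a)]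
    (he : 0 < e) (hea : 8 * (a * e) ≤ 1) : 1 / 3 ≤ (designLaw a).real (stripCorners a e) := by
  have ha0 : 0 < a := by linarith
  have h1a : 1 / a < 1 / 4 := one_div_lt_one_div_of_lt (by norm_num) ha
  have he4 : e ≤ 1 / 32 := by nlinarith
  have hea' : e ≤ 2 / a := by rw [le_div_iff₀ ha0]; nlinarith
  have h := mul_volume_le_designLaw (measurableSet_stripCorners a e) (c := a / 4) (by positivity)
    fun x hx => by
      obtain ⟨⟨h1, h2⟩, ⟨h3, h4⟩⟩ := hx
      exact (designDensity_eq_of_strip ha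
        ⟨⟨by linarith, by linarith⟩, ⟨by linarith, by linarith⟩⟩
        (abs_le.2 ⟨h1, by linarith⟩)).ge
  refine le_trans ?_ h
  have h2a : 2 / a = 1 / a + 1 / a := by ring
  rw [Measure.real, stripCorners, Measure.volume_eq_prod, Measure.prod_prod, Real.volume_Icc,
    Real.volume_Ioc, ENNReal.toReal_mul, ENNReal.toReal_ofReal (by linarith),
    ENNReal.toReal_ofReal (by linarith)]
  have e1 : a / 4 * ((1 / a - e - -(1 / a)) * (1 / 2 - e - -1 / 2)) = (2 - a * e) / 4 * (1 - e) := by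
    field_simp; ring
  rw [e1]
  have h3 : 15 / 32 ≤ (2 - a * e) / 4 := by linarith
  nlinarith

theorem square_subset_of_mem_stripCorners {a e : ℝ} (ha : 4 < a) {x : Plane}
    (hx : x ∈ stripCorners a e) (he : 0 < e) :
    square x e ⊆ region 1 ∧ ∀ z ∈ square x e, |z.1| ≤ 1 / a := by
  have h1a : 1 / a < 1 / 4 := one_div_lt_one_div_of_lt (by norm_num) ha
  obtain ⟨⟨h1, h2⟩, ⟨h3, h4⟩⟩ := hx
  refine ⟨square_subset_region (by linarith) (by linarith) h3 (by linarith), ?_⟩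
  rintro z ⟨⟨b1, b2⟩, -⟩
  exact abs_le.2 ⟨by linarith, by linarith⟩

/-- The design is regular at block size `e`: every block in the unit region contains at least
`n e² / 32` design points, blocks in the central strip contain `a` times as many, and at least a
quarter of the design points start blocks in the strip. -/
def IsRegularAt (a e : ℝ) (n : ℕ) {Ω : Type u} (X : ℕ → Ω → Plane) (ω : Ω) : Prop :=
  (∀ x, square x e ⊆ region 1 → n * e ^ 2 / 32 ≤ countIn X n (square x e) ω) ∧
  (∀ x ∈ stripCorners a e, a * (n * e ^ 2 / 32) ≤ countIn X n (square x e) ω) ∧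
  (n : ℝ) / 4 ≤ countIn X n (stripCorners a e) ω

/-- The counts of the grid cells control the counts of all blocks, so Chebyshev's inequality on
the grid suffices. -/
theorem measure_not_isRegularAt_le {Ω : Type u} [MeasurableSpace Ω] {P : Measure Ω}
    [IsProbabilityMeasure P] {a : ℝ} (ha : 4 < a) {X : ℕ → Ω → Plane} (hX : IsDesign a P X) {n : ℕ}
    (hn : 1 ≤ n) {m : ℕ} {e : ℝ} (he : 0 < e) (hme : e * (2 * m) = 1) (hea : 8 * (a * e) ≤ 1) :
    P {ω | ¬ IsRegularAt a e n X ω} ≤ ENNReal.ofReal (1024 / (n * e ^ 4)) +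
      ENNReal.ofReal (48 / n) := by
  classical
  have hprob := isProbabilityMeasure_designLaw hX
  have hn0 : (0 : ℝ) < n := by exact_mod_cast hn
  have ha0 : 0 < a := by linarith
  set J := Finset.Ioo (-(2 * m) : ℤ) (2 * m) ×ˢ Finset.Ioo (-(2 * m) : ℤ) (2 * m) with hJ
  -- a lower bound for the mass of a cell, of area `e ^ 2 / 4`: the density is at least `1 / 4`,
  -- and equal to `a / 4` in the strip
  let p : ℤ × ℤ → ℝ := fun j => e ^ 2 / 16 * if ∀ z ∈ gridCell e j, |z.1| ≤ 1 / a then a else 1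
  have hp1 : ∀ j, e ^ 2 / 16 ≤ p j := fun j => by
    have : (1 : ℝ) ≤ if ∀ z ∈ gridCell e j, |z.1| ≤ 1 / a then a else 1 := by
      split_ifs <;> linarith
    exact le_mul_of_one_le_right (by positivity) this
  let B : ℤ × ℤ → Set Ω := fun j =>
    if gridCell e j ⊆ region 1 then {ω | countIn X n (gridCell e j) ω < 3 / 4 * (n * p j)} else ∅
  let D : Set Ω := {ω | countIn X n (stripCorners a e) ω < 3 / 4 * (n * (1 / 3))}
  have hsub : {ω | ¬ IsRegularAt a e n X ω} ⊆ (⋃ j ∈ J, B j) ∪ D := by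
    intro ω hω
    by_contra hc
    rw [Set.mem_union, not_or] at hc
    obtain ⟨hc1, hc2⟩ := hc
    have hcell : ∀ j ∈ J, gridCell e j ⊆ region 1 →
        3 / 4 * (n * p j) ≤ countIn X n (gridCell e j) ω := by
      intro j hj hjr
      by_contra hlt
      refine hc1 (Set.mem_biUnion hj ?_)
      simp only [B, if_pos hjr]
      exact not_le.1 hlt
    refine hω ⟨fun x hx => ?_, fun x hx => ?_, ?_⟩
    · obtain ⟨j, hj, hjs⟩ := exists_gridCell_subset he hme hx
      refine le_trans ?_ ((hcell j hj (hjs.trans hx)).trans (countIn_mono X n hjs ω))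
      have := mul_le_mul_of_nonneg_left (hp1 j) hn0.le
      have h0 : 0 ≤ n * e ^ 2 := by positivity
      linarith
    · obtain ⟨hr, hs⟩ := square_subset_of_mem_stripCorners ha hx he
      obtain ⟨j, hj, hjs⟩ := exists_gridCell_subset he hme hr
      refine le_trans ?_ ((hcell j hj (hjs.trans hr)).trans (countIn_mono X n hjs ω))
      have hpj : p j = e ^ 2 / 16 * a := by
        simp only [p]; rw [if_pos fun z hz => hs z (hjs hz)]
      rw [hpj]
      have h0 : 0 ≤ a * (n * e ^ 2) := by positivity
      linarith
    · have : ¬ countIn X n (stripCorners a e) ω < 3 / 4 * (n * (1 / 3)) := hc2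
      linarith
  have hB : ∀ j ∈ J, P (B j) ≤ ENNReal.ofReal (256 / (n * e ^ 2)) := by
    intro j _
    by_cases hjr : gridCell e j ⊆ region 1
    · simp only [B, if_pos hjr]
      have hvol : volume.real (gridCell e j) = e ^ 2 / 4 := by
        rw [gridCell, volume_real_square _ (by positivity)]; ring
      have hpj : p j ≤ (designLaw a).real (gridCell e j) := by
        by_cases hs : ∀ z ∈ gridCell e j, |z.1| ≤ 1 / a
        · have h := mul_volume_le_designLaw (measurableSet_square (e / 2 * j.1, e / 2 * j.2) (e / 2))
            (c := a / 4) (by positivity)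
            fun x hx => (designDensity_eq_of_strip ha (hjr hx) (hs x hx)).ge
          have h' : a / 4 * volume.real (gridCell e j) ≤ (designLaw a).real (gridCell e j) := h
          rw [hvol] at h'
          simp only [p]; rw [if_pos hs]; linarith
        · have h := mul_volume_le_designLaw (measurableSet_square (e / 2 * j.1, e / 2 * j.2) (e / 2))
            (c := 1 / 4) (by positivity) fun x hx => quarter_le_designDensity ha (hjr hx)
          have h' : 1 / 4 * volume.real (gridCell e j) ≤ (designLaw a).real (gridCell e j) := h
          rw [hvol] at h'
          simp only [p]; rw [if_neg hs]; linarith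
      have hp0 : 0 < p j := lt_of_lt_of_le (by positivity) (hp1 j)
      refine (measure_countIn_lt_le hX hn (measurableSet_square _ _) hp0 hpj).trans
        (ENNReal.ofReal_le_ofReal ?_)
      rw [div_le_div_iff₀ (by positivity) (by positivity)]
      have := mul_le_mul_of_nonneg_left (hp1 j) hn0.le
      linarith
    · simp only [B, if_neg hjr]; simp
  -- there are at most `(4 * m) ^ 2` cells, as `e = 1 / (2 * m)`
  have hcard : (J.card : ℝ) ≤ 4 / e ^ 2 := by
    have h1 : (Finset.Ioo (-(2 * m) : ℤ) (2 * m)).card ≤ 4 * m := by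
      rw [Int.card_Ioo]; omega
    have h2 : (J.card : ℝ) ≤ (4 * m) ^ 2 := by
      rw [hJ, Finset.card_product, ← sq]
      exact_mod_cast Nat.pow_le_pow_left h1 2
    refine h2.trans (le_of_eq ?_)
    rw [eq_div_iff (by positivity)]
    have : (4 * (m : ℝ)) ^ 2 * e ^ 2 = 4 * (e * (2 * m)) ^ 2 := by ring
    rw [this, hme]; norm_num
  refine (measure_mono hsub).trans ((measure_union_le _ _).trans (add_le_add ?_ ?_))
  · refine (measure_biUnion_finset_le _ _).trans ((Finset.sum_le_card_nsmul _ _ _ hB).trans ?_)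
    rw [nsmul_eq_mul, ← ENNReal.ofReal_natCast, ← ENNReal.ofReal_mul (by positivity)]
    refine ENNReal.ofReal_le_ofReal ((mul_le_mul_of_nonneg_right hcard (by positivity)).trans
      (le_of_eq ?_))
    field_simp; norm_num
  · refine (measure_countIn_lt_le hX hn (measurableSet_stripCorners a e) (by norm_num)
      (third_le_designLaw_stripCorners ha he hea)).trans (le_of_eq ?_)
    congr 1; field_simp; norm_num

/-! ### Second moments over a block -/

/-- Averaging over an independent variable whose law is bounded by `c • μ`. -/
theorem lintegral_comp_le_of_indepFun {Ω A B : Type*} [MeasurableSpace Ω] [MeasurableSpace A]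
    [MeasurableSpace B] {P : Measure Ω} [IsProbabilityMeasure P] {ξ : Ω → A} {ζ : Ω → B}
    (hξ : Measurable ξ) (hζ : Measurable ζ) (h : IndepFun ξ ζ P) {μ : Measure B} {c : ENNReal}
    (hc : P.map ζ ≤ c • μ) {F : A → B → ENNReal} (hF : Measurable (Function.uncurry F)) :
    ∫⁻ ω, F (ξ ω) (ζ ω) ∂P ≤ ∫⁻ ω, c * ∫⁻ z, F (ξ ω) z ∂μ ∂P := by
  have h1 : P.map (fun ω => (ξ ω, ζ ω)) = (P.map ξ).prod (P.map ζ) :=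
    (indepFun_iff_map_prod_eq_prod_map_map hξ.aemeasurable hζ.aemeasurable).1 h
  have h2 : ∫⁻ ω, F (ξ ω) (ζ ω) ∂P =
      ∫⁻ p, Function.uncurry F p ∂(P.map fun ω => (ξ ω, ζ ω)) :=
    (lintegral_map hF (hξ.prodMk hζ)).symm
  have := Measure.isProbabilityMeasure_map (μ := P) hζ.aemeasurable
  rw [h2, h1, lintegral_prod _ hF.aemeasurable, lintegral_map hF.lintegral_prod_right' hξ]
  refine lintegral_mono fun ω => ?_
  refine (lintegral_mono' hc le_rfl).trans (le_of_eq ?_)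
  rw [lintegral_smul_measure]; rfl

/-- The indicator that the second site lies in the block at the first. -/
def inBlock (e : ℝ) (x y : Plane) : ENNReal := (square x e).indicator 1 y

theorem measurableSet_mem_square (e : ℝ) :
    MeasurableSet {p : Plane × Plane | p.2 ∈ square p.1 e} := by
  simp only [square, Set.mem_prod, Set.mem_Ico]
  measurability

theorem measurable_indicator_square (e : ℝ) :
    Measurable fun p : Plane × Plane => (square p.1 e).indicator (1 : Plane → ℝ) p.2 :=
  (measurable_one : Measurable (1 : Plane × Plane → ℝ)).indicator (measurableSet_mem_square e)

theorem measurable_inBlock (e : ℝ) : Measurable (Function.uncurry (inBlock e)) := by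
  have : Function.uncurry (inBlock e) =
      Set.indicator {p : Plane × Plane | p.2 ∈ square p.1 e} 1 := by
    ext ⟨x, y⟩; rfl
  rw [this]
  exact measurable_one.indicator (measurableSet_mem_square e)

theorem inBlock_le_one (e : ℝ) (x y : Plane) : inBlock e x y ≤ 1 :=
  Set.indicator_le_self' (fun _ _ => zero_le) y

theorem lintegral_inBlock {e : ℝ} (he : 0 ≤ e) (x : Plane) :
    ∫⁻ y, inBlock e x y = ENNReal.ofReal (e ^ 2) := by
  simp only [inBlock]
  rw [lintegral_indicator_one (measurableSet_square x e), square, Measure.volume_eq_prod,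
    Measure.prod_prod, Real.volume_Ico, Real.volume_Ico, add_sub_cancel_left, add_sub_cancel_left,
    ← ENNReal.ofReal_mul he, sq]

/-- Second moments over a block of the pair interaction `H`, by the number of coincidences among
the three sites involved. -/
theorem lintegral_pairs_inBlock_le {Ω : Type u} [MeasurableSpace Ω] {P : Measure Ω}
    [IsProbabilityMeasure P] {a : ℝ} (ha : 4 < a) {X : ℕ → Ω → Plane} (hX : IsDesign a P X)
    {e : ℝ} (he : 0 ≤ e) {H : Plane → ENNReal} (hH : Measurable H) (n i : ℕ) :
    ∫⁻ ω, ∑ j ∈ Finset.range n, ∑ k ∈ Finset.range n,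
        inBlock e (X i ω) (X j ω) * inBlock e (X i ω) (X k ω) * H (X j ω - X k ω) ∂P ≤
      H 0 + n * (ENNReal.ofReal (a / 4) * ENNReal.ofReal (e ^ 2) * H 0) +
        2 * (n * (ENNReal.ofReal (a / 4) * ∫⁻ u, H u)) +
        n ^ 2 * (ENNReal.ofReal (a / 4) * (∫⁻ u, H u) *
          (ENNReal.ofReal (a / 4) * ENNReal.ofReal (e ^ 2))) := by
  set c := ENNReal.ofReal (a / 4) with hc
  set v := ENNReal.ofReal (e ^ 2) with hv
  set I := ∫⁻ u, H u with hI
  have hlaw : ∀ k, P.map (X k) ≤ c • volume := fun k => by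
    rw [hX.law k]; exact designLaw_le ha
  have hqm : ∀ i j, Measurable fun ω => inBlock e (X i ω) (X j ω) := fun i j =>
    (measurable_inBlock e).comp ((hX.measurable i).prodMk (hX.measurable j))
  have hHm : ∀ j k, Measurable fun ω => H (X j ω - X k ω) := fun j k =>
    hH.comp ((hX.measurable j).sub (hX.measurable k))
  have hq : ∀ i j, i ≠ j → ∫⁻ ω, inBlock e (X i ω) (X j ω) ∂P ≤ c * v := by
    intro i j hij
    refine (lintegral_comp_le_of_indepFun (hX.measurable i) (hX.measurable j)
      (hX.indep.indepFun hij) (hlaw j) (measurable_inBlock e)).trans ?_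
    simp only [lintegral_inBlock he]
    simp [hv]
  have hHH : ∀ i j, i ≠ j → ∫⁻ ω, H (X i ω - X j ω) ∂P ≤ c * I := by
    intro i j hij
    refine (lintegral_comp_le_of_indepFun (F := fun x y => H (x - y)) (hX.measurable i)
      (hX.measurable j) (hX.indep.indepFun hij) (hlaw j)
      (hH.comp (measurable_fst.sub measurable_snd))).trans ?_
    simp only [lintegral_sub_left_eq_self H]
    simp [hI]
  have hterm : ∀ j k, ∫⁻ ω, inBlock e (X i ω) (X j ω) * inBlock e (X i ω) (X k ω) *
      H (X j ω - X k ω) ∂P ≤ (if j = i then if k = i then H 0 else 0 else 0) +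
        (if j = k then c * v * H 0 else 0) + ((if j = i then c * I else 0) +
        (if k = i then c * I else 0)) + c * I * (c * v) := by
    intro j k
    have hle1 : ∀ ω, inBlock e (X i ω) (X j ω) * inBlock e (X i ω) (X k ω) *
        H (X j ω - X k ω) ≤ H (X j ω - X k ω) := fun ω =>
      mul_le_of_le_one_left zero_le
        (mul_le_one' (inBlock_le_one _ _ _) (inBlock_le_one _ _ _))
    have hle2 : ∀ ω, inBlock e (X i ω) (X j ω) * inBlock e (X i ω) (X k ω) *
        H (X j ω - X k ω) ≤ inBlock e (X i ω) (X j ω) * H (X j ω - X k ω) := fun ω => by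
      gcongr
      exact mul_le_of_le_one_right zero_le (inBlock_le_one _ _ _)
    by_cases hjk : j = k
    · subst hjk
      by_cases hji : j = i
      · refine (lintegral_mono hle1).trans ?_
        simp only [sub_self, lintegral_const, measure_univ, mul_one, if_pos hji]
        rw [add_assoc, add_assoc]
        exact le_self_add
      · refine (lintegral_mono hle2).trans ?_
        simp only [sub_self, if_neg hji]
        rw [lintegral_mul_const _ (hqm i j)]
        simp only [zero_add, if_true, add_zero]
        exact (mul_le_mul_left (hq i j (Ne.symm hji)) _).trans le_self_add
    · by_cases hji : j = i
      · refine (lintegral_mono hle1).trans ((hHH j k hjk).trans ?_)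
        rw [if_pos hji (t := c * I)]
        exact le_add_right (le_add_left le_self_add)
      · by_cases hki : k = i
        · refine (lintegral_mono hle1).trans ((hHH j k hjk).trans ?_)
          rw [if_pos hki (t := c * I)]
          exact le_add_right (le_add_left le_add_self)
        · -- three distinct sites: integrate out `X k`, then `X j`
          refine (lintegral_mono hle2).trans (le_trans ?_ le_add_self)
          have hind := (hX.indep.indepFun_prodMk hX.measurable i j k (Ne.symm hki) hjk)
          refine (lintegral_comp_le_of_indepFun
            (F := fun p z => inBlock e p.1 p.2 * H (p.2 - z))
            ((hX.measurable i).prodMk (hX.measurable j)) (hX.measurable k) hind (hlaw k)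
            (((measurable_inBlock e).comp measurable_fst).mul
              (hH.comp ((measurable_snd.comp measurable_fst).sub measurable_snd)))).trans ?_
          have e1 : ∀ ω, c * ∫⁻ z, inBlock e (X i ω) (X j ω) * H (X j ω - z) =
              c * I * inBlock e (X i ω) (X j ω) := fun ω => by
            have hm : Measurable fun z => H (X j ω - z) :=
              hH.comp (measurable_const.sub measurable_id)
            rw [lintegral_const_mul _ hm, lintegral_sub_left_eq_self H]
            ring
          simp only [e1]
          rw [lintegral_const_mul _ (hqm i j)]
          exact mul_le_mul_right (hq i j (Ne.symm hji)) _
  have htm : ∀ j k, Measurable fun ω => inBlock e (X i ω) (X j ω) * inBlock e (X i ω) (X k ω) *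
      H (X j ω - X k ω) := fun j k => ((hqm i j).mul (hqm i k)).mul (hHm j k)
  rw [lintegral_finsetSum _ fun j _ => Finset.measurable_fun_sum _ fun k _ => htm j k]
  simp_rw [lintegral_finsetSum _ fun k _ => htm _ k]
  refine (Finset.sum_le_sum fun j _ => Finset.sum_le_sum fun k _ => hterm j k).trans ?_
  simp only [Finset.sum_add_distrib]
  have hone : ∀ x : ENNReal, ∑ j ∈ Finset.range n, (if j = i then x else 0) ≤ x := fun x => by
    rw [Finset.sum_ite_eq']; split_ifs <;> simp
  refine add_le_add (add_le_add (add_le_add ?_ ?_) ?_) ?_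
  · refine le_trans (Finset.sum_le_sum fun j _ => ?_) (hone _)
    split_ifs
    · exact hone _
    · simp
  · refine (Finset.sum_le_sum (g := fun _ => c * v * H 0) fun j hj => ?_).trans (by simp)
    rw [Finset.sum_ite_eq, if_pos hj]
  · rw [two_mul]
    refine add_le_add ?_ ?_
    · rw [Finset.sum_comm]
      exact (Finset.sum_le_sum fun k _ => hone _).trans (by simp)
    · exact (Finset.sum_le_sum fun k _ => hone _).trans (by simp)
  · simp only [Finset.sum_const, Finset.card_range, nsmul_eq_mul]
    rw [← mul_assoc, sq]

/-- The second moment of the number of design points in a block. -/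
theorem lintegral_sq_countIn_le {Ω : Type u} [MeasurableSpace Ω] {P : Measure Ω}
    [IsProbabilityMeasure P] {a : ℝ} (ha : 4 < a) {X : ℕ → Ω → Plane} (hX : IsDesign a P X)
    {e : ℝ} (he : 0 < e) (n i : ℕ) :
    ∫⁻ ω, ENNReal.ofReal (countIn X n (square (X i ω) e) ω ^ 2) ∂P ≤
      ENNReal.ofReal (1 + 9 * (a / 4 * (n * e ^ 2)) + 4 * (a / 4 * (n * e ^ 2)) ^ 2) := by
  have ha0 : 0 < a := by linarith
  set D : Set Plane := Set.Ioo (-e) e ×ˢ Set.Ioo (-e) e with hD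
  have hDm : MeasurableSet D := measurableSet_Ioo.prod measurableSet_Ioo
  have hDI : ∫⁻ u, D.indicator (1 : Plane → ENNReal) u = ENNReal.ofReal (4 * e ^ 2) := by
    rw [lintegral_indicator_one hDm, hD, Measure.volume_eq_prod, Measure.prod_prod,
      Real.volume_Ioo, ← ENNReal.ofReal_mul (by linarith)]
    congr 1; ring
  have hD0 : (0 : Plane) ∈ D := ⟨⟨by simpa, by simpa⟩, ⟨by simpa, by simpa⟩⟩
  have h := lintegral_pairs_inBlock_le ha hX he.le (measurable_one.indicator hDm) n i
  rw [hDI, Set.indicator_of_mem hD0, Pi.one_apply] at h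
  -- two sites in the same block differ by a vector of the box `D`
  have hpt : ∀ ω, ENNReal.ofReal (countIn X n (square (X i ω) e) ω ^ 2) ≤
      ∑ j ∈ Finset.range n, ∑ k ∈ Finset.range n, inBlock e (X i ω) (X j ω) *
        inBlock e (X i ω) (X k ω) * D.indicator (1 : Plane → ENNReal) (X j ω - X k ω) := by
    intro ω
    rw [countIn, sq, Finset.sum_mul_sum]
    have h0 : ∀ j, 0 ≤ (square (X i ω) e).indicator (1 : Plane → ℝ) (X j ω) := fun j =>
      Set.indicator_nonneg (fun _ _ => zero_le_one) _
    rw [ENNReal.ofReal_sum_of_nonneg fun j _ => Finset.sum_nonneg fun k _ =>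
      mul_nonneg (h0 j) (h0 k)]
    refine Finset.sum_le_sum fun j _ => ?_
    rw [ENNReal.ofReal_sum_of_nonneg fun k _ => mul_nonneg (h0 j) (h0 k)]
    refine Finset.sum_le_sum fun k _ => ?_
    by_cases hj : X j ω ∈ square (X i ω) e
    · by_cases hk : X k ω ∈ square (X i ω) e
      · have hjk : X j ω - X k ω ∈ D := by
          obtain ⟨⟨a1, a2⟩, ⟨a3, a4⟩⟩ := hj
          obtain ⟨⟨b1, b2⟩, ⟨b3, b4⟩⟩ := hk
          refine ⟨⟨?_, ?_⟩, ⟨?_, ?_⟩⟩ <;>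
            (simp only [Prod.fst_sub, Prod.snd_sub]; linarith)
        simp [inBlock, hj, hk, hjk]
      · simp [hk]
    · simp [hj]
  refine (lintegral_mono hpt).trans (h.trans (le_of_eq ?_))
  rw [← ENNReal.ofReal_natCast, show (2 : ENNReal) = ENNReal.ofReal 2 by simp,
    show (1 : ENNReal) = ENNReal.ofReal 1 by simp]
  rw [← ENNReal.ofReal_pow (by positivity)]
  repeat rw [← ENNReal.ofReal_mul (by positivity)]
  repeat rw [← ENNReal.ofReal_add (by positivity) (by positivity)]
  congr 1; ring

theorem lintegral_comp_smul {H : Plane → ENNReal} (hH : Measurable H) {l : ℝ} (hl : 0 < l) :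
    ∫⁻ u, H (l • u) = ENNReal.ofReal (l ^ 2)⁻¹ * ∫⁻ u, H u := by
  have h := Measure.map_addHaar_smul (volume : Measure Plane) hl.ne'
  have h1 : ∫⁻ u, H (l • u) = ∫⁻ u, H u ∂(Measure.map (fun u : Plane => l • u) volume) :=
    (lintegral_map hH (measurable_const_smul l)).symm
  have h2 : Measure.map (fun u : Plane => l • u) volume = ENNReal.ofReal (l ^ 2)⁻¹ • volume := by
    simpa [abs_of_pos hl] using h
  rw [h1, h2, lintegral_smul_measure]; rfl

/-- The second moment of the sum of the observations in a block, for a nonnegative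
autocovariance. -/
theorem lintegral_sq_blockSum_le {Ω : Type u} [MeasurableSpace Ω] {P : Measure Ω}
    [IsProbabilityMeasure P] {a : ℝ} (ha : 4 < a) {Y : Plane → Ω → ℝ} {X : ℕ → Ω → Plane}
    (hY : IsMixingField P Y) (hX : IsDesign a P X) (hYX : IsMeasurableIndep P Y X)
    (hnn : ∀ s, 0 ≤ autocov P Y s) {e l : ℝ} (he : 0 < e) (hl : 0 < l) (n i : ℕ) :
    ∫⁻ ω, ENNReal.ofReal ((∑ j ∈ Finset.range n,
        (square (X i ω) e).indicator 1 (X j ω) * Y (l • X j ω) ω) ^ 2) ∂P ≤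
      ENNReal.ofReal (autocov P Y 0 * (1 + a / 4 * (n * e ^ 2)) +
        (2 * (a / 4) * n + (a / 4) ^ 2 * (n ^ 2 * e ^ 2)) * ((l ^ 2)⁻¹ * ∫ s, autocov P Y s)) := by
  have ha0 : 0 < a := by linarith
  have hm := measurable_uncurry_of_isMeasurableIndep hYX
  have hσm : Measurable (autocov P Y) := measurable_autocov hY hm
  have hσi : Integrable (autocov P Y) := integrable_autocov hY hm
  let w : ℕ → (ℕ → Plane) → ℝ := fun j x => (square (x i) e).indicator 1 (x j)
  have hw : ∀ j, Measurable (w j) := fun j =>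
    (measurable_indicator_square e).comp
      (by fun_prop : Measurable fun x : ℕ → Plane => (x i, x j))
  have hw0 : ∀ j x, 0 ≤ w j x := fun j x => Set.indicator_nonneg (fun _ _ => zero_le_one) _
  have hwX : ∀ j ω, 0 ≤ w j (fun i => X i ω) := fun j ω => hw0 j fun i => X i ω
  have hw1 : ∀ j x, |w j x| ≤ 1 := fun j x => by
    by_cases h : x j ∈ square (x i) e <;> simp [w, h]
  obtain ⟨hint, hce⟩ := condExp_sq_weighted_sum hY hX.measurable hYX l (Finset.range n) hw hw1
  have hle : designSigma X ≤ (inferInstance : MeasurableSpace Ω) :=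
    iSup_le fun j => (hX.measurable j).comap_le
  have hnn2 : ∀ ω, 0 ≤ ∑ j ∈ Finset.range n, ∑ k ∈ Finset.range n, w j (fun i => X i ω) *
      w k (fun i => X i ω) * autocov P Y (l • (X j ω - X k ω)) := fun ω =>
    Finset.sum_nonneg fun j _ => Finset.sum_nonneg fun k _ =>
      mul_nonneg (mul_nonneg (hwX j ω) (hwX k ω)) (hnn _)
  have e1 : ∫⁻ ω, ENNReal.ofReal ((∑ j ∈ Finset.range n,
        (square (X i ω) e).indicator 1 (X j ω) * Y (l • X j ω) ω) ^ 2) ∂P =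
      ∫⁻ ω, ENNReal.ofReal (∑ j ∈ Finset.range n, ∑ k ∈ Finset.range n, w j (fun i => X i ω) *
        w k (fun i => X i ω) * autocov P Y (l • (X j ω - X k ω))) ∂P := by
    rw [← ofReal_integral_eq_lintegral_ofReal (integrable_condExp.congr hce)
      (Eventually.of_forall hnn2), ← integral_congr_ae hce, integral_condExp hle]
    exact (ofReal_integral_eq_lintegral_ofReal hint (Eventually.of_forall fun _ => sq_nonneg _)).symm
  let H : Plane → ENNReal := fun u => ENNReal.ofReal (autocov P Y (l • u))
  have hHm : Measurable H := (hσm.comp (measurable_const_smul l)).ennreal_ofReal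
  have hHI : ∫⁻ u, H u = ENNReal.ofReal ((l ^ 2)⁻¹ * ∫ s, autocov P Y s) := by
    rw [ENNReal.ofReal_mul (by positivity), ofReal_integral_eq_lintegral_ofReal hσi
      (Eventually.of_forall hnn), ← lintegral_comp_smul hσm.ennreal_ofReal hl]
  have h := lintegral_pairs_inBlock_le ha hX he.le hHm n i
  have hH0 : H 0 = ENNReal.ofReal (autocov P Y 0) := by simp [H]
  rw [hHI, hH0] at h
  have hpt : ∀ ω, ENNReal.ofReal (∑ j ∈ Finset.range n, ∑ k ∈ Finset.range n,
      w j (fun i => X i ω) * w k (fun i => X i ω) * autocov P Y (l • (X j ω - X k ω))) =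
      ∑ j ∈ Finset.range n, ∑ k ∈ Finset.range n, inBlock e (X i ω) (X j ω) *
        inBlock e (X i ω) (X k ω) * H (X j ω - X k ω) := by
    intro ω
    rw [ENNReal.ofReal_sum_of_nonneg fun j _ => Finset.sum_nonneg fun k _ =>
      mul_nonneg (mul_nonneg (hwX j ω) (hwX k ω)) (hnn _)]
    refine Finset.sum_congr rfl fun j _ => ?_
    rw [ENNReal.ofReal_sum_of_nonneg fun k _ =>
      mul_nonneg (mul_nonneg (hwX j ω) (hwX k ω)) (hnn _)]
    refine Finset.sum_congr rfl fun k _ => ?_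
    by_cases hj : X j ω ∈ square (X i ω) e <;> by_cases hk : X k ω ∈ square (X i ω) e <;>
      simp [w, inBlock, H, hj, hk]
  rw [e1]
  simp only [hpt]
  refine h.trans (le_of_eq ?_)
  have hI0 : 0 ≤ ∫ s, autocov P Y s := integral_nonneg hnn
  have h00 := hnn 0
  rw [← ENNReal.ofReal_natCast, show (2 : ENNReal) = ENNReal.ofReal 2 by simp]
  rw [← ENNReal.ofReal_pow (by positivity)]
  repeat rw [← ENNReal.ofReal_mul (by positivity)]
  repeat rw [← ENNReal.ofReal_add (by positivity) (by positivity)]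
  congr 1; ring

/-! ### The bootstrap variance on a regular design -/

theorem ncard_mem_eq_countIn {Ω : Type u} (X : ℕ → Ω → Plane) (n : ℕ) (Q : Set Plane) (ω : Ω) :
    (({i : Fin n | X i ω ∈ Q} : Set (Fin n)).ncard : ℝ) = countIn X n Q ω := by
  classical
  rw [countIn, ← Fin.sum_univ_eq_sum_range fun j => Q.indicator (1 : Plane → ℝ) (X j ω),
    Set.ncard_eq_toFinset_card', Finset.card_eq_sum_ones]
  push_cast
  rw [Set.toFinset_ofPred, Finset.sum_filter]
  refine Finset.sum_congr rfl fun j _ => ?_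
  by_cases h : X j ω ∈ Q <;> simp [h]

/-- On a regular design the bootstrap variance is a small multiple of the averaged squared block
sums; the multiple is of order `a⁻²`. -/
theorem dssbbEstimator_le {Ω : Type u} {a : ℝ} (ha : 4 < a) (Y : Plane → Ω → ℝ)
    (X : ℕ → Ω → Plane) {n : ℕ} {l b : ℝ} (hl : 0 < l) (hb : 0 < b) (hn : (n : ℝ) = (l ^ 2) ^ 2)
    {m : ℕ} (hlb : l / b = 2 * m) {ω : Ω} (hreg : IsRegularAt a (b / l) n X ω)
    (hV : ∑ i ∈ Finset.range n, countIn X n (square (X i ω) (b / l)) ω ^ 2 ≤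
      20 * n * (a / 4 * (n * (b / l) ^ 2)) ^ 2) :
    dssbbEstimator Y X n l b ω ≤
      (8 / (n ^ 2 * b ^ 2) * ∑ i ∈ Finset.range n, (∑ j ∈ Finset.range n,
        (square (X i ω) (b / l)).indicator 1 (X j ω) * Y (l • X j ω) ω) ^ 2) *
      ((512 / a) ^ 2 + 2 ^ 19 * (b / l) ^ 2 +
        6 * a ^ 2 * ((512 / a) ^ 4 + 2 ^ 31 * (b / l) ^ 2)) := by
  have ha0 : 0 < a := by linarith
  have hn0 : (0 : ℝ) < n := by rw [hn]; positivity
  have hm : 1 ≤ m := by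
    rcases Nat.eq_zero_or_pos m with h | h
    · rw [h] at hlb
      have : 0 < l / b := by positivity
      simp at hlb
      rcases hlb with h | h <;> linarith
    · exact h
  have hK : (((2 * m) ^ 2 : ℕ) : ℝ) = l ^ 2 / b ^ 2 := by
    push_cast; rw [← hlb]; ring
  obtain ⟨h1, h2, h3⟩ := hreg
  set ν : ℝ := n * (b / l) ^ 2 with hν
  have hν' : ν = l ^ 2 * b ^ 2 := by rw [hν, hn]; field_simp
  have hν0 : 0 < ν := by rw [hν']; positivity
  have hblock : ∀ i : Fin n, ∑ j ∈ blockSites b (fun i : Fin n => l • X i ω) i,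
      Y (l • X j ω) ω = ∑ j ∈ Finset.range n,
        (square (X i ω) (b / l)).indicator 1 (X j ω) * Y (l • X j ω) ω := fun i =>
    sum_blockSites X hl ω i fun j => Y (l • X j ω) ω
  have h := dssbbVariance_le (l := l) (b := b) (n := n) (m := m)
    (by exact_mod_cast hn0) hm hlb (fun i : Fin n => l • X i ω) (fun i : Fin n => Y (l • X i ω) ω)
    (v₀ := ν / 32) (v₁ := a * (ν / 32)) (by positivity) (by positivity)
    (fun i hi => by
      rw [card_blockSites X hl]
      exact h1 _ ((mem_admissible_iff hl (fun i : Fin n => X i ω) i).1 hi))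
    (G := {i : Fin n | X i ω ∈ stripCorners a (b / l)})
    (fun i hi => (mem_admissible_iff hl (fun i : Fin n => X i ω) i).2
      (square_subset_of_mem_stripCorners ha hi (by positivity)).1)
    (fun i hi => by rw [card_blockSites X hl]; exact h2 _ hi)
    (by rw [ncard_mem_eq_countIn]; exact h3) rfl
  rw [dssbbEstimator]
  refine h.trans ?_
  simp only [hblock, card_blockSites X hl]
  rw [Fin.sum_univ_eq_sum_range fun i => (∑ j ∈ Finset.range n,
        (square (X i ω) (b / l)).indicator 1 (X j ω) * Y (l • X j ω) ω) ^ 2,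
    Fin.sum_univ_eq_sum_range fun i =>
      max (countIn X n (square (X i ω) (b / l)) ω) (ν / 32) ^ 2, hK]
  set W := ∑ i ∈ Finset.range n, (∑ j ∈ Finset.range n,
        (square (X i ω) (b / l)).indicator 1 (X j ω) * Y (l • X j ω) ω) ^ 2 with hW
  have hW0 : 0 ≤ W := Finset.sum_nonneg fun _ _ => sq_nonneg _
  set V := ∑ i ∈ Finset.range n, max (countIn X n (square (X i ω) (b / l)) ω) (ν / 32) ^ 2
  have hVV : V ≤ 3 / 2 * a ^ 2 * n * ν ^ 2 := by
    have e1 : V ≤ ∑ i ∈ Finset.range n,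
        (countIn X n (square (X i ω) (b / l)) ω ^ 2 + (ν / 32) ^ 2) := by
      refine Finset.sum_le_sum fun i _ => ?_
      rcases max_cases (countIn X n (square (X i ω) (b / l)) ω) (ν / 32) with ⟨h, -⟩ | ⟨h, -⟩ <;>
        rw [h]
      · exact le_add_of_nonneg_right (sq_nonneg _)
      · exact le_add_of_nonneg_left (sq_nonneg _)
    rw [Finset.sum_add_distrib, Finset.sum_const, Finset.card_range, nsmul_eq_mul] at e1
    have e2 : 0 ≤ n * ν ^ 2 := by positivity
    have e3 : n * ν ^ 2 * 16 ≤ n * ν ^ 2 * a ^ 2 := by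
      refine mul_le_mul_of_nonneg_left ?_ e2
      nlinarith
    nlinarith
  -- the pooled block counts are of order `a * n` on good draws, and of order `n` always
  have hA : l ^ 2 / b ^ 2 / 16 * (a * (ν / 32)) = a * n / 512 := by
    rw [hν', hn]; field_simp; norm_num
  have hB : l ^ 2 / b ^ 2 / 2 * (ν / 32) = n / 64 := by
    rw [hν', hn]; field_simp; norm_num
  rw [hA, hB]
  have hVK : (l ^ 2 / b ^ 2) ^ 2 / n ^ 2 * (4 / n * V) ≤ 6 * a ^ 2 := by
    have e4 : (l ^ 2 / b ^ 2) ^ 2 / n ^ 2 * (4 / n * (3 / 2 * a ^ 2 * n * ν ^ 2)) = 6 * a ^ 2 := by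
      rw [hν', hn]; field_simp; norm_num
    rw [← e4]
    gcongr
  have e5 : l ^ 2 * (2 * (l ^ 2 / b ^ 2) * (4 / n * W) *
        (((a * n / 512) ^ 2)⁻¹ + ((n / 64 : ℝ) ^ 2)⁻¹ * (128 / (l ^ 2 / b ^ 2))) +
      2 * (l ^ 2 / b ^ 2) ^ 3 * (4 / n * V) * (4 / n * W) *
        (((a * n / 512) ^ 4)⁻¹ + ((n / 64 : ℝ) ^ 4)⁻¹ * (128 / (l ^ 2 / b ^ 2)))) =
      8 / (n ^ 2 * b ^ 2) * W * ((512 / a) ^ 2 + 2 ^ 19 * (b / l) ^ 2 +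
        4 * ((l ^ 2 / b ^ 2) ^ 2 / n ^ 2 * (4 / n * V)) / 4 *
          ((512 / a) ^ 4 + 2 ^ 31 * (b / l) ^ 2)) := by
    rw [hn]; field_simp; ring
  rw [e5]
  gcongr
  linarith

/-- Markov's inequality, at four times the mean. -/
theorem measure_gt_four_mul_le {Ω : Type u} [MeasurableSpace Ω] {P : Measure Ω} {f : Ω → ℝ}
    (hf : Measurable f) {t : ℝ} (ht : 0 < t)
    (h : ∫⁻ ω, ENNReal.ofReal (f ω) ∂P ≤ ENNReal.ofReal t) :
    P {ω | 4 * t < f ω} ≤ ENNReal.ofReal (1 / 4) := by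
  have h1 := meas_ge_le_lintegral_div (μ := P) hf.ennreal_ofReal.aemeasurable
    (ε := ENNReal.ofReal (4 * t)) (by simpa using ht) ENNReal.ofReal_ne_top
  have h2 : {ω | 4 * t < f ω} ⊆ {ω | ENNReal.ofReal (4 * t) ≤ ENNReal.ofReal (f ω)} := fun ω hω =>
    ENNReal.ofReal_le_ofReal (le_of_lt hω)
  refine (measure_mono h2).trans (h1.trans ((ENNReal.div_le_div_right h _).trans (le_of_eq ?_)))
  rw [← ENNReal.ofReal_div_of_pos (by positivity)]
  congr 1; field_simp

theorem le_integral_sq_designDensity {a : ℝ} (ha : 4 < a) [IsProbabilityMeasure (designLaw a)] :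
    a / 8 ≤ ∫ s, designDensity a s ^ 2 := by
  have ha0 : 0 < a := by linarith
  have h1a : 1 / a < 1 / 4 := one_div_lt_one_div_of_lt (by norm_num) ha
  have h0a : 0 < 1 / a := by positivity
  set S : Set Plane := Set.Icc (-(1 / a)) (1 / a) ×ˢ Set.Ioo (-1 / 2) (1 / 2) with hS
  have hSm : MeasurableSet S := measurableSet_Icc.prod measurableSet_Ioo
  have hvol : volume.real S = 2 / a := by
    rw [Measure.real, hS, Measure.volume_eq_prod, Measure.prod_prod, Real.volume_Icc,
      Real.volume_Ioo, ENNReal.toReal_mul, ENNReal.toReal_ofReal (by linarith),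
      ENNReal.toReal_ofReal (by norm_num)]
    ring
  have hint : Integrable (fun s => designDensity a s ^ 2) := by
    simpa [sq] using integrable_mul_designDensity ha (integrable_designDensity ha) measurable_id
  have h1 : ∫ _ in S, (a / 4) ^ 2 ≤ ∫ s in S, designDensity a s ^ 2 := by
    refine le_of_eq (setIntegral_congr_fun hSm fun x hx => ?_)
    obtain ⟨⟨h1, h2⟩, ⟨h3, h4⟩⟩ := hx
    rw [designDensity_eq_of_strip ha ⟨⟨by linarith, by linarith⟩, ⟨h3, h4⟩⟩ (abs_le.2 ⟨h1, h2⟩)]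
  have h2 := setIntegral_le_integral (s := S) hint (Eventually.of_forall fun s => sq_nonneg _)
  rw [setIntegral_const, hvol, smul_eq_mul] at h1
  refine le_trans (le_of_eq ?_) (h1.trans h2)
  field_simp; norm_num

/-! ### The bootstrap variance is too small with positive probability -/

/-- The normalized average of the squared block sums has mean at most `a² ∫ σ`: the contribution of
distinct triples of sites is half of that, and `hsmall` bounds the rest. -/
theorem lintegral_blockSums_le {Ω : Type u} [MeasurableSpace Ω] {P : Measure Ω}
    [IsProbabilityMeasure P] {a : ℝ} (ha : 4 < a) {Y : Plane → Ω → ℝ} {X : ℕ → Ω → Plane}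
    (hY : IsMixingField P Y) (hX : IsDesign a P X) (hYX : IsMeasurableIndep P Y X)
    (hnn : ∀ s, 0 ≤ autocov P Y s) {n : ℕ} {l b : ℝ} (hl : 0 < l) (hb : 0 < b)
    (hn : (n : ℝ) = (l ^ 2) ^ 2)
    (hsmall : autocov P Y 0 * (8 * (l⁻¹ ^ 4 * b⁻¹ ^ 2) + 2 * a * l⁻¹ ^ 2) +
      4 * a * (l⁻¹ ^ 2 * b⁻¹ ^ 2) * ∫ s, autocov P Y s ≤ a ^ 2 / 2 * ∫ s, autocov P Y s) :
    ∫⁻ ω, ENNReal.ofReal (8 / (n ^ 2 * b ^ 2) * ∑ i ∈ Finset.range n, (∑ j ∈ Finset.range n,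
        (square (X i ω) (b / l)).indicator 1 (X j ω) * Y (l • X j ω) ω) ^ 2) ∂P ≤
      ENNReal.ofReal (a ^ 2 * ∫ s, autocov P Y s) := by
  have hn0 : (0 : ℝ) < n := by rw [hn]; positivity
  simp only [ENNReal.ofReal_mul (show (0 : ℝ) ≤ 8 / (n ^ 2 * b ^ 2) by positivity),
    ENNReal.ofReal_sum_of_nonneg fun _ _ => sq_nonneg _]
  have hm := measurable_uncurry_of_isMeasurableIndep hYX
  have hYm : ∀ j, Measurable fun ω => Y (l • X j ω) ω := fun j =>
    hm.comp (((hX.measurable j).const_smul l).prodMk measurable_id)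
  have hSm : ∀ i, Measurable fun ω => ENNReal.ofReal ((∑ j ∈ Finset.range n,
      (square (X i ω) (b / l)).indicator 1 (X j ω) * Y (l • X j ω) ω) ^ 2) := fun i =>
    ((Finset.measurable_fun_sum _ fun j _ => ((measurable_indicator_square (b / l)).comp
      ((hX.measurable i).prodMk (hX.measurable j))).mul (hYm j)).pow_const 2).ennreal_ofReal
  rw [lintegral_const_mul _ (Finset.measurable_fun_sum _ fun i _ => hSm i),
    lintegral_finsetSum _ fun i _ => hSm i]
  refine (mul_le_mul_right (Finset.sum_le_card_nsmul _ _ _ fun i _ =>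
    lintegral_sq_blockSum_le ha hY hX hYX hnn (by positivity : 0 < b / l) hl n i) _).trans ?_
  rw [Finset.card_range, nsmul_eq_mul, ← ENNReal.ofReal_natCast,
    ← ENNReal.ofReal_mul (by positivity), ← ENNReal.ofReal_mul (by positivity)]
  refine ENNReal.ofReal_le_ofReal ?_
  have e1 : 8 / ((n : ℝ) ^ 2 * b ^ 2) * (n * (autocov P Y 0 * (1 + a / 4 * (n * (b / l) ^ 2)) +
      (2 * (a / 4) * n + (a / 4) ^ 2 * (n ^ 2 * (b / l) ^ 2)) *
        ((l ^ 2)⁻¹ * ∫ s, autocov P Y s))) =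
      autocov P Y 0 * (8 * (l⁻¹ ^ 4 * b⁻¹ ^ 2) + 2 * a * l⁻¹ ^ 2) +
        4 * a * (l⁻¹ ^ 2 * b⁻¹ ^ 2) * (∫ s, autocov P Y s) +
        a ^ 2 / 2 * ∫ s, autocov P Y s := by
    rw [hn]; field_simp; ring
  rw [e1]
  linarith

/-- For `a = 2 ^ 46` the estimator exceeds half of its target with probability at most `3 / 4`
eventually: irregular designs and two applications of Markov's inequality account for `1 / 4`
each. -/
theorem limsup_measure_dssbbEstimator_gt_lt_one {Ω : Type u} [MeasurableSpace Ω] {P : Measure Ω}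
    [IsProbabilityMeasure P] {a : ℝ} (ha : a = 2 ^ 46) {Y : Plane → Ω → ℝ} {X : ℕ → Ω → Plane}
    {lam b : ℕ → ℝ} (hY : IsMixingField P Y) (hX : IsDesign a P X) (hYX : IsMeasurableIndep P Y X)
    (hlam : IsScaling lam) (hb : IsBlockLength lam b) (h0 : autocov P Y 0 ≠ 0)
    (hnn : ∀ s, 0 ≤ autocov P Y s) :
    limsup (fun n : ℕ => P {ω | dssbbEstimator Y X n (lam n) (b n) ω >
      1 / 2 * sigmaInftySq a P Y}) atTop < 1 := by
  have ha4 : 4 < a := by rw [ha]; norm_num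
  have ha0 : 0 < a := by linarith
  have hm := measurable_uncurry_of_isMeasurableIndep hYX
  have hprob := isProbabilityMeasure_designLaw hX
  set S := ∫ s, autocov P Y s with hS
  have hSpos : 0 < S := integral_autocov_pos hY hm h0 hnn
  have hsig : S * (a / 8) ≤ sigmaInftySq a P Y :=
    mul_le_mul_of_nonneg_left (le_integral_sq_designDensity ha4) hSpos.le
  -- everything is governed by the three parameters `1 / λ`, `1 / b`, `b / λ`, which tend to zero
  have hpos : ∀ᶠ n : ℕ in atTop, 0 < lam n ∧ 0 < b n :=
    (eventually_ge_atTop 1).mono fun n hn => ⟨(hlam n hn).1, hb.pos n hn⟩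
  have tl : Tendsto (fun n => (lam n)⁻¹) atTop (𝓝 0) :=
    tendsto_inv_atTop_zero.comp (tendsto_scaling hlam)
  have tb : Tendsto (fun n => (b n)⁻¹) atTop (𝓝 0) := by
    refine squeeze_zero' (hpos.mono fun n h => ?_) (hpos.mono fun n h => ?_) hb.tendsto
    · exact inv_nonneg.2 h.2.le
    · exact le_add_of_nonneg_right (div_nonneg h.2.le h.1.le)
  have te : Tendsto (fun n => b n / lam n) atTop (𝓝 0) := by
    refine squeeze_zero' (hpos.mono fun n h => ?_) (hpos.mono fun n h => ?_) hb.tendsto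
    · exact div_nonneg h.2.le h.1.le
    · exact le_add_of_nonneg_left (inv_nonneg.2 h.2.le)
  have key : ∀ (F : ℝ × ℝ × ℝ → ℝ), Continuous F → ∀ r, F (0, 0, 0) < r →
      ∀ᶠ n in atTop, F ((lam n)⁻¹, (b n)⁻¹, b n / lam n) < r := fun F hF r hr =>
    ((hF.tendsto _).comp (tl.prodMk_nhds (tb.prodMk_nhds te))).eventually_lt_const hr
  have c1 := key (fun p => 1024 * p.2.1 ^ 4 + 48 * p.1 ^ 4) (by fun_prop) (1 / 4) (by norm_num)
  have c2 := key (fun p => 8 * (a * p.2.2)) (by fun_prop) 1 (by norm_num)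
  have c3 := key (fun p => (p.1 * p.2.1) ^ 4 + 9 * (a / 4) * (p.1 * p.2.1) ^ 2) (by fun_prop)
    ((a / 4) ^ 2) (by simp; positivity)
  have c4 := key (fun p => 4 * a ^ 2 * (2 ^ 19 * p.2.2 ^ 2 + 6 * a ^ 2 * (2 ^ 31 * p.2.2 ^ 2)))
    (by fun_prop) (2 ^ 40) (by norm_num)
  have c5 := key (fun p => autocov P Y 0 * (8 * (p.1 ^ 4 * p.2.1 ^ 2) + 2 * a * p.1 ^ 2) +
      4 * a * (p.1 ^ 2 * p.2.1 ^ 2) * S) (by fun_prop) (a ^ 2 / 2 * S) (by simp; positivity)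
  refine lt_of_le_of_lt (limsup_le_of_le (a := ENNReal.ofReal (3 / 4)) (by isBoundedDefault) ?_)
    (by rw [ENNReal.ofReal_lt_one]; norm_num)
  filter_upwards [c1, c2, c3, c4, c5, eventually_ge_atTop 1] with n c1 c2 c3 c4 c5 hn
  obtain ⟨hl, hn4⟩ := hlam n hn
  have hbn := hb.pos n hn
  obtain ⟨m, hlb⟩ := hb.even n hn
  set l := lam n
  set β := b n
  have hn0 : (0 : ℝ) < n := by exact_mod_cast hn
  have he : 0 < β / l := by positivity
  have hme : β / l * (2 * m) = 1 := by rw [← hlb]; field_simp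
  set ν : ℝ := n * (β / l) ^ 2 with hν
  have hν' : ν = l ^ 2 * β ^ 2 := by rw [hν, hn4]; field_simp
  have hν0 : 0 < ν := by rw [hν']; positivity
  have p1 : P {ω | ¬ IsRegularAt a (β / l) n X ω} ≤ ENNReal.ofReal (1 / 4) := by
    refine (measure_not_isRegularAt_le ha4 hX hn he hme c2.le).trans ?_
    rw [← ENNReal.ofReal_add (by positivity) (by positivity)]
    refine ENNReal.ofReal_le_ofReal (le_trans (le_of_eq ?_) c1.le)
    rw [hn4]; field_simp
  have hwm : ∀ i j, Measurable fun ω =>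
      (square (X i ω) (β / l)).indicator (1 : Plane → ℝ) (X j ω) := fun i j =>
    (measurable_indicator_square (β / l)).comp ((hX.measurable i).prodMk (hX.measurable j))
  have p2 : P {ω | 4 * (n * (5 * (a / 4 * ν) ^ 2)) < ∑ i ∈ Finset.range n,
      countIn X n (square (X i ω) (β / l)) ω ^ 2} ≤ ENNReal.ofReal (1 / 4) := by
    have hcm : ∀ i, Measurable fun ω => countIn X n (square (X i ω) (β / l)) ω ^ 2 := fun i =>
      (Finset.measurable_fun_sum _ fun j _ => hwm i j).pow_const 2
    refine measure_gt_four_mul_le (Finset.measurable_fun_sum _ fun i _ => hcm i) (by positivity) ?_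
    simp only [ENNReal.ofReal_sum_of_nonneg fun _ _ => sq_nonneg _]
    rw [lintegral_finsetSum _ fun i _ => (hcm i).ennreal_ofReal]
    refine (Finset.sum_le_card_nsmul _ _ _ fun i _ =>
      lintegral_sq_countIn_le ha4 hX he n i).trans ?_
    rw [Finset.card_range, nsmul_eq_mul, ← ENNReal.ofReal_natCast,
      ← ENNReal.ofReal_mul (by positivity)]
    refine ENNReal.ofReal_le_ofReal (mul_le_mul_of_nonneg_left ?_ hn0.le)
    have h1 : 1 + 9 * (a / 4 * ν) ≤ (a / 4 * ν) ^ 2 := by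
      have h2 := mul_le_mul_of_nonneg_right c3.le (sq_nonneg ν)
      have h3 : ((l⁻¹ * β⁻¹) ^ 4 + 9 * (a / 4) * (l⁻¹ * β⁻¹) ^ 2) * ν ^ 2 =
          1 + 9 * (a / 4 * ν) := by
        rw [hν']; field_simp
      rw [← h3, mul_pow (a / 4) ν]
      exact h2
    linarith
  have p3 := measure_gt_four_mul_le (P := P) (f := fun ω => 8 / (n ^ 2 * β ^ 2) *
    ∑ i ∈ Finset.range n, (∑ j ∈ Finset.range n,
        (square (X i ω) (β / l)).indicator 1 (X j ω) * Y (l • X j ω) ω) ^ 2)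
    ((Finset.measurable_fun_sum _ fun i _ => (Finset.measurable_fun_sum _ fun j _ =>
      (hwm i j).mul (hm.comp (((hX.measurable j).const_smul l).prodMk measurable_id))).pow_const
      2).const_mul _) (by positivity : 0 < a ^ 2 * S)
    (lintegral_blockSums_le ha4 hY hX hYX hnn hl hbn hn4 c5.le)
  have hsub : {ω | dssbbEstimator Y X n l β ω > 1 / 2 * sigmaInftySq a P Y} ⊆
      {ω | ¬ IsRegularAt a (β / l) n X ω} ∪
      {ω | 4 * (n * (5 * (a / 4 * ν) ^ 2)) < ∑ i ∈ Finset.range n,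
        countIn X n (square (X i ω) (β / l)) ω ^ 2} ∪
      {ω | 4 * (a ^ 2 * S) < 8 / (n ^ 2 * β ^ 2) * ∑ i ∈ Finset.range n, (∑ j ∈ Finset.range n,
        (square (X i ω) (β / l)).indicator 1 (X j ω) * Y (l • X j ω) ω) ^ 2} := by
    intro ω hω
    by_contra hc
    simp only [Set.mem_union, Set.mem_ofPred_eq, not_or, not_not, not_lt] at hc
    obtain ⟨⟨hr, hv⟩, hu⟩ := hc
    have h := dssbbEstimator_le ha4 Y X hl hbn hn4 hlb hr (hv.trans (le_of_eq (by ring)))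
    have hω' : 1 / 2 * sigmaInftySq a P Y < dssbbEstimator Y X n l β ω := hω
    have hβ : 0 ≤ (512 / a) ^ 2 + 2 ^ 19 * (β / l) ^ 2 +
        6 * a ^ 2 * ((512 / a) ^ 4 + 2 ^ 31 * (β / l) ^ 2) := by positivity
    have h2 := h.trans (mul_le_mul_of_nonneg_right hu hβ)
    have h3 : 4 * a ^ 2 * ((512 / a) ^ 2 + 2 ^ 19 * (β / l) ^ 2 +
        6 * a ^ 2 * ((512 / a) ^ 4 + 2 ^ 31 * (β / l) ^ 2)) =
        4 * 512 ^ 2 + 24 * 512 ^ 4 +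
        4 * a ^ 2 * (2 ^ 19 * (β / l) ^ 2 + 6 * a ^ 2 * (2 ^ 31 * (β / l) ^ 2)) := by
      field_simp; ring
    have h4 : 4 * a ^ 2 * ((512 / a) ^ 2 + 2 ^ 19 * (β / l) ^ 2 +
        6 * a ^ 2 * ((512 / a) ^ 4 + 2 ^ 31 * (β / l) ^ 2)) ≤ a / 16 := by
      rw [h3]
      -- this inequality dictates the size of `a`
      have h5 : (4 * 512 ^ 2 + 24 * 512 ^ 4 + 2 ^ 40 : ℝ) ≤ a / 16 := by rw [ha]; norm_num
      linarith
    have h6 := mul_le_mul_of_nonneg_left h4 hSpos.le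
    linarith
  refine (measure_mono hsub).trans ((measure_union_le _ _).trans ((add_le_add
    ((measure_union_le _ _).trans (add_le_add p1 p2)) p3).trans (le_of_eq ?_)))
  rw [← ENNReal.ofReal_add (by norm_num) (by norm_num), ← ENNReal.ofReal_add (by norm_num)
    (by norm_num)]
  norm_num

end SpatialBootstrap

end

theorem proposition1 :
    (∀ a : ℝ, 4 < a →
      ∀ (Ω : Type u) [MeasurableSpace Ω] (P : Measure Ω) [IsProbabilityMeasure P]
        (Y : SpatialBootstrap.Plane → Ω → ℝ) (X : ℕ → Ω → SpatialBootstrap.Plane) (lam : ℕ → ℝ),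
        SpatialBootstrap.IsMixingField P Y →
        SpatialBootstrap.IsDesign a P X →
        SpatialBootstrap.IsMeasurableIndep P Y X →
        SpatialBootstrap.IsScaling lam →
        Integrable (SpatialBootstrap.autocov P Y) ∧
        ∀ᵐ ω ∂P, Tendsto (fun n : ℕ => SpatialBootstrap.scaledCondVar P Y X n (lam n) ω) atTop
          (𝓝 (SpatialBootstrap.sigmaInftySq a P Y))) ∧
    ∃ a : ℝ, 4 < a ∧ ∃ η : ℝ, 0 < η ∧ η < 1 ∧
      ∀ (Ω : Type u) [MeasurableSpace Ω] (P : Measure Ω) [IsProbabilityMeasure P]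
        (Y : SpatialBootstrap.Plane → Ω → ℝ) (X : ℕ → Ω → SpatialBootstrap.Plane)
        (lam b : ℕ → ℝ),
        SpatialBootstrap.IsMixingField P Y →
        SpatialBootstrap.IsDesign a P X →
        SpatialBootstrap.IsMeasurableIndep P Y X →
        SpatialBootstrap.IsScaling lam →
        SpatialBootstrap.IsBlockLength lam b →
        SpatialBootstrap.autocov P Y 0 ≠ 0 →
        (∀ s, 0 ≤ SpatialBootstrap.autocov P Y s) →
        limsup (fun n : ℕ => P {ω | SpatialBootstrap.dssbbEstimator Y X n (lam n) (b n) ω >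
          η * SpatialBootstrap.sigmaInftySq a P Y}) atTop < 1 := by
  refine ⟨fun a ha Ω _ P _ Y X lam hY hX hYX hlam => ⟨SpatialBootstrap.integrable_autocov hY
    (SpatialBootstrap.measurable_uncurry_of_isMeasurableIndep hYX),
    SpatialBootstrap.ae_tendsto_scaledCondVar ha hY hX hYX hlam⟩, 2 ^ 46, by norm_num, 1 / 2,
    by norm_num, by norm_num, fun Ω _ P _ Y X lam b hY hX hYX hlam hb h0 hnn => ?_⟩
  -- the witness `a = 2 ^ 46` has to absorb the numerical constants of the bootstrap bound
  exact SpatialBootstrap.limsup_measure_dssbbEstimator_gt_lt_one rfl hY hX hYX hlam hb h0 hnn
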